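/- For $n\in\mathbb{N}$ write $[n]=\{1,\dots,n\}$ and, for $p\in[0,1]$, let $[n]_p$ be the random subset of $[n]$ that contains each element independently with probability $p$. A $q$-AP is a set $\{a,a+d,\dots,a+(q-1)d\}$ with $d>0$. Let $H(n,q_1,q_2)$ be the hypergraph with vertex set $[n]$ whose edges are all $q_1$-APs and all $q_2$-APs contained in $[n]$, and let $H(n,q_1,q_2,p)$ be its random subhypergraph induced by $[n]_p$ (its vertices are the elements of $[n]_p$, its edges those edges of $H(n,q_1,q_2)$ that are contained in $[n]_p$). Call such a hypergraph asymmetrically 2-colorable if its vertices can be colored red and blue so that no edge of size $q_1$ is entirely red and no edge of size $q_2$ is entirely blue. Theorem. For any integers $q_1>q_2\ge 3$ there exists $c>0$ such that for every sequence $p=p(n)\in[0,1]$ with $p(n)\le c\, n^{-\frac{q_2}{q_1(q_2-1)}}$ for all sufficiently large $n$, $H(n,q_1,q_2,p(n))$ is asymmetrically 2-colorable a.a.s.; that is, $$\lim_{n\to\infty}\mathbb{P}\bigl(H(n,q_1,q_2,p(n))\text{ is asymmetrically 2-colorable}\bigr)=1 .$$ In other words, a.a.s. $[n]_{p(n)}$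 can be colored red/blue with no red $q_1$-AP and no blue $q_2$-AP. -/

import Mathlib

open Filter Topology ProbabilityTheory
open scoped unitInterval

/-- `e` is an arithmetic progression of length `q` (a `q`-AP) of natural numbers, with positive
common difference. -/
def IsArithProg (q : ℕ) (e : Set ℕ) : Prop :=
  ∃ a d : ℕ, 0 < d ∧ e = {x | ∃ i < q, x = a + i * d}

namespace Hypergraph

/-- The subhypergraph of `H` induced by a set `S` of vertices: its edges are the edges of `H`
all of whose vertices lie in `S`. -/
def inducedOn {α : Type*} (H : Hypergraph α) (S : Set α) : Hypergraph α where
  vertexSet := H.vertexSet ∩ S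
  edgeSet := {e | e ∈ H.edgeSet ∧ e ⊆ S}
  subset_vertexSet_of_mem_edgeSet' := fun _ he =>
    Set.subset_inter (H.subset_vertexSet_of_mem_edgeSet' he.1) he.2

/-- A hypergraph whose edges have cardinality `q₁` (long edges) or `q₂` (short edges) is
asymmetrically 2-colorable if its vertices can be colored red or blue with no red long edge and no
blue short edge. The set of red vertices is `R`, the set of blue ones its complement in the vertex
set. -/
def AsymTwoColorable {α : Type*} (q₁ q₂ : ℕ) (H : Hypergraph α) : Prop :=
  ∃ R ⊆ H.vertexSet, ∀ e ∈ H.edgeSet,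
    (e.ncard = q₁ → ¬ e ⊆ R) ∧ (e.ncard = q₂ → ¬ e ⊆ H.vertexSet \ R)

end Hypergraph

/-- The hypergraph `H(n, q₁, q₂)` on `[n] = {1, …, n}` whose edges are the arithmetic progressions
of lengths `q₁` and `q₂` contained in `[n]`. -/
def apHypergraph (n q₁ q₂ : ℕ) : Hypergraph ℕ where
  vertexSet := Set.Icc 1 n
  edgeSet := {e | e ⊆ Set.Icc 1 n ∧ (IsArithProg q₁ e ∨ IsArithProg q₂ e)}
  subset_vertexSet_of_mem_edgeSet' := fun _ he => he.1

/-- The probability that `H(n, q₁, q₂, p)`, the subhypergraph of `H(n, q₁, q₂)` induced by the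
random set `[n]_p` (which contains each element of `[n]` independently with probability `p`), is
asymmetrically 2-colorable. -/
noncomputable def probAsymTwoColorable (n q₁ q₂ : ℕ) (p : I) : ℝ :=
  (setBernoulli (Set.Icc 1 n) p).real
    {S | ((apHypergraph n q₁ q₂).inducedOn S).AsymTwoColorable q₁ q₂}

/-! Write `k = q₂` and `l = q₁`. The exponent `al k l = k / (l (k - 1))` makes one extension
balanced: a `k`-AP through a given point, with an `l`-AP through each of its other `k - 1` points,
has `k` degrees of freedom and `l (k - 1)` new points. In general `rk k l A B` is the dimension of
the space of functions on `B` that, extended by zero, are affine on the progressions of `A ∪ B`.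
There are `O(n ^ rk)` sets of given size and rank over `A` (`card_le_of_rk_le`), so `rk - al * |B|`
governs their expected number in the random set.

A non-colorable set contains a minimal one, `V`. It splits into blocks, the components of its
hypergraph of `l`-APs. Start from a block, which contributes at most about `n ^ (1 - ga)`, and
repeatedly follow a `k`-AP that leaves the current set `A`, adding all blocks that it meets outside
`A`. By `exists_extension` a step is dead (so poor in degrees of freedom that it outweighs the
start), or sparse (it gains a power of `n`), or balanced (it gains only a factor proportional to
`c`). Without a dead step the growth continues for about `log n` steps, and the first moment then
tends to `0`.

Choosing the point of `A` where the next `k`-AP leaves costs a factor `|A|`, of order `log n`, which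
a constant cannot pay for. But a balanced step yields an unsaturated set, and from such a set one
can leave through an unsaturated point fixed in advance. A choice is needed only at saturated sets,
which are starting sets or results of sparse steps, and the power of `n` pays for the latter. The
weight `wt` does this accounting.

The growth must not exhaust `V`. If it did, the absence of a dead step would leave some block
attached to the rest of `V` at one point only. By `not_attached_at_point`, some part of that block
could then be recolored: it has so few points that at most `k - 2` of them meet all its `l`-APs
(`exists_small_transversal`). Those points become blue and the rest of the part red, and this is
compatible with a coloring of the remainder of `V`. -/

namespace AsymVdW

open Finset

/-! ### Progressions, colorings and minimal non-colorable sets. -/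

/-- The arithmetic progression `a, a + d, …, a + (q - 1) d`. -/
def ap (q a d : ℕ) : Finset ℕ := (range q).image fun i => a + i * d

/-- `e` is an arithmetic progression of length `q` with positive difference. -/
def IsAP (q : ℕ) (e : Finset ℕ) : Prop := ∃ a d, 0 < d ∧ e = ap q a d

/-- `V` can be split into a part without `l`-APs and a part without `k`-APs. -/
def Colorable (k l : ℕ) (V : Finset ℕ) : Prop :=
  ∃ R ⊆ V, (∀ e, IsAP l e → ¬ e ⊆ R) ∧ ∀ e, IsAP k e → ¬ e ⊆ V \ R

/-- `V` is a minimal set that is not colorable. -/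
def MinimalNonColorable (k l : ℕ) (V : Finset ℕ) : Prop :=
  ¬ Colorable k l V ∧ ∀ W, W ⊂ V → Colorable k l W

/-- Each `x ∈ A` is the only common point of some `l`-AP and some `k`-AP inside `A`. -/
def Saturated (k l : ℕ) (A : Finset ℕ) : Prop :=
  ∀ x ∈ A, ∃ e f, IsAP l e ∧ IsAP k f ∧ e ⊆ A ∧ f ⊆ A ∧ e ∩ f = {x}

lemma mem_ap {q a d x : ℕ} : x ∈ ap q a d ↔ ∃ i < q, a + i * d = x := by
  simp [ap]

lemma card_ap {q a d : ℕ} (hd : 0 < d) : (ap q a d).card = q := by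
  rw [ap, card_image_of_injective, card_range]
  intro i j h
  have : i * d = j * d := by simpa using h
  exact Nat.eq_of_mul_eq_mul_right hd this

lemma IsAP.card {q : ℕ} {e : Finset ℕ} (h : IsAP q e) : e.card = q := by
  obtain ⟨a, d, hd, rfl⟩ := h
  exact card_ap hd

lemma IsAP.nonempty {q : ℕ} {e : Finset ℕ} (h : IsAP q e) (hq : 0 < q) : e.Nonempty := by
  rw [← card_pos, h.card]
  exact hq

lemma isArithProg_coe {q : ℕ} {e : Finset ℕ} : IsArithProg q (e : Set ℕ) ↔ IsAP q e := by
  constructor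
  · rintro ⟨a, d, hd, h⟩
    refine ⟨a, d, hd, ?_⟩
    ext x
    rw [← mem_coe, h, mem_ap]
    simp [eq_comm]
  · rintro ⟨a, d, hd, rfl⟩
    refine ⟨a, d, hd, ?_⟩
    ext x
    rw [mem_coe, mem_ap]
    simp [eq_comm]

lemma exists_minimalNonColorable {k l : ℕ} {X : Finset ℕ} (h : ¬ Colorable k l X) :
    ∃ V ⊆ X, MinimalNonColorable k l V := by
  induction X using Finset.strongInduction with
  | H X ih =>
    by_cases hX : ∀ W, W ⊂ X → Colorable k l W
    · exact ⟨X, Subset.rfl, h, hX⟩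
    · push Not at hX
      obtain ⟨W, hW, hc⟩ := hX
      obtain ⟨V, hV, hm⟩ := ih W hW hc
      exact ⟨V, hV.trans hW.subset, hm⟩

/-- Color `V` without `x`. Making `x` red must create a red `l`-AP, and making it blue a blue
`k`-AP. Both pass through `x`, and their other points have different colors. -/
lemma MinimalNonColorable.saturated {k l : ℕ} {V : Finset ℕ}
    (h : MinimalNonColorable k l V) : Saturated k l V := by
  intro x hx
  obtain ⟨R, hR, hl, hk⟩ := h.2 (V.erase x) (erase_ssubset hx)
  have hxR : x ∉ R := fun h => by simpa using hR h
  have h1 : ∃ e, IsAP l e ∧ e ⊆ insert x R := by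
    by_contra! hc
    refine h.1 ⟨insert x R, insert_subset hx (hR.trans (erase_subset _ _)), hc, ?_⟩
    intro e he hs
    refine hk e he fun y hy => ?_
    have := hs hy
    simp only [Finset.mem_sdiff, mem_insert, not_or, mem_erase] at this ⊢
    tauto
  have h2 : ∃ f, IsAP k f ∧ f ⊆ V \ R := by
    by_contra! hc
    exact h.1 ⟨R, hR.trans (erase_subset _ _), hl, hc⟩
  obtain ⟨e, he, hes⟩ := h1
  obtain ⟨f, hf, hfs⟩ := h2
  have hxe : x ∈ e := by
    by_contra hc
    exact hl e he fun y hy => by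
      have := hes hy
      rw [mem_insert] at this
      rcases this with rfl | h
      · exact absurd hy hc
      · exact h
  have hxf : x ∈ f := by
    by_contra hc
    refine hk f hf fun y hy => ?_
    have := hfs hy
    simp only [Finset.mem_sdiff, mem_erase] at this ⊢
    refine ⟨⟨?_, this.1⟩, this.2⟩
    rintro rfl
    exact hc hy
  refine ⟨e, f, he, hf, hes.trans (insert_subset hx (hR.trans (erase_subset _ _))),
    hfs.trans sdiff_subset, ?_⟩
  ext y
  simp only [mem_inter, mem_singleton]
  constructor
  · rintro ⟨h1, h2⟩
    have h1 := hes h1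
    have h2 := hfs h2
    simp only [Finset.mem_sdiff, mem_insert] at h1 h2
    tauto
  · rintro rfl
    exact ⟨hxe, hxf⟩

open scoped Classical in
lemma asymTwoColorable_of_colorable {n q₁ q₂ : ℕ} (h₁₂ : q₁ ≠ q₂) {S : Set ℕ}
    (h : Colorable q₂ q₁ ((Icc 1 n).filter (· ∈ S))) :
    ((apHypergraph n q₁ q₂).inducedOn S).AsymTwoColorable q₁ q₂ := by
  obtain ⟨R, hR, hl, hk⟩ := h
  have hV : ((apHypergraph n q₁ q₂).inducedOn S).vertexSet
      = (((Icc 1 n).filter (· ∈ S) : Finset ℕ) : Set ℕ) := by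
    ext x
    simp [Hypergraph.inducedOn, apHypergraph]
  refine ⟨R, by rw [hV]; exact_mod_cast hR, ?_⟩
  rintro e ⟨⟨he1, he2⟩, -⟩
  have hfin : e.Finite := (Set.finite_Icc 1 n).subset he1
  lift e to Finset ℕ using hfin
  rw [isArithProg_coe, isArithProg_coe] at he2
  rw [Set.ncard_coe_finset, hV]
  constructor
  · intro hc hs
    have : IsAP q₁ e := he2.resolve_right fun h => h₁₂ (hc.symm.trans h.card)
    exact hl e this (by exact_mod_cast hs)
  · intro hc hs
    have : IsAP q₂ e := he2.resolve_left fun h => h₁₂ (h.card.symm.trans hc)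
    exact hk e this (by exact_mod_cast hs)

/-! ### Affine relations and degrees of freedom. -/

/-- `y` agrees with an affine function on `e`. -/
def AffOn (y : ℕ → ℚ) (e : Finset ℕ) : Prop := ∃ a b : ℚ, ∀ x ∈ e, y x = a + b * x

lemma AffOn.mono {y : ℕ → ℚ} {e f : Finset ℕ} (h : AffOn y f) (hef : e ⊆ f) : AffOn y e := by
  obtain ⟨a, b, h⟩ := h
  exact ⟨a, b, fun x hx => h x (hef hx)⟩

lemma AffOn.add {y z : ℕ → ℚ} {e : Finset ℕ} (hy : AffOn y e) (hz : AffOn z e) :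
    AffOn (y + z) e := by
  obtain ⟨a, b, h⟩ := hy
  obtain ⟨a', b', h'⟩ := hz
  refine ⟨a + a', b + b', fun x hx => ?_⟩
  rw [Pi.add_apply, h x hx, h' x hx]
  ring

lemma AffOn.smul {y : ℕ → ℚ} {e : Finset ℕ} (hy : AffOn y e) (c : ℚ) : AffOn (c • y) e := by
  obtain ⟨a, b, h⟩ := hy
  refine ⟨c * a, c * b, fun x hx => ?_⟩
  rw [Pi.smul_apply, h x hx, smul_eq_mul]
  ring

lemma affOn_zero (e : Finset ℕ) : AffOn 0 e := ⟨0, 0, fun _ _ => by simp⟩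

lemma AffOn.eq_of_two {y : ℕ → ℚ} {e : Finset ℕ} (hy : AffOn y e) {u v : ℕ} (hu : u ∈ e)
    (hv : v ∈ e) (huv : u ≠ v) {a b : ℚ} (h1 : y u = a + b * u) (h2 : y v = a + b * v) :
    ∀ x ∈ e, y x = a + b * x := by
  obtain ⟨a', b', h⟩ := hy
  intro x hx
  have e1 := h u hu
  have e2 := h v hv
  have huv' : (u : ℚ) - v ≠ 0 := sub_ne_zero.2 (by exact_mod_cast huv)
  have hb : b' = b := by
    have : (b' - b) * ((u : ℚ) - v) = 0 := by linear_combination -e1 + e2 + h1 - h2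
    rcases mul_eq_zero.1 this with h | h
    · linarith
    · exact absurd h huv'
  subst hb
  rw [h x hx]
  linarith

lemma AffOn.eq_zero_of_two {y : ℕ → ℚ} {e : Finset ℕ} (hy : AffOn y e) {u v : ℕ} (hu : u ∈ e)
    (hv : v ∈ e) (huv : u ≠ v) (h1 : y u = 0) (h2 : y v = 0) : ∀ x ∈ e, y x = 0 := by
  intro x hx
  have := hy.eq_of_two hu hv huv (a := 0) (b := 0) (by simpa using h1) (by simpa using h2) x hx
  simpa using this

/-- The functions supported on `B` that are affine on each `k`-AP and each `l`-AP in `A ∪ B`. -/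
def Sol (k l : ℕ) (A B : Finset ℕ) : Submodule ℚ (ℕ → ℚ) where
  carrier := {y | (∀ x, x ∉ B → y x = 0) ∧
    ∀ e, (IsAP k e ∨ IsAP l e) → e ⊆ A ∪ B → AffOn y e}
  zero_mem' := ⟨fun _ _ => rfl, fun e _ _ => affOn_zero e⟩
  add_mem' := fun {y z} hy hz =>
    ⟨fun x hx => by rw [Pi.add_apply, hy.1 x hx, hz.1 x hx, add_zero],
      fun e he hs => (hy.2 e he hs).add (hz.2 e he hs)⟩
  smul_mem' := fun c y hy =>
    ⟨fun x hx => by rw [Pi.smul_apply, hy.1 x hx, smul_zero], fun e he hs => (hy.2 e he hs).smul c⟩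

/-- The number of degrees of freedom of `B` given `A`. -/
noncomputable def rk (k l : ℕ) (A B : Finset ℕ) : ℕ := Module.finrank ℚ (Sol k l A B)

lemma finiteDimensional_of_supported {B : Finset ℕ} {W : Submodule ℚ (ℕ → ℚ)}
    (h : ∀ y ∈ W, ∀ x, x ∉ B → y x = 0) : FiniteDimensional ℚ W := by
  let φ : W →ₗ[ℚ] (B → ℚ) := (LinearMap.funLeft ℚ ℚ (fun b : B => (b : ℕ))).comp W.subtype
  refine FiniteDimensional.of_injective φ ?_
  intro y z hyz
  ext x
  by_cases hx : x ∈ B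
  · exact congrFun hyz ⟨x, hx⟩
  · rw [h y y.2 x hx, h z z.2 x hx]

instance {k l : ℕ} {A B : Finset ℕ} : FiniteDimensional ℚ (Sol k l A B) :=
  finiteDimensional_of_supported fun _ hy => hy.1

lemma finrank_le_inf_ker_add_one {W : Submodule ℚ (ℕ → ℚ)} [FiniteDimensional ℚ W]
    (φ : (ℕ → ℚ) →ₗ[ℚ] ℚ) :
    Module.finrank ℚ W ≤ Module.finrank ℚ (W ⊓ LinearMap.ker φ : Submodule ℚ (ℕ → ℚ)) + 1 := by
  have h1 := LinearMap.finrank_range_add_finrank_ker (φ.comp W.subtype)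
  have h2 : Module.finrank ℚ (LinearMap.range (φ.comp W.subtype)) ≤ 1 := by
    simpa using Submodule.finrank_le (LinearMap.range (φ.comp W.subtype))
  have h3 : Module.finrank ℚ (LinearMap.ker (φ.comp W.subtype)) =
      Module.finrank ℚ (W ⊓ LinearMap.ker φ : Submodule ℚ (ℕ → ℚ)) := by
    rw [LinearMap.ker_comp, ← Submodule.map_comap_subtype]
    exact (LinearEquiv.finrank_eq (Submodule.equivMapOfInjective _ W.subtype_injective _))
  omega

lemma finrank_inf_ker_lt {W : Submodule ℚ (ℕ → ℚ)} [FiniteDimensional ℚ W]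
    (φ : (ℕ → ℚ) →ₗ[ℚ] ℚ) {y : ℕ → ℚ} (hy : y ∈ W) (hφ : φ y ≠ 0) :
    Module.finrank ℚ (W ⊓ LinearMap.ker φ : Submodule ℚ (ℕ → ℚ)) < Module.finrank ℚ W := by
  refine Submodule.finrank_lt_finrank_of_lt (lt_of_le_of_ne inf_le_left ?_)
  intro h
  rw [← h] at hy
  exact hφ hy.2

/-- Imposing zero at a coordinate that is not identically zero on `W` lowers the dimension, so `r`
such coordinates suffice. -/
lemma exists_coordinates {B : Finset ℕ} (r : ℕ) : ∀ (W : Submodule ℚ (ℕ → ℚ)),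
    (∀ y ∈ W, ∀ x, x ∉ B → y x = 0) → Module.finrank ℚ W ≤ r →
    ∃ J ⊆ B, J.card ≤ r ∧ ∀ y ∈ W, (∀ j ∈ J, y j = 0) → y = 0 := by
  induction r with
  | zero =>
    intro W hW hr
    have := finiteDimensional_of_supported hW
    have hbot : W = ⊥ := Submodule.finrank_eq_zero.1 (Nat.le_zero.1 hr)
    refine ⟨∅, empty_subset _, le_rfl, fun y hy _ => ?_⟩
    rw [hbot] at hy
    exact hy
  | succ r ih =>
    intro W hW hr
    have := finiteDimensional_of_supported hW
    by_cases hbot : ∀ y ∈ W, y = 0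
    · exact ⟨∅, empty_subset _, Nat.zero_le _, fun y hy _ => hbot y hy⟩
    push Not at hbot
    obtain ⟨y, hy, hy0⟩ := hbot
    obtain ⟨j, hj⟩ := Function.ne_iff.1 hy0
    have hjB : j ∈ B := by
      by_contra hc
      exact hj (hW y hy j hc)
    have hlt := finrank_inf_ker_lt (LinearMap.proj j) hy hj
    obtain ⟨J, hJB, hJ, h⟩ := ih (W ⊓ LinearMap.ker (LinearMap.proj j))
      (fun z hz => hW z hz.1) (by omega)
    refine ⟨insert j J, insert_subset hjB hJB, (card_insert_le _ _).trans (by omega), ?_⟩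
    intro z hz h0
    exact h z ⟨hz, h0 j (mem_insert_self _ _)⟩ fun i hi => h0 i (mem_insert_of_mem hi)

/-! ### Counting sets by their pattern of progressions. -/

/-- The positions of the APs of length `q` among the values of `v`. -/
def apPattern {ι : Type*} (q : ℕ) (v : ι → ℕ) : Set (Fin q → ι) :=
  {s | ∃ a d, 0 < d ∧ ∀ i : Fin q, v (s i) = a + i * d}

lemma exists_apPattern {ι : Type*} {q : ℕ} {v : ι → ℕ} {e : Finset ℕ} (he : IsAP q e)
    (hv : ∀ x ∈ e, ∃ i, v i = x) : ∃ s ∈ apPattern q v, ∀ x ∈ e, ∃ i, v (s i) = x := by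
  obtain ⟨a, d, hd, rfl⟩ := he
  have h : ∀ i : Fin q, ∃ j, v j = a + i * d := fun i => hv _ (mem_ap.2 ⟨i, i.2, rfl⟩)
  choose s hs using h
  refine ⟨s, ⟨a, d, hd, hs⟩, fun x hx => ?_⟩
  obtain ⟨i, hi, rfl⟩ := mem_ap.1 hx
  exact ⟨⟨i, hi⟩, hs ⟨i, hi⟩⟩

/-- Along `s` all three of `v`, `v₁`, `v₂` are affine in the index, and the step of `v` is nonzero.
Hence `v₁ - v₂` is an affine function of `v`. -/
lemma affOn_of_apPattern {ι : Type*} {q : ℕ} {v v₁ v₂ : ι → ℕ} {s : Fin q → ι} {e : Finset ℕ}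
    {y : ℕ → ℚ} (h : s ∈ apPattern q v) (h₁ : s ∈ apPattern q v₁) (h₂ : s ∈ apPattern q v₂)
    (he : ∀ x ∈ e, ∃ i, v (s i) = x) (hy : ∀ i, y (v i) = (v₁ i : ℚ) - v₂ i) : AffOn y e := by
  obtain ⟨a, d, hd, h⟩ := h
  obtain ⟨a₁, d₁, -, h₁⟩ := h₁
  obtain ⟨a₂, d₂, -, h₂⟩ := h₂
  refine ⟨(a₁ : ℚ) - a₂ - (d₁ - d₂) / d * a, ((d₁ : ℚ) - d₂) / d, fun x hx => ?_⟩
  obtain ⟨i, rfl⟩ := he x hx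
  rw [hy, h, h₁, h₂]
  have : (d : ℚ) ≠ 0 := by exact_mod_cast hd.ne'
  push_cast
  field_simp
  ring

open scoped Classical in
-- View each `B` as a function `T B` on `B₀` through the enumerations `φ`. For sets with a common
-- pattern, differences of these functions lie in `Sol k l A B₀`, the points of `A` being fixed. So
-- `B` is determined by at most `r` coordinates of `T B`, each in `[n]`.
lemma card_le_of_pattern_eq {k l m n r : ℕ} (hn : 1 ≤ n) {A B₀ : Finset ℕ}
    {φ : Finset ℕ → Fin m → ℕ} {F : Finset (Finset ℕ)}
    (hF : ∀ B ∈ F, B ⊆ Icc 1 n ∧ Disjoint A B ∧ Function.Injective (φ B) ∧ univ.image (φ B) = B)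
    (h0 : B₀ ∈ F) (hr : rk k l A B₀ ≤ r)
    (hk : ∀ B ∈ F, apPattern k (Sum.elim (fun a : A => (a : ℕ)) (φ B)) =
      apPattern k (Sum.elim (fun a : A => (a : ℕ)) (φ B₀)))
    (hl : ∀ B ∈ F, apPattern l (Sum.elim (fun a : A => (a : ℕ)) (φ B)) =
      apPattern l (Sum.elim (fun a : A => (a : ℕ)) (φ B₀))) :
    F.card ≤ n ^ r := by
  obtain ⟨J, hJB, hJ, hinj⟩ := exists_coordinates (B := B₀) r (Sol k l A B₀) (fun y hy => hy.1) hr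
  obtain ⟨-, hd0, hφ0, him0⟩ := hF _ h0
  have himm : ∀ B ∈ F, ∀ i, φ B i ∈ B := by
    intro B hB i
    have := mem_image_of_mem (φ B) (mem_univ i)
    rwa [(hF B hB).2.2.2] at this
  let T : Finset ℕ → ℕ → ℕ := fun B x => ∑ i, if φ B₀ i = x then φ B i else 0
  have hT : ∀ B i, T B (φ B₀ i) = φ B i := by
    intro B i
    simp [T, hφ0.eq_iff]
  have hT0 : ∀ B x, x ∉ B₀ → T B x = 0 := by
    intro B x hx
    refine sum_eq_zero fun i _ => if_neg ?_
    rintro rfl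
    exact hx (himm _ h0 i)
  have hpos : ∀ x ∈ B₀, ∃ i, φ B₀ i = x := by
    intro x hx
    rw [← him0] at hx
    simpa using hx
  have key : ∀ B ∈ F, ∀ B' ∈ F, (fun x => (T B x : ℚ) - T B' x) ∈ Sol k l A B₀ := by
    intro B hB B' hB'
    refine ⟨fun x hx => by simp [hT0 _ x hx], ?_⟩
    have hcov : ∀ e : Finset ℕ, e ⊆ A ∪ B₀ →
        ∀ x ∈ e, ∃ i, Sum.elim (fun a : A => (a : ℕ)) (φ B₀) i = x := by
      intro e he x hx
      rcases mem_union.1 (he hx) with h | h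
      · exact ⟨Sum.inl ⟨x, h⟩, rfl⟩
      · obtain ⟨i, hi⟩ := hpos x h
        exact ⟨Sum.inr i, hi⟩
    have hval : ∀ i, (fun x => (T B x : ℚ) - T B' x)
        (Sum.elim (fun a : A => (a : ℕ)) (φ B₀) i) =
        ((Sum.elim (fun a : A => (a : ℕ)) (φ B) i : ℕ) : ℚ) -
          (Sum.elim (fun a : A => (a : ℕ)) (φ B') i : ℕ) := by
      rintro (a | i)
      · have : (a : ℕ) ∉ B₀ := disjoint_left.1 hd0 a.2
        simp [hT0 _ _ this]
      · simp [hT]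
    rintro e (he | he) hs
    · obtain ⟨s, hs1, hs2⟩ := exists_apPattern he (hcov e hs)
      exact affOn_of_apPattern hs1 (hk B hB ▸ hs1) (hk B' hB' ▸ hs1) hs2 hval
    · obtain ⟨s, hs1, hs2⟩ := exists_apPattern he (hcov e hs)
      exact affOn_of_apPattern hs1 (hl B hB ▸ hs1) (hl B' hB' ▸ hs1) hs2 hval
  have hcard : F.card ≤ (Fintype.piFinset fun _ : J => Icc 1 n).card := by
    refine card_le_card_of_injOn (fun B (j : J) => T B j) ?_ ?_
    · intro B hB
      rw [mem_coe, Fintype.mem_piFinset]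
      intro j
      obtain ⟨i, hi⟩ := hpos j (hJB j.2)
      have : T B j ∈ B := by
        rw [← hi, hT]
        exact himm B hB i
      exact (hF B hB).1 this
    · intro B hB B' hB' heq
      have hz := hinj _ (key B hB B' hB') fun j hj => by
        have : T B j = T B' j := congrFun heq ⟨j, hj⟩
        simp [this]
      have hφ : φ B = φ B' := by
        ext i
        have := congrFun hz (φ B₀ i)
        simp only [hT, Pi.zero_apply, sub_eq_zero, Nat.cast_inj] at this
        exact this
      rw [← (hF B hB).2.2.2, ← (hF B' hB').2.2.2, hφ]
  refine hcard.trans ?_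
  rw [Fintype.card_piFinset]
  simp only [Nat.card_Icc, add_tsub_cancel_right, prod_const, card_univ, Fintype.card_coe]
  exact Nat.pow_le_pow_right hn hJ

open scoped Classical in
/-- For a fixed set `A`, there are `O(n ^ r)` sets `B` of a given size with `r` degrees of freedom
over `A`. -/
theorem card_le_of_rk_le (k l a m : ℕ) : ∃ C : ℕ, ∀ (A : Finset ℕ), A.card ≤ a → ∀ n r : ℕ, 1 ≤ n →
    ∀ F : Finset (Finset ℕ),
    (∀ B ∈ F, B ⊆ Icc 1 n ∧ Disjoint A B ∧ B.card = m ∧ rk k l A B ≤ r) →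
    F.card ≤ C * n ^ r := by
  -- The constant bounds the number of possible pairs of patterns.
  refine ⟨2 ^ ((a + m) ^ k) * 2 ^ ((a + m) ^ l), fun A hA n r hn F hF => ?_⟩
  have hφ : ∀ B ∈ F, ∃ φ : Fin m → ℕ, Function.Injective φ ∧ univ.image φ = B := by
    intro B hB
    refine ⟨B.orderEmbOfFin (hF B hB).2.2.1, (B.orderEmbOfFin _).injective, ?_⟩
    ext x
    rw [← mem_coe, coe_image, coe_univ, Set.image_univ, range_orderEmbOfFin, mem_coe]
  choose! φ hφ using hφ
  let ty : Finset ℕ → Set (Fin k → A ⊕ Fin m) × Set (Fin l → A ⊕ Fin m) := fun B =>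
    (apPattern k (Sum.elim (fun a : A => (a : ℕ)) (φ B)),
      apPattern l (Sum.elim (fun a : A => (a : ℕ)) (φ B)))
  have hfib : ∀ τ ∈ F.image ty, (F.filter fun B => ty B = τ).card ≤ n ^ r := by
    intro τ hτ
    obtain ⟨B₀, hB₀, rfl⟩ := mem_image.1 hτ
    refine card_le_of_pattern_eq (k := k) (l := l) (A := A) (B₀ := B₀) (φ := φ) hn ?_
      (mem_filter.2 ⟨hB₀, rfl⟩) (hF B₀ hB₀).2.2.2 ?_ ?_
    · intro B hB
      rw [mem_filter] at hB
      exact ⟨(hF B hB.1).1, (hF B hB.1).2.1, hφ B hB.1⟩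
    · intro B hB
      exact congrArg Prod.fst (mem_filter.1 hB).2
    · intro B hB
      exact congrArg Prod.snd (mem_filter.1 hB).2
  calc F.card ≤ n ^ r * (F.image ty).card :=
        card_le_mul_card_image F (n ^ r) hfib
    _ ≤ n ^ r * (2 ^ ((a + m) ^ k) * 2 ^ ((a + m) ^ l)) := by
        gcongr
        refine (card_le_univ _).trans ?_
        rw [Fintype.card_prod, Fintype.card_set, Fintype.card_set, Fintype.card_fun,
          Fintype.card_fun, Fintype.card_sum, Fintype.card_coe, Fintype.card_fin, Fintype.card_fin,
          Fintype.card_fin]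
        gcongr <;> norm_num
    _ = _ := mul_comm _ _

/-! ### Small transversals for the `l`-APs in a set of fewer than `2 l` points. -/

/-- The arithmetic progression `p, p + d, …, p + (l - 1) d` of integers. -/
noncomputable def zap (l : ℕ) (p d : ℤ) : Finset ℤ := (Ico 0 (l : ℤ)).image fun i => p + i * d

lemma mem_zap {l : ℕ} {p d x : ℤ} : x ∈ zap l p d ↔ ∃ i : ℤ, 0 ≤ i ∧ i < l ∧ p + i * d = x := by
  simp [zap, and_assoc]

lemma add_mul_injective {p d : ℤ} (hd : 0 < d) : Function.Injective fun i : ℤ => p + i * d := by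
  intro i j h
  exact mul_right_cancel₀ hd.ne' (add_left_cancel h)

lemma card_zap {l : ℕ} {p d : ℤ} (hd : 0 < d) : (zap l p d).card = l := by
  rw [zap, card_image_of_injective _ (add_mul_injective hd)]
  simp

lemma mem_zap_index {l : ℕ} {p d i : ℤ} (hd : 0 < d) : p + i * d ∈ zap l p d ↔ 0 ≤ i ∧ i < l := by
  rw [mem_zap]
  constructor
  · rintro ⟨j, h0, h1, h⟩
    obtain rfl := add_mul_injective hd h
    exact ⟨h0, h1⟩
  · rintro ⟨h0, h1⟩
    exact ⟨i, h0, h1, rfl⟩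

/-- The positions in `Ico x y` at which the progression `q + i * d` meets `X`. -/
noncomputable def zpos (q d x y : ℤ) (X : Finset ℤ) : Finset ℤ := (Ico x y).filter fun i => q + i * d ∈ X

lemma mem_zpos {q d x y i : ℤ} {X : Finset ℤ} :
    i ∈ zpos q d x y X ↔ (x ≤ i ∧ i < y) ∧ q + i * d ∈ X := by
  simp [zpos]

lemma card_zpos {q d x y : ℤ} (hd : 0 < d) (X : Finset ℤ) :
    (zpos q d x y X).card = (((Ico x y).image fun i => q + i * d) ∩ X).card := by
  rw [zpos, ← card_image_of_injective _ (add_mul_injective (p := q) hd)]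
  congr 1
  ext z
  simp only [mem_image, mem_filter, mem_inter]
  constructor
  · rintro ⟨i, ⟨h1, h2⟩, rfl⟩
    exact ⟨⟨i, h1, rfl⟩, h2⟩
  · rintro ⟨⟨i, h1, rfl⟩, h2⟩
    exact ⟨i, ⟨h1, h2⟩, rfl⟩

/-- `S` and its translate by `1` are disjoint inside an interval with one more point. -/
lemma sparse_card {S : Finset ℤ} {x y : ℤ} (hS : S ⊆ Ico x y) (hxy : x ≤ y)
    (h : ∀ i ∈ S, i + 1 ∉ S) : 2 * (S.card : ℤ) ≤ y - x + 1 := by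
  have hd : Disjoint S (S.image (· + 1)) := by
    rw [disjoint_right]
    intro i hi
    obtain ⟨j, hj, rfl⟩ := mem_image.1 hi
    exact h j hj
  have hsub : S ∪ S.image (· + 1) ⊆ Ico x (y + 1) := by
    refine union_subset (hS.trans (Ico_subset_Ico_right (by omega))) ?_
    intro i hi
    obtain ⟨j, hj, rfl⟩ := mem_image.1 hi
    have := mem_Ico.1 (hS hj)
    rw [mem_Ico]
    omega
  have := card_le_card hsub
  rw [card_union_of_disjoint hd, card_image_of_injective _ (add_left_injective 1), Int.card_Ico]
    at this
  omega

lemma dvd_sub_of_mem_zap {l : ℕ} {p d x y : ℤ} (hx : x ∈ zap l p d) (hy : y ∈ zap l p d) :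
    d ∣ x - y := by
  obtain ⟨i, -, -, rfl⟩ := mem_zap.1 hx
  obtain ⟨j, -, -, rfl⟩ := mem_zap.1 hy
  exact ⟨i - j, by ring⟩

lemma not_consecutive {l : ℕ} {p d q D i : ℤ} (hD : 0 < D) (hd : D < d)
    (h1 : q + i * D ∈ zap l p d) : q + (i + 1) * D ∉ zap l p d := by
  intro h2
  have := dvd_sub_of_mem_zap h2 h1
  rw [show q + (i + 1) * D - (q + i * D) = D by ring] at this
  have := Int.le_of_dvd hD this
  omega

/-- The progression with the larger step contains no two consecutive terms of the other one. -/
lemma two_mul_card_inter_le {l : ℕ} {p d p' d' : ℤ} (hd : 0 < d) (hd' : 0 < d') (h : d ≠ d') :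
    2 * ((zap l p d ∩ zap l p' d').card : ℤ) ≤ l + 1 := by
  wlog hlt : d < d' generalizing p d p' d'
  · rw [inter_comm]
    exact this hd' hd h.symm (by omega)
  have h1 := card_zpos (q := p) (x := 0) (y := l) hd (zap l p' d')
  rw [zap, ← h1]
  have := sparse_card (S := zpos p d 0 l (zap l p' d')) (x := 0) (y := l) (filter_subset _ _)
    (by omega) ?_
  · linarith
  · intro i hi hi'
    exact not_consecutive hd hlt (mem_zpos.1 hi).2 (mem_zpos.1 hi').2

lemma card_union_three {X Y Z L : Finset ℤ} {l s : ℕ} (hX : X ⊆ L) (hY : Y ⊆ L) (hZ : Z ⊆ L)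
    (hZl : Z.card = l) (hXl : X.card = l) (hYl : Y.card = l) (hL : L.card + s ≤ 2 * l) :
    l + s ≤ (X ∩ Y).card + (Z ∩ (X ∪ Y)).card := by
  have h1 := card_union_add_card_inter X Y
  have h2 := card_union_add_card_inter Z (X ∪ Y)
  have h3 := card_le_card (union_subset hZ (union_subset hX hY))
  omega

lemma card_inter_ge {X Y L : Finset ℤ} {l s : ℕ} (hX : X ⊆ L) (hY : Y ⊆ L)
    (hXl : X.card = l) (hYl : Y.card = l) (hL : L.card + s ≤ 2 * l) : s ≤ (X ∩ Y).card := by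
  have h1 := card_union_add_card_inter X Y
  have h3 := card_le_card (union_subset hX hY)
  omega

/-- Two progressions with a common step that meet `Q` in separated sets of positions, all but
possibly `w` of them, cannot have more than half of their elements in common. -/
lemma same_step_false {l : ℕ} {p q d D s : ℤ} (hD : 0 < D) (hd : D < d) {w i₁ i₂ i₃ i₄ : ℤ}
    (h0 : 0 ≤ i₁) (h12 : i₁ < i₂) (h23 : i₂ < i₃) (h34 : i₃ < i₄) (h4 : i₄ < l)
    (hs : 2 * s + 2 ≤ l)
    (m₁ : q + i₁ * D ∈ zap l p d) (m₂ : q + i₂ * D ∈ zap l p d)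
    (m₃ : q + i₃ * D ∈ zap l (p + s * d) d) (m₄ : q + i₄ * D ∈ zap l (p + s * d) d)
    (n₂ : q + i₂ * D ∉ zap l (p + s * d) d) (n₃ : q + i₃ * D ∉ zap l p d)
    (hw : ∀ i : ℤ, 0 ≤ i → i < l → q + i * D ∈ zap l p d → q + i * D ∈ zap l (p + s * d) d → i = w) :
    False := by
  have hd0 : 0 < d := hD.trans hd
  obtain ⟨a, b, g, hg, hco, hDa, hdb⟩ : ∃ a b g : ℤ, 0 < g ∧ IsCoprime a b ∧ D = a * g ∧
      d = b * g := by
    obtain ⟨g, a, b, hg, hab, h1, h2⟩ := Int.exists_gcd_one' (Int.gcd_pos_of_ne_zero_left d hD.ne')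
    exact ⟨a, b, g, by exact_mod_cast hg, Int.isCoprime_iff_gcd_eq_one.2 hab, h1, h2⟩
  subst hDa hdb
  have ha : 0 < a := pos_of_mul_pos_left hD hg.le
  have hab : a < b := lt_of_mul_lt_mul_right hd hg.le
  obtain ⟨j₁, hj₁, hj₁', e₁⟩ := mem_zap.1 m₁
  obtain ⟨j₂, hj₂, hj₂', e₂⟩ := mem_zap.1 m₂
  obtain ⟨j₃, hj₃, hj₃', e₃⟩ := mem_zap.1 m₃
  obtain ⟨j₄, hj₄, hj₄', e₄⟩ := mem_zap.1 m₄
  -- Positions on the two progressions' common points form one residue class modulo `b`. A move by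
  -- `b` in the position is a move by `a` in the index.
  have step : ∀ {i j i' j' : ℤ}, p + j * (b * g) = q + i * (a * g) →
      p + j' * (b * g) = q + i' * (a * g) → ∃ n, i' = i + n * b ∧ j' = j + n * a := by
    intro i j i' j' h h'
    have e : (j' - j) * b = (i' - i) * a := by
      refine mul_right_cancel₀ hg.ne' ?_
      linear_combination h' - h
    obtain ⟨n, hn⟩ : b ∣ i' - i := hco.symm.dvd_of_dvd_mul_right ⟨j' - j, by linarith⟩
    refine ⟨n, by linarith, ?_⟩
    have hb : b ≠ 0 := by omega
    have : (j' - j) = n * a := mul_right_cancel₀ hb (by rw [e, hn]; ring)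
    linarith
  have e₃' : p + (j₃ + s) * (b * g) = q + i₃ * (a * g) := by rw [← e₃]; ring
  have e₄' : p + (j₄ + s) * (b * g) = q + i₄ * (a * g) := by rw [← e₄]; ring
  obtain ⟨n₁, f₁, -⟩ := step e₁ e₂
  obtain ⟨n₂', f₂, g₂⟩ := step e₂ e₃'
  obtain ⟨n₃', f₃, -⟩ := step e₃' e₄'
  have hb : 0 < b := by omega
  have p₁ : 1 ≤ n₁ := pos_of_mul_pos_left (show 0 < n₁ * b by omega) hb.le
  have p₂ : 1 ≤ n₂' := pos_of_mul_pos_left (show 0 < n₂' * b by omega) hb.le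
  have p₃ : 1 ≤ n₃' := pos_of_mul_pos_left (show 0 < n₃' * b by omega) hb.le
  have r₁ : b ≤ n₁ * b := le_mul_of_one_le_left hb.le p₁
  have r₂ : b ≤ n₂' * b := le_mul_of_one_le_left hb.le p₂
  have r₃ : b ≤ n₃' * b := le_mul_of_one_le_left hb.le p₃
  have q₂ : ¬ (s ≤ j₂) ∨ ¬ (j₂ < l + s) := by
    by_contra! hc
    apply n₂
    rw [← e₂]
    exact mem_zap.2 ⟨j₂ - s, by omega, by omega, by ring⟩
  have q₃ : ¬ (0 ≤ j₃ + s) ∨ ¬ (j₃ + s < l) := by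
    by_contra! hc
    apply n₃
    rw [← e₃]
    exact mem_zap.2 ⟨j₃ + s, by omega, by omega, by ring⟩
  have hna : a ≤ n₂' * a := le_mul_of_one_le_left ha.le p₂
  -- Indices from `s` to `l - 1` belong to both progressions. The class passes from an index below
  -- this range to one above it.
  have hj₂s : j₂ < s := by omega
  have hj₃s : l ≤ j₃ + s := by omega
  have hb3 : 3 * b ≤ l - 1 := by omega
  -- the first position in the class of `i₂` whose index is at least `s`
  obtain ⟨n, hn1, hn2, hn3⟩ : ∃ n : ℤ, 1 ≤ n ∧ s ≤ j₂ + n * a ∧ j₂ + n * a < s + a := by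
    have h0 := Int.ediv_nonneg (show 0 ≤ s - j₂ - 1 by omega) ha.le
    have h1 := Int.mul_ediv_add_emod (s - j₂ - 1) a
    have h2 := Int.emod_lt_of_pos (s - j₂ - 1) ha
    have h3 := Int.emod_nonneg (s - j₂ - 1) ha.ne'
    have h4 : ((s - j₂ - 1) / a + 1) * a = a * ((s - j₂ - 1) / a) + a := by ring
    exact ⟨(s - j₂ - 1) / a + 1, by omega, by omega, by omega⟩
  have mem : ∀ n : ℤ, 0 ≤ n → s ≤ j₂ + n * a → j₂ + n * a < l → i₂ + n * b = w ∧ n < n₂' := by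
    intro n hn h1 h2
    have hlt : n < n₂' := by
      by_contra hc
      have : n₂' * a ≤ n * a := mul_le_mul_of_nonneg_right (by omega) ha.le
      omega
    have hnb : 0 ≤ n * b := mul_nonneg hn hb.le
    have hnb' : n * b ≤ n₂' * b := mul_le_mul_of_nonneg_right hlt.le hb.le
    refine ⟨hw _ (by omega) (by omega) ?_ ?_, hlt⟩
    · rw [show q + (i₂ + n * b) * (a * g) = p + (j₂ + n * a) * (b * g) by
        linear_combination -e₂]
      exact mem_zap.2 ⟨_, by omega, h2, rfl⟩
    · rw [show q + (i₂ + n * b) * (a * g) = p + s * (b * g) + (j₂ + n * a - s) * (b * g) by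
        linear_combination -e₂]
      exact mem_zap.2 ⟨_, by omega, by omega, rfl⟩
  obtain ⟨w1, hn'⟩ := mem n (by omega) hn2 (by omega)
  -- The common position just found shows `n₂' ≥ 2`, so four gaps fit into the range. With this
  -- sharper bound the next position of the class is common as well, and both would have to equal
  -- `w`.
  have hb4 : 4 * b ≤ l - 1 := by
    have : 2 * b ≤ n₂' * b := mul_le_mul_of_nonneg_right (by omega) hb.le
    omega
  obtain ⟨w2, -⟩ := mem (n + 1) (by omega) (by linarith) (by linarith)
  linarith

lemma exists_two_of_three {S : Finset ℤ} (h : 3 ≤ S.card) (w : ℤ) :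
    ∃ i ∈ S, ∃ j ∈ S, i < j ∧ i ≠ w ∧ j ≠ w := by
  have h1 : 1 < (S.erase w).card := by
    have := pred_card_le_card_erase (s := S) (a := w)
    omega
  obtain ⟨i, hi, j, hj, hij⟩ := one_lt_card.1 h1
  rw [mem_erase] at hi hj
  rcases lt_or_gt_of_ne hij with h | h
  · exact ⟨i, hi.2, j, hj.2, h, hi.1, hj.1⟩
  · exact ⟨j, hj.2, i, hi.2, h, hj.1, hi.1⟩

lemma zpos_sparse {l : ℕ} {q D p d x y : ℤ} (hD : 0 < D) (hd : D < d) :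
    ∀ i ∈ zpos q D x y (zap l p d), i + 1 ∉ zpos q D x y (zap l p d) := fun _ hi hi' =>
  not_consecutive hD hd (mem_zpos.1 hi).2 (mem_zpos.1 hi').2

/-- The larger step makes the positions of `P` non-consecutive, so each end of length `m` contains
at most `(m + 1) / 2` of them. With `w` this gives at most `m + 2` common points, so the run of `l +
m` points and `P` together have at least `2 l - 2` points, more than `L` has. -/
lemma interval_false {l s : ℕ} {L : Finset ℤ} {q D p d x y m w : ℤ} (hs : 3 ≤ s)
    (hL : L.card + s ≤ 2 * l) (hD : 0 < D) (hd : D < d) (hP : zap l p d ⊆ L) (hm : 0 ≤ m)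
    (hxy : y - x = l + m) (hint : ∀ i, x ≤ i → i < y → q + i * D ∈ L)
    (h : ∀ i, x ≤ i → i < y → q + i * D ∈ zap l p d → i < x + m ∨ i = w ∨ y - m ≤ i) : False := by
  set S := zpos q D x y (zap l p d) with hS
  have hsub : S ⊆ (S ∩ Ico x (x + m)) ∪ ({w} ∪ S ∩ Ico (y - m) y) := by
    intro i hi
    have h1 := mem_zpos.1 hi
    have h2 := h i h1.1.1 h1.1.2 h1.2
    simp only [mem_union, mem_inter, mem_singleton, mem_Ico]
    have := h1.1
    tauto
  have hsp := zpos_sparse (l := l) (q := q) (p := p) (x := x) (y := y) hD hd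
  have c1 := sparse_card (S := S ∩ Ico x (x + m)) inter_subset_right (by omega)
    fun i hi hi' => hsp i (mem_inter.1 hi).1 (mem_inter.1 hi').1
  have c2 := sparse_card (S := S ∩ Ico (y - m) y) inter_subset_right (by omega)
    fun i hi hi' => hsp i (mem_inter.1 hi).1 (mem_inter.1 hi').1
  have c3 := (card_le_card hsub).trans ((card_union_le _ _).trans
    (Nat.add_le_add_left (card_union_le _ _) _))
  rw [card_singleton] at c3
  have c4 := card_zpos (q := q) (x := x) (y := y) hD (zap l p d)
  have c5 := card_union_add_card_inter ((Ico x y).image fun i => q + i * D) (zap l p d)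
  rw [card_image_of_injective _ (add_mul_injective hD), card_zap (hD.trans hd), Int.card_Ico] at c5
  have c6 := card_le_card (union_subset (s := (Ico x y).image fun i => q + i * D) (t := zap l p d)
    (u := L) (by
      intro z hz
      obtain ⟨i, hi, rfl⟩ := mem_image.1 hz
      exact hint i (mem_Ico.1 hi).1 (mem_Ico.1 hi).2) hP)
  rw [← hS] at c4
  omega

lemma mem_zap_shift {l : ℕ} {q D s i : ℤ} (hD : 0 < D) :
    q + i * D ∈ zap l (q + s * D) D ↔ s ≤ i ∧ i < s + l := by
  rw [show q + i * D = q + s * D + (i - s) * D by ring, mem_zap_index hD]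
  omega

lemma exists_shift {l : ℕ} {q D p : ℤ} (h : (zap l q D ∩ zap l p D).Nonempty) :
    ∃ s, p = q + s * D := by
  obtain ⟨x, hx⟩ := h
  rw [mem_inter, mem_zap, mem_zap] at hx
  obtain ⟨⟨i, -, -, rfl⟩, j, -, -, hj⟩ := hx
  exact ⟨i - j, by linarith⟩

lemma card_inter_shift_le {l : ℕ} {q D s : ℤ} (hD : 0 < D) :
    ((zap l q D ∩ zap l (q + s * D) D).card : ℤ) ≤ max (l - s) 0 := by
  have : zap l q D ∩ zap l (q + s * D) D ⊆ (Ico s (l : ℤ)).image fun i => q + i * D := by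
    intro x hx
    rw [mem_inter] at hx
    obtain ⟨i, h0, h1, rfl⟩ := mem_zap.1 hx.1
    rw [mem_zap_shift hD] at hx
    exact mem_image_of_mem _ (mem_Ico.2 ⟨hx.2.1, h1⟩)
  have := (card_le_card this).trans card_image_le
  rw [Int.card_Ico] at this
  omega

/-- Cut the positions at the first one, other than `w`, of the second set. Apart from `w`, only one
of the two sets occurs on each side, and it has no consecutive positions. -/
lemma card_inter_union_le_of_separated {l : ℕ} {q D p d p' d' w : ℤ} (hD : 0 < D) (hdD : D < d)
    (hdD' : D < d') (hne : ((zpos q D 0 l (zap l p' d')).erase w).Nonempty)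
    (hsep : ∀ i ∈ zpos q D 0 l (zap l p d), i ≠ w → ∀ j ∈ zpos q D 0 l (zap l p' d'), j ≠ w →
      i < j) :
    2 * ((zap l q D ∩ (zap l p d ∪ zap l p' d')).card : ℤ) ≤ l + 4 := by
  have c5 := card_zpos (q := q) (x := 0) (y := l) hD (zap l p d ∪ zap l p' d')
  rw [zap, ← c5]
  set S := zpos q D 0 l (zap l p d) with hS
  set S' := zpos q D 0 l (zap l p' d') with hS'
  set θ := (S'.erase w).min' hne with hθ
  have hθm := (S'.erase w).min'_mem hne
  rw [← hθ, mem_erase] at hθm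
  have hθb := (mem_zpos.1 hθm.2).1
  have k1 := sparse_card (S := S.erase w) (x := 0) (y := θ) (by
      intro i hi
      rw [mem_erase] at hi
      exact mem_Ico.2 ⟨(mem_zpos.1 hi.2).1.1, hsep i hi.2 hi.1 θ hθm.2 hθm.1⟩) hθb.1
    fun i hi hi' => zpos_sparse hD hdD i (mem_erase.1 hi).2 (mem_erase.1 hi').2
  have k2 := sparse_card (S := S'.erase w) (x := θ) (y := l) (by
      intro i hi
      exact mem_Ico.2 ⟨min'_le _ _ hi, (mem_zpos.1 (mem_erase.1 hi).2).1.2⟩) (by omega)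
    fun i hi hi' => zpos_sparse hD hdD' i (mem_erase.1 hi).2 (mem_erase.1 hi').2
  have hsub : zpos q D 0 l (zap l p d ∪ zap l p' d') ⊆ S.erase w ∪ ({w} ∪ S'.erase w) := by
    intro i hi
    rw [mem_zpos, mem_union] at hi
    simp only [mem_union, mem_erase, mem_singleton, hS, hS', mem_zpos]
    tauto
  have c6 := (card_le_card hsub).trans ((card_union_le _ _).trans
    (Nat.add_le_add_left (card_union_le _ _) _))
  rw [card_singleton] at c6
  omega

/-- The sets of positions in which two progressions meet a progression of smallest step are not
separated, even after one position is removed. -/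
lemma not_separated {l s : ℕ} {L : Finset ℤ} {q D p d p' d' w : ℤ} (hs : 3 ≤ s)
    (hL : L.card + s ≤ 2 * l) (hD : 0 < D) (hd : D ≤ d) (hd' : D ≤ d')
    (hQ : zap l q D ⊆ L) (hP : zap l p d ⊆ L) (hP' : zap l p' d' ⊆ L)
    (hsep : ∀ i ∈ zpos q D 0 l (zap l p d), i ≠ w → ∀ j ∈ zpos q D 0 l (zap l p' d'), j ≠ w →
      i < j) : False := by
  have hd0 : 0 < d := by omega
  have hd0' : 0 < d' := by omega
  have cQ := card_zap (l := l) (p := q) hD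
  have cP := card_zap (l := l) (p := p) hd0
  have cP' := card_zap (l := l) (p := p') hd0'
  have c1 : (zpos q D 0 l (zap l p d)).card = (zap l q D ∩ zap l p d).card := card_zpos hD _
  have c1' : (zpos q D 0 l (zap l p' d')).card = (zap l q D ∩ zap l p' d').card := card_zpos hD _
  have c2 := card_inter_ge hQ hP cQ cP hL
  have c2' := card_inter_ge hQ hP' cQ cP' hL
  have c3 := card_inter_ge hP hP' cP cP' hL
  obtain ⟨i₁, hi₁, i₂, hi₂, h12, w1, w2⟩ :=
    exists_two_of_three (S := zpos q D 0 l (zap l p d)) (by rw [c1]; exact hs.trans c2) w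
  obtain ⟨i₃, hi₃, i₄, hi₄, h34, w3, w4⟩ :=
    exists_two_of_three (S := zpos q D 0 l (zap l p' d')) (by rw [c1']; exact hs.trans c2') w
  have h23 := hsep i₂ hi₂ w2 i₃ hi₃ w3
  have b1 := mem_zpos.1 hi₁
  have b2 := mem_zpos.1 hi₂
  have b3 := mem_zpos.1 hi₃
  have b4 := mem_zpos.1 hi₄
  have hboth : ∀ i : ℤ, 0 ≤ i → i < l → q + i * D ∈ zap l p d → q + i * D ∈ zap l p' d' → i = w := by
    intro i h0 h1 h2 h3
    by_contra hc
    exact lt_irrefl i (hsep i (mem_zpos.2 ⟨⟨h0, h1⟩, h2⟩) hc i (mem_zpos.2 ⟨⟨h0, h1⟩, h3⟩) hc)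
  have hneg : d = D → ∃ t, p = q + t * D ∧ t < 0 ∧ 3 ≤ l + t := by
    rintro rfl
    obtain ⟨t, rfl⟩ := exists_shift (l := l) (q := q) (p := p) (D := d)
      (card_pos.1 (by omega))
    have c4 := card_inter_shift_le (l := l) (q := q) (s := t) hD
    have ht : t < 0 := by
      by_contra ht
      have m1 : (l : ℤ) - 1 ∈ zpos q d 0 l (zap l (q + t * d) d) :=
        mem_zpos.2 ⟨by omega, (mem_zap_shift hD).2 (by omega)⟩
      have m2 : (l : ℤ) - 2 ∈ zpos q d 0 l (zap l (q + t * d) d) :=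
        mem_zpos.2 ⟨by omega, (mem_zap_shift hD).2 (by omega)⟩
      by_cases hw : (l : ℤ) - 1 = w
      · have := hsep _ m2 (by omega) _ hi₃ w3
        omega
      · have := hsep _ m1 hw _ hi₃ w3
        omega
    refine ⟨t, rfl, ht, ?_⟩
    rw [mem_zap_shift hD] at b1 b2
    by_contra hlt
    have hsub : zpos q d 0 l (zap l (q + t * d) d) ⊆ Ico 0 (t + l) := by
      intro i hi
      have := mem_zpos.1 hi
      rw [mem_zap_shift hD] at this
      rw [mem_Ico]
      omega
    have := card_le_card hsub
    rw [Int.card_Ico] at this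
    omega
  have hpos : d' = D → ∃ t, p' = q + t * D ∧ 0 < t ∧ 3 ≤ l - t := by
    rintro rfl
    obtain ⟨t, rfl⟩ := exists_shift (l := l) (q := q) (p := p') (D := d')
      (card_pos.1 (by omega))
    have c4 := card_inter_shift_le (l := l) (q := q) (s := t) hD
    refine ⟨t, rfl, ?_, by omega⟩
    by_contra ht
    have hsub : zpos q d' 0 l (zap l (q + t * d') d') ⊆ Ico 0 (t + l) := by
      intro i hi
      have := mem_zpos.1 hi
      rw [mem_zap_shift hD] at this
      rw [mem_Ico]
      omega
    have hc := card_le_card hsub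
    rw [Int.card_Ico] at hc
    have m1 : (0 : ℤ) ∈ zpos q d' 0 l (zap l (q + t * d') d') :=
      mem_zpos.2 ⟨by omega, (mem_zap_shift hD).2 (by omega)⟩
    have m2 : (1 : ℤ) ∈ zpos q d' 0 l (zap l (q + t * d') d') :=
      mem_zpos.2 ⟨by omega, (mem_zap_shift hD).2 (by omega)⟩
    by_cases hw : (0 : ℤ) = w
    · have := hsep _ hi₂ w2 _ m2 (by omega)
      omega
    · have := hsep _ hi₂ w2 _ m1 hw
      omega
  -- If both steps are `D`, the overlap contains two positions, but only `w` is allowed. If exactly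
  -- one is `D`, that progression and `Q` form a run to which `interval_false` applies. If neither
  -- is, counting shows that `P` and `P'` share more than half of their points, so their steps agree
  -- and `same_step_false` applies.
  rcases hd.eq_or_lt with hdD | hdD <;> rcases hd'.eq_or_lt with hdD' | hdD'
  · obtain ⟨t, rfl, ht, ht'⟩ := hneg hdD.symm
    obtain ⟨t', rfl, ht1, ht1'⟩ := hpos hdD'.symm
    subst hdD hdD'
    have c4 := card_inter_shift_le (l := l) (q := q + t * D) (s := t' - t) hD
    rw [show q + t * D + (t' - t) * D = q + t' * D by ring] at c4
    have e1 := hboth t' (by omega) (by omega) ((mem_zap_shift hD).2 (by omega))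
      ((mem_zap_shift hD).2 (by omega))
    have e2 := hboth (t' + 1) (by omega) (by omega) ((mem_zap_shift hD).2 (by omega))
      ((mem_zap_shift hD).2 (by omega))
    omega
  · obtain ⟨t, rfl, ht, ht'⟩ := hneg hdD.symm
    subst hdD
    refine interval_false (q := q) (x := t) (y := l) (m := -t) (w := w) hs hL hD hdD' hP' (by omega)
      (by omega) ?_ ?_
    · intro i h1 h2
      rcases lt_or_ge i 0 with h | h
      · exact hP ((mem_zap_shift hD).2 (by omega))
      · exact hQ ((mem_zap_index hD).2 (by omega))
    · intro i h1 h2 h3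
      by_contra! hc
      exact hc.2.1 (hboth i (by omega) (by omega) ((mem_zap_shift hD).2 (by omega)) h3)
  · obtain ⟨t, rfl, ht, ht'⟩ := hpos hdD'.symm
    subst hdD'
    refine interval_false (q := q) (x := 0) (y := l + t) (m := t) (w := w) hs hL hD hdD hP (by omega)
      (by omega) ?_ ?_
    · intro i h1 h2
      rcases lt_or_ge i l with h | h
      · exact hQ ((mem_zap_index hD).2 (by omega))
      · exact hP' ((mem_zap_shift hD).2 (by omega))
    · intro i h1 h2 h3
      by_contra! hc
      exact hc.2.1 (hboth i (by omega) (by omega) h3 ((mem_zap_shift hD).2 (by omega)))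
  · have hu := card_inter_union_le_of_separated hD hdD hdD' ⟨i₃, mem_erase.2 ⟨w3, hi₃⟩⟩ hsep
    have hbig := card_union_three hP hP' hQ cQ cP cP' hL
    have hdd : d = d' := by
      by_contra hne
      have := two_mul_card_inter_le (l := l) (p := p) (p' := p') hd0 hd0' hne
      omega
    subst hdd
    obtain ⟨t, rfl⟩ := exists_shift (l := l) (q := p) (p := p') (D := d) (card_pos.1 (by omega))
    have c4 := card_inter_shift_le (l := l) (q := p) (s := t) hd0
    refine same_step_false (s := t) hD hdD (w := w) b1.1.1 h12 h23 h34 b4.1.2 (by omega)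
      b1.2 b2.2 b3.2 b4.2 ?_ ?_ hboth
    · intro hc
      exact w2 (hboth i₂ b2.1.1 b2.1.2 b2.2 hc)
    · intro hc
      exact w3 (hboth i₃ b3.1.1 b3.1.2 hc b3.2)

/-- After division by the gcd of the steps, the common positions form a progression with difference
`b`, the reduced step of `P`. At least `s` of them lie in an interval of length `l - 1`, which
bounds `b`. -/
lemma zpos_structure {l s : ℕ} {q D p d : ℤ} (hD : 0 < D) (hd : 0 < d) (hs : 2 ≤ s)
    (hcard : s ≤ (zpos q D 0 l (zap l p d)).card) :
    ∃ b : ℤ, 0 < b ∧ b ≤ ((l - 1) / (s - 1) : ℕ) ∧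
      ∀ i ∈ zpos q D 0 l (zap l p d), ∀ j ∈ zpos q D 0 l (zap l p d), i < j →
        i + b ≤ j ∧ i + b ∈ zpos q D 0 l (zap l p d) ∧ j - b ∈ zpos q D 0 l (zap l p d) := by
  obtain ⟨a, b, g, hg, hco, hDa, hdb⟩ : ∃ a b g : ℤ, 0 < g ∧ IsCoprime a b ∧ D = a * g ∧
      d = b * g := by
    obtain ⟨g, a, b, hg, hab, h1, h2⟩ := Int.exists_gcd_one' (Int.gcd_pos_of_ne_zero_left d hD.ne')
    exact ⟨a, b, g, by exact_mod_cast hg, Int.isCoprime_iff_gcd_eq_one.2 hab, h1, h2⟩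
  subst hDa hdb
  have ha : 0 < a := pos_of_mul_pos_left hD hg.le
  have hb : 0 < b := pos_of_mul_pos_left hd hg.le
  have step : ∀ {i j i' j' : ℤ}, p + j * (b * g) = q + i * (a * g) →
      p + j' * (b * g) = q + i' * (a * g) → ∃ n, i' = i + n * b ∧ j' = j + n * a := by
    intro i j i' j' h h'
    have e : (j' - j) * b = (i' - i) * a := by
      refine mul_right_cancel₀ hg.ne' ?_
      linear_combination h' - h
    obtain ⟨n, hn⟩ : b ∣ i' - i := hco.symm.dvd_of_dvd_mul_right ⟨j' - j, by linarith⟩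
    refine ⟨n, by linarith, ?_⟩
    have : (j' - j) = n * a := mul_right_cancel₀ hb.ne' (by rw [e, hn]; ring)
    linarith
  set S := zpos q (a * g) 0 l (zap l p (b * g)) with hS
  have hne : S.Nonempty := card_pos.1 (by omega)
  refine ⟨b, hb, ?_, ?_⟩
  · have hsub : S ⊆ (Icc 0 (((l : ℤ) - 1) / b)).image fun n => S.min' hne + n * b := by
      intro i hi
      have h1 := mem_zpos.1 (S.min'_mem hne)
      have h2 := mem_zpos.1 hi
      obtain ⟨j₁, -, -, e₁⟩ := mem_zap.1 h1.2
      obtain ⟨j₂, -, -, e₂⟩ := mem_zap.1 h2.2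
      obtain ⟨n, hn, -⟩ := step e₁ e₂
      have hle := S.min'_le i hi
      refine mem_image.2 ⟨n, mem_Icc.2 ⟨?_, ?_⟩, hn.symm⟩
      · exact nonneg_of_mul_nonneg_left (show 0 ≤ n * b by omega) hb
      · rw [Int.le_ediv_iff_mul_le hb]
        omega
    have hc := hcard.trans ((card_le_card hsub).trans card_image_le)
    rw [Int.card_Icc] at hc
    have hdiv : (s : ℤ) - 1 ≤ ((l : ℤ) - 1) / b := by omega
    rw [Int.le_ediv_iff_mul_le hb] at hdiv
    have hl : 1 ≤ l := by
      by_contra hl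
      have : (l : ℤ) - 1 < 0 := by omega
      nlinarith
    push_cast [show 1 ≤ s by omega, hl]
    rw [Int.le_ediv_iff_mul_le (by omega)]
    linarith
  · intro i hi j hj hij
    have h1 := mem_zpos.1 hi
    have h2 := mem_zpos.1 hj
    obtain ⟨j₁, l₁, u₁, e₁⟩ := mem_zap.1 h1.2
    obtain ⟨j₂, l₂, u₂, e₂⟩ := mem_zap.1 h2.2
    obtain ⟨n, rfl, rfl⟩ := step e₁ e₂
    have hn : 1 ≤ n := pos_of_mul_pos_left (show 0 < n * b by omega) hb.le
    have r₁ : b ≤ n * b := le_mul_of_one_le_left hb.le hn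
    have r₂ : a ≤ n * a := le_mul_of_one_le_left ha.le hn
    refine ⟨by omega, mem_zpos.2 ⟨by omega, ?_⟩, mem_zpos.2 ⟨by omega, ?_⟩⟩
    · rw [show q + (i + b) * (a * g) = p + (j₁ + a) * (b * g) by linear_combination -e₁]
      exact mem_zap.2 ⟨_, by omega, by omega, rfl⟩
    · rw [show q + (i + n * b - b) * (a * g) = p + (j₁ + n * a - a) * (b * g) by
        linear_combination -e₁]
      exact mem_zap.2 ⟨_, by omega, by omega, rfl⟩

lemma exists_smallest_step {l : ℕ} {L : Finset ℤ} (h : ∃ p d, 0 < d ∧ zap l p d ⊆ L) :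
    ∃ q D, 0 < D ∧ zap l q D ⊆ L ∧ ∀ p d, 0 < d → zap l p d ⊆ L → D ≤ d := by
  classical
  have h' : ∃ n : ℕ, 0 < n ∧ ∃ p, zap l p n ⊆ L := by
    obtain ⟨p, d, hd, hs⟩ := h
    lift d to ℕ using hd.le
    exact ⟨d, by exact_mod_cast hd, p, hs⟩
  obtain ⟨h1, q, h2⟩ := Nat.find_spec h'
  refine ⟨q, Nat.find h', by exact_mod_cast h1, h2, fun p d hd hs => ?_⟩
  lift d to ℕ using hd.le
  exact_mod_cast Nat.find_min' h' ⟨by exact_mod_cast hd, p, hs⟩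

/-- Record each `l`-AP in `L` by its positions on one of smallest step. By `not_separated` no two of
these sets are separated, so, as in Helly's theorem on the line, one position `x` is straddled by
all of them. Their gaps are at most `(l - 1) / (s - 1)`, so a window of that length at `x` meets
each of them. -/
lemma exists_int_transversal {l s : ℕ} {L : Finset ℤ} (hs : 3 ≤ s) (hL : L.card + s ≤ 2 * l)
    (w : ℤ) : ∃ Y : Finset ℤ, w ∉ Y ∧ Y.card ≤ (l - 1) / (s - 1) ∧
      (∀ p d, 0 < d → zap l p d ⊆ L → ∃ y ∈ Y, y ∈ zap l p d) ∧
      ∀ y ∈ Y, ∃ p d, 0 < d ∧ zap l p d ⊆ L ∧ y ∈ zap l p d := by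
  classical
  by_cases hex : ∃ p d, 0 < d ∧ zap l p d ⊆ L
  swap
  · push Not at hex
    exact ⟨∅, by simp, by simp, fun p d hd h => absurd h (hex p d hd), by simp⟩
  obtain ⟨q, D, hD, hQ, hmin⟩ := exists_smallest_step hex
  have hcard : ∀ p d, 0 < d → zap l p d ⊆ L → s ≤ (zpos q D 0 l (zap l p d)).card := by
    intro p d hd hP
    rw [card_zpos hD]
    exact card_inter_ge hQ hP (card_zap hD) (card_zap hd) hL
  obtain ⟨w', hw'⟩ : ∃ w' : ℤ, ∀ i, i ≠ w' → q + i * D ≠ w := by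
    by_cases h : ∃ i, q + i * D = w
    · obtain ⟨i, hi⟩ := h
      exact ⟨i, fun j hj h => hj (add_mul_injective hD (h.trans hi.symm))⟩
    · push Not at h
      exact ⟨0, fun i _ => h i⟩
  set T := (l - 1) / (s - 1) with hT
  -- a position that lies between two positions of each progression
  obtain ⟨x, hx0, hxw, hx⟩ : ∃ x : ℤ, (0 ≤ x ∧ x < l) ∧ x ≠ w' ∧ ∀ p d, 0 < d → zap l p d ⊆ L →
      ∃ i ∈ zpos q D 0 l (zap l p d), ∃ j ∈ zpos q D 0 l (zap l p d), i ≤ x ∧ x ≤ j := by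
    have hne : ∀ p d, 0 < d → zap l p d ⊆ L → ((zpos q D 0 l (zap l p d)).erase w').Nonempty := by
      intro p d hd hP
      rw [← card_pos]
      have h1 := pred_card_le_card_erase (s := zpos q D 0 l (zap l p d)) (a := w')
      have h2 := hcard p d hd hP
      omega
    -- The first positions other than `w'`. The largest of them is the required `x`: a progression
    -- lying entirely to its left would be separated from the one that attains it.
    let Xs : Finset ℤ := (Ico 0 (l : ℤ)).filter fun x => ∃ p d, 0 < d ∧ zap l p d ⊆ L ∧
      x ∈ (zpos q D 0 l (zap l p d)).erase w' ∧ ∀ i ∈ (zpos q D 0 l (zap l p d)).erase w', x ≤ i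
    have hmem : ∀ p d, 0 < d → zap l p d ⊆ L → ∃ x ∈ Xs, x ∈ zpos q D 0 l (zap l p d) := by
      intro p d hd hP
      have h1 := min'_mem _ (hne p d hd hP)
      have h2 := (mem_erase.1 h1).2
      exact ⟨_, mem_filter.2 ⟨mem_Ico.2 (mem_zpos.1 h2).1, p, d, hd, hP, h1,
        fun i hi => min'_le _ i hi⟩, h2⟩
    have hXs : Xs.Nonempty := by
      obtain ⟨x, hx, -⟩ := hmem q D hD hQ
      exact ⟨x, hx⟩
    have hxm := Xs.max'_mem hXs
    obtain ⟨hx1, p₁, d₁, hd₁, hP₁, hx2, hx3⟩ := mem_filter.1 hxm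
    refine ⟨Xs.max' hXs, mem_Ico.1 hx1, (mem_erase.1 hx2).1, fun p d hd hP => ?_⟩
    obtain ⟨i, hi1, hi2⟩ := hmem p d hd hP
    refine ⟨i, hi2, ?_⟩
    by_contra! hc
    refine not_separated (w := w') hs hL hD (hmin p d hd hP) (hmin p₁ d₁ hd₁ hP₁) hQ hP hP₁ ?_
    intro a ha haw b hb hbw
    have h1 := hx3 b (mem_erase.2 ⟨hbw, hb⟩)
    have h2 := hc a ha (Xs.le_max' i hi1)
    omega
  have hTl : ∀ p d, 0 < d → zap l p d ⊆ L → ∃ b : ℤ, 0 < b ∧ b ≤ T ∧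
      ∀ i ∈ zpos q D 0 l (zap l p d), ∀ j ∈ zpos q D 0 l (zap l p d), i < j →
        i + b ≤ j ∧ i + b ∈ zpos q D 0 l (zap l p d) ∧ j - b ∈ zpos q D 0 l (zap l p d) :=
    fun p d hd hP => zpos_structure hD hd (by omega) (hcard p d hd hP)
  -- a window of positions that avoids `w'`
  suffices h : ∃ W : Finset ℤ, W.card ≤ T ∧ (∀ i ∈ W, (0 ≤ i ∧ i < l) ∧ i ≠ w') ∧
      ∀ p d, 0 < d → zap l p d ⊆ L → ∃ i ∈ W, i ∈ zpos q D 0 l (zap l p d) by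
    obtain ⟨W, h1, h2, h3⟩ := h
    refine ⟨W.image fun i => q + i * D, ?_, card_image_le.trans h1, ?_, ?_⟩
    · intro hw
      obtain ⟨i, hi, hiw⟩ := mem_image.1 hw
      exact hw' i (h2 i hi).2 hiw
    · intro p d hd hP
      obtain ⟨i, hi, hi'⟩ := h3 p d hd hP
      exact ⟨_, mem_image_of_mem _ hi, (mem_zpos.1 hi').2⟩
    · intro y hy
      obtain ⟨i, hi, rfl⟩ := mem_image.1 hy
      exact ⟨q, D, hD, hQ, (mem_zap_index hD).2 (h2 i hi).1⟩
  -- The window extends from `x` in the direction away from `w'`.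
  rcases lt_or_gt_of_ne hxw with hlt | hlt
  · refine ⟨(Ioc (x - T) x).filter (0 ≤ ·), (card_filter_le _ _).trans (by simp), ?_, ?_⟩
    · intro i hi
      rw [mem_filter, mem_Ioc] at hi
      omega
    · intro p d hd hP
      obtain ⟨i, hi, j, hj, hix, hxj⟩ := hx p d hd hP
      obtain ⟨b, hb, hbT, hst⟩ := hTl p d hd hP
      rcases hxj.eq_or_lt with rfl | hxj
      · exact ⟨x, by rw [mem_filter, mem_Ioc]; omega, hj⟩
      have hne : ((zpos q D 0 l (zap l p d)).filter (x < ·)).Nonempty :=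
        ⟨j, mem_filter.2 ⟨hj, hxj⟩⟩
      obtain ⟨M, hm, hM'⟩ : ∃ M, M ∈ (zpos q D 0 l (zap l p d)).filter (x < ·) ∧
          ∀ y ∈ (zpos q D 0 l (zap l p d)).filter (x < ·), M ≤ y :=
        ⟨_, min'_mem _ hne, fun y hy => min'_le _ y hy⟩
      rw [mem_filter] at hm
      have hmin' : ∀ y ∈ zpos q D 0 l (zap l p d), x < y → M ≤ y :=
        fun y hy hxy => hM' y (mem_filter.2 ⟨hy, hxy⟩)
      obtain ⟨s1, s2, s3⟩ := hst i hi _ hm.1 (by omega)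
      have hle : M - b ≤ x := by
        by_contra hc
        have := hmin' _ s3 (by omega)
        omega
      have := (mem_zpos.1 s3).1
      exact ⟨_, by rw [mem_filter, mem_Ioc]; omega, s3⟩
  · refine ⟨(Ico x (x + T)).filter (· < (l : ℤ)), (card_filter_le _ _).trans (by simp), ?_, ?_⟩
    · intro i hi
      rw [mem_filter, mem_Ico] at hi
      omega
    · intro p d hd hP
      obtain ⟨i, hi, j, hj, hix, hxj⟩ := hx p d hd hP
      obtain ⟨b, hb, hbT, hst⟩ := hTl p d hd hP
      rcases hix.eq_or_lt with rfl | hix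
      · exact ⟨i, by rw [mem_filter, mem_Ico]; omega, hi⟩
      have hne : ((zpos q D 0 l (zap l p d)).filter (· < x)).Nonempty :=
        ⟨i, mem_filter.2 ⟨hi, hix⟩⟩
      obtain ⟨M, hm, hM'⟩ : ∃ M, M ∈ (zpos q D 0 l (zap l p d)).filter (· < x) ∧
          ∀ y ∈ (zpos q D 0 l (zap l p d)).filter (· < x), y ≤ M :=
        ⟨_, max'_mem _ hne, fun y hy => le_max' _ y hy⟩
      rw [mem_filter] at hm
      have hmax' : ∀ y ∈ zpos q D 0 l (zap l p d), y < x → y ≤ M :=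
        fun y hy hxy => hM' y (mem_filter.2 ⟨hy, hxy⟩)
      obtain ⟨s1, s2, s3⟩ := hst _ hm.1 j hj (by omega)
      have hle : x ≤ M + b := by
        by_contra hc
        have := hmax' _ s2 (by omega)
        omega
      have := (mem_zpos.1 s2).1
      exact ⟨_, by rw [mem_filter, mem_Ico]; omega, s2⟩

lemma image_cast_ap {q a d : ℕ} : (ap q a d).image (Nat.cast : ℕ → ℤ) = zap q a d := by
  ext x
  simp only [mem_image, mem_ap, mem_zap]
  constructor
  · rintro ⟨_, ⟨i, hi, rfl⟩, rfl⟩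
    exact ⟨i, by omega, by omega, by push_cast; ring⟩
  · rintro ⟨i, h0, h1, rfl⟩
    lift i to ℕ using h0
    exact ⟨a + i * d, ⟨i, by omega, rfl⟩, by push_cast; ring⟩

lemma exists_ap_of_zap {l : ℕ} (hl : 0 < l) {p d : ℤ} (hd : 0 < d) {L : Finset ℕ}
    (h : zap l p d ⊆ L.image (Nat.cast : ℕ → ℤ)) :
    ∃ a e : ℕ, 0 < e ∧ ap l a e ⊆ L ∧ (ap l a e).image (Nat.cast : ℕ → ℤ) = zap l p d := by
  have hp : p ∈ zap l p d := mem_zap.2 ⟨0, le_rfl, by exact_mod_cast hl, by ring⟩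
  obtain ⟨a, -, rfl⟩ := mem_image.1 (h hp)
  lift d to ℕ using hd.le
  refine ⟨a, d, by exact_mod_cast hd, ?_, image_cast_ap⟩
  rw [← image_cast_ap] at h
  exact (image_subset_image_iff Nat.cast_injective).1 h

/-- A set that is not much larger than an `l`-AP has a small set of points meeting all of its
`l`-APs, which may be chosen to avoid a given point `w`. -/
theorem exists_small_transversal {l s : ℕ} (hl : 0 < l) {L : Finset ℕ} (hs : 3 ≤ s)
    (hL : L.card + s ≤ 2 * l) (w : ℕ) : ∃ Y : Finset ℕ, w ∉ Y ∧ Y.card ≤ (l - 1) / (s - 1) ∧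
      (∀ P, IsAP l P → P ⊆ L → ∃ y ∈ Y, y ∈ P) ∧
      ∀ y ∈ Y, ∃ P, IsAP l P ∧ P ⊆ L ∧ y ∈ P := by
  obtain ⟨Y, hwY, hc, h1, h2⟩ := exists_int_transversal (L := L.image (Nat.cast : ℕ → ℤ)) hs
    (by rwa [card_image_of_injective _ Nat.cast_injective]) w
  refine ⟨Y.preimage Nat.cast Nat.cast_injective.injOn, ?_, ?_, ?_, ?_⟩
  · simpa using hwY
  · refine (card_le_card_of_injOn Nat.cast ?_ Nat.cast_injective.injOn).trans hc
    intro y hy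
    simpa using hy
  · rintro P ⟨a, d, hd, rfl⟩ hP
    obtain ⟨y, hy, hy'⟩ := h1 a d (by exact_mod_cast hd) (by
      rw [← image_cast_ap]
      exact image_subset_image hP)
    rw [← image_cast_ap] at hy'
    obtain ⟨z, hz, rfl⟩ := mem_image.1 hy'
    exact ⟨z, by simpa using hy, hz⟩
  · intro y hy
    obtain ⟨p, d, hd, hP, hyP⟩ := h2 y (by simpa using hy)
    obtain ⟨a, e, he, haL, heq⟩ := exists_ap_of_zap hl hd hP
    refine ⟨_, ⟨a, e, he, rfl⟩, haL, ?_⟩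
    rw [← heq] at hyP
    simpa using hyP

/-! ### Degrees of freedom -/

lemma finrank_le_card_of_vanish (J : Finset ℕ) : ∀ (W : Submodule ℚ (ℕ → ℚ))
    [FiniteDimensional ℚ W], (∀ y ∈ W, (∀ j ∈ J, y j = 0) → y = 0) →
    Module.finrank ℚ W ≤ J.card := by
  induction J using Finset.induction_on with
  | empty =>
    intro W _ h
    have : W = ⊥ := (Submodule.eq_bot_iff _).2 fun y hy => h y hy (by simp)
    simp [this]
  | insert j J hj ih =>
    intro W _ h
    have h1 := finrank_le_inf_ker_add_one (W := W) (LinearMap.proj j)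
    have h2 := ih (W ⊓ LinearMap.ker (LinearMap.proj j)) fun y hy h0 => h y hy.1 fun i hi => by
      rcases mem_insert.1 hi with rfl | hi
      · exact hy.2
      · exact h0 i hi
    rw [card_insert_of_notMem hj]
    omega

/-- Multiplication of a function by the indicator of `B`. -/
def cut (B : Finset ℕ) : (ℕ → ℚ) →ₗ[ℚ] (ℕ → ℚ) where
  toFun y x := if x ∈ B then y x else 0
  map_add' y z := by
    ext x
    by_cases h : x ∈ B <;> simp [h]
  map_smul' c y := by
    ext x
    by_cases h : x ∈ B <;> simp [h]

lemma cut_of_mem {B : Finset ℕ} {y : ℕ → ℚ} {x : ℕ} (h : x ∈ B) : cut B y x = y x := if_pos h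

lemma cut_of_notMem {B : Finset ℕ} {y : ℕ → ℚ} {x : ℕ} (h : x ∉ B) : cut B y x = 0 := if_neg h

/-- The rank-nullity inequality for restriction to `B`. -/
lemma finrank_le_of_cut {B : Finset ℕ} {W W₁ W₂ : Submodule ℚ (ℕ → ℚ)} [FiniteDimensional ℚ W]
    [FiniteDimensional ℚ W₁] [FiniteDimensional ℚ W₂] (h₁ : ∀ y ∈ W, cut B y ∈ W₁)
    (h₂ : ∀ y ∈ W, cut B y = 0 → y ∈ W₂) :
    Module.finrank ℚ W ≤ Module.finrank ℚ W₁ + Module.finrank ℚ W₂ := by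
  have h := LinearMap.finrank_range_add_finrank_ker ((cut B).comp W.subtype)
  have hr : Module.finrank ℚ (LinearMap.range ((cut B).comp W.subtype)) ≤
      Module.finrank ℚ W₁ := by
    refine Submodule.finrank_mono ?_
    rintro _ ⟨y, rfl⟩
    exact h₁ y y.2
  have hk : Module.finrank ℚ (LinearMap.ker ((cut B).comp W.subtype)) ≤
      Module.finrank ℚ W₂ := by
    rw [LinearEquiv.finrank_eq (Submodule.equivMapOfInjective W.subtype W.subtype_injective _)]
    refine Submodule.finrank_mono ?_
    rintro _ ⟨y, hy, rfl⟩
    exact h₂ y y.2 hy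
  omega

/-- Restrict a solution to `B`; the kernel consists of solutions on `C` over `A ∪ B`. Disjointness
ensures that a solution vanishes on the part of `A` outside `B`, as its restriction does. -/
lemma rk_union_le {k l : ℕ} {A B C : Finset ℕ} (hAC : Disjoint A C) :
    rk k l A (B ∪ C) ≤ rk k l A B + rk k l (A ∪ B) C := by
  refine finrank_le_of_cut (B := B) (fun y hy => ⟨fun x hx => cut_of_notMem hx, ?_⟩) ?_
  · intro e he hs
    obtain ⟨a, b, hab⟩ := hy.2 e he (by rw [← union_assoc]; exact hs.trans subset_union_left)
    refine ⟨a, b, fun x hx => ?_⟩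
    rw [← hab x hx]
    by_cases hxB : x ∈ B
    · exact cut_of_mem hxB
    · have hxA : x ∈ A := (mem_union.1 (hs hx)).resolve_right hxB
      rw [cut_of_notMem hxB, hy.1 x]
      rw [mem_union, not_or]
      exact ⟨hxB, disjoint_left.1 hAC hxA⟩
  · intro y hy h0
    refine ⟨fun x hx => ?_, fun e he hs => hy.2 e he (by rwa [← union_assoc])⟩
    by_cases hxB : x ∈ B
    · rw [← cut_of_mem (y := y) hxB, h0]
      rfl
    · exact hy.1 x (by simp [hx, hxB])

lemma rk_le_card_of_vanish {k l : ℕ} {A B J : Finset ℕ}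
    (h : ∀ y ∈ Sol k l A B, (∀ j ∈ J, y j = 0) → y = 0) : rk k l A B ≤ J.card :=
  finrank_le_card_of_vanish J _ h

lemma rk_sdiff_eq_zero {k l : ℕ} {A g : Finset ℕ} (hg : IsAP k g ∨ IsAP l g) {u v : ℕ}
    (hu : u ∈ g) (hv : v ∈ g) (huv : u ≠ v) (huA : u ∈ A) (hvA : v ∈ A) :
    rk k l A (g \ A) = 0 := by
  rw [← Nat.le_zero]
  refine (rk_le_card_of_vanish (J := ∅) fun y hy _ => ?_).trans (by simp)
  have h := (hy.2 g hg (by rw [union_sdiff_self_eq_union]; exact subset_union_right)).eq_zero_of_two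
    hu hv huv (hy.1 u (by simp [huA])) (hy.1 v (by simp [hvA]))
  ext x
  by_cases hx : x ∈ g
  · exact h x hx
  · exact hy.1 x (by simp [hx])

lemma rk_sdiff_le_one {k l : ℕ} {A g : Finset ℕ} (hg : IsAP k g ∨ IsAP l g) (hc : 2 ≤ g.card)
    {u : ℕ} (hu : u ∈ g) (huA : u ∈ A) : rk k l A (g \ A) ≤ 1 := by
  obtain ⟨v, hv, hvu⟩ := exists_mem_ne (s := g) (by omega) u
  refine (rk_le_card_of_vanish (J := {v}) fun y hy h0 => ?_).trans (by simp)
  have h := (hy.2 g hg (by rw [union_sdiff_self_eq_union]; exact subset_union_right)).eq_zero_of_two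
    hu hv hvu.symm (hy.1 u (by simp [huA])) (h0 v (by simp))
  ext x
  by_cases hx : x ∈ g
  · exact h x hx
  · exact hy.1 x (by simp [hx])

lemma rk_ap_le_two {k l : ℕ} {A g : Finset ℕ} (hg : IsAP k g ∨ IsAP l g) (hc : 2 ≤ g.card) :
    rk k l A g ≤ 2 := by
  obtain ⟨u, hu, v, hv, huv⟩ := one_lt_card.1 hc
  refine (rk_le_card_of_vanish (J := {u, v}) fun y hy h0 => ?_).trans card_le_two
  have h := (hy.2 g hg subset_union_right).eq_zero_of_two
    hu hv huv (h0 u (by simp)) (h0 v (by simp))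
  ext x
  by_cases hx : x ∈ g
  · exact h x hx
  · exact hy.1 x hx

/-! ### Blocks -/

/-- `A ⊆ V` contains each `l`-AP of `V` that it meets. -/
def LongClosed (l : ℕ) (V A : Finset ℕ) : Prop :=
  A ⊆ V ∧ ∀ e, IsAP l e → e ⊆ V → ∀ x ∈ e, x ∈ A → e ⊆ A

/-- `N` is a minimal nonempty long-closed subset of `V`. -/
def IsBlock (l : ℕ) (V N : Finset ℕ) : Prop :=
  LongClosed l V N ∧ N.Nonempty ∧ ∀ A, LongClosed l V A → A ⊆ N → A.Nonempty → A = N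

lemma LongClosed.inter {l : ℕ} {V A B : Finset ℕ} (hA : LongClosed l V A)
    (hB : LongClosed l V B) : LongClosed l V (A ∩ B) := by
  refine ⟨inter_subset_left.trans hA.1, fun e he hs x hx hxA => ?_⟩
  rw [mem_inter] at hxA
  exact subset_inter (hA.2 e he hs x hx hxA.1) (hB.2 e he hs x hx hxA.2)

lemma LongClosed.union {l : ℕ} {V A B : Finset ℕ} (hA : LongClosed l V A)
    (hB : LongClosed l V B) : LongClosed l V (A ∪ B) := by
  refine ⟨union_subset hA.1 hB.1, fun e he hs x hx hxA => ?_⟩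
  rcases mem_union.1 hxA with h | h
  · exact (hA.2 e he hs x hx h).trans subset_union_left
  · exact (hB.2 e he hs x hx h).trans subset_union_right

lemma LongClosed.sdiff {l : ℕ} {V A : Finset ℕ} (hA : LongClosed l V A) :
    LongClosed l V (V \ A) := by
  refine ⟨sdiff_subset, fun e he hs x hx hxA y hy => Finset.mem_sdiff.2 ⟨hs hy, fun hyA => ?_⟩⟩
  exact (Finset.mem_sdiff.1 hxA).2 (hA.2 e he hs y hy hyA hx)

lemma IsBlock.subset_of_mem {l : ℕ} {V A N : Finset ℕ} (hN : IsBlock l V N)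
    (hA : LongClosed l V A) {x : ℕ} (hxN : x ∈ N) (hxA : x ∈ A) : N ⊆ A := by
  have := hN.2.2 (A ∩ N) (hA.inter hN.1) inter_subset_right ⟨x, mem_inter.2 ⟨hxA, hxN⟩⟩
  rw [← this]
  exact inter_subset_left

lemma IsBlock.disjoint {l : ℕ} {V A N : Finset ℕ} (hN : IsBlock l V N)
    (hA : LongClosed l V A) {x : ℕ} (hxN : x ∈ N) (hxA : x ∉ A) : Disjoint A N := by
  rw [disjoint_left]
  intro y hyA hyN
  exact hxA (hN.subset_of_mem hA hyN hyA hxN)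

lemma IsBlock.eq_of_mem {l : ℕ} {V N N' : Finset ℕ} (hN : IsBlock l V N) (hN' : IsBlock l V N')
    {x : ℕ} (hx : x ∈ N) (hx' : x ∈ N') : N = N' :=
  (hN.subset_of_mem hN'.1 hx hx').antisymm (hN'.subset_of_mem hN.1 hx' hx)

/-- Intersect all long-closed sets containing `x`. Minimality holds because complements of
long-closed sets are long-closed. -/
lemma exists_isBlock {l : ℕ} {V : Finset ℕ} {x : ℕ} (hx : x ∈ V) : ∃ N, IsBlock l V N ∧ x ∈ N := by
  classical
  let N := V.filter fun y => ∀ A, LongClosed l V A → x ∈ A → y ∈ A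
  have hN : ∀ A, LongClosed l V A → x ∈ A → N ⊆ A := fun A hA hxA y hy => (mem_filter.1 hy).2 A hA hxA
  have hxN : x ∈ N := mem_filter.2 ⟨hx, fun _ _ h => h⟩
  have hcl : LongClosed l V N := by
    refine ⟨filter_subset _ _, fun e he hs y hy hyN z hz => mem_filter.2 ⟨hs hz, fun A hA hxA => ?_⟩⟩
    exact hA.2 e he hs y hy (hN A hA hxA hyN) hz
  refine ⟨N, ⟨hcl, ⟨x, hxN⟩, fun A hA hAN hne => ?_⟩, hxN⟩
  by_cases hxA : x ∈ A
  · exact hAN.antisymm (hN A hA hxA)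
  · obtain ⟨y, hy⟩ := hne
    exact absurd hy (Finset.mem_sdiff.1 (hN _ hA.sdiff (Finset.mem_sdiff.2 ⟨hx, hxA⟩) (hAN hy))).2

/-- A proper nonempty part of a block is left by some `l`-AP. -/
lemma IsBlock.exists_ap {l : ℕ} {V N S : Finset ℕ} (hN : IsBlock l V N) (hS : S ⊆ N)
    (hne : S.Nonempty) (hSN : S ≠ N) :
    ∃ g, IsAP l g ∧ g ⊆ N ∧ (∃ x ∈ g, x ∈ S) ∧ ∃ x ∈ g, x ∉ S := by
  by_contra! hc
  refine hSN (hN.2.2 S ⟨hS.trans hN.1.1, fun e he hs x hx hxS => ?_⟩ hS hne)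
  exact hc e he (hN.1.2 e he hs x hx (hS hxS)) ⟨x, hx, hxS⟩

/-! ### The parameters -/

/-- The density of a block that is neither sparse nor dense. -/
noncomputable def al (k l : ℕ) : ℝ := k / (l * (k - 1))

/-- The reciprocal of `k - 1`. -/
noncomputable def ga (k : ℕ) : ℝ := 1 / (k - 1)

lemma al_mul {k l : ℕ} (hk : 3 ≤ k) (hl : k < l) : al k l * l = 1 + ga k := by
  have h1 : (k : ℝ) - 1 ≠ 0 := by
    have : (3 : ℝ) ≤ k := by exact_mod_cast hk
    linarith
  have h2 : (l : ℝ) ≠ 0 := by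
    have : 0 < l := by omega
    exact_mod_cast this.ne'
  rw [al, ga]
  field_simp
  ring

lemma ga_mul {k : ℕ} (hk : 3 ≤ k) : ga k * (k - 1) = 1 := by
  have h1 : (k : ℝ) - 1 ≠ 0 := by
    have : (3 : ℝ) ≤ k := by exact_mod_cast hk
    linarith
  rw [ga]
  field_simp

lemma ga_pos {k : ℕ} (hk : 3 ≤ k) : 0 < ga k := by
  have : (3 : ℝ) ≤ k := by exact_mod_cast hk
  exact one_div_pos.2 (by linarith)

lemma ga_le {k : ℕ} (hk : 3 ≤ k) : ga k ≤ 1 / 2 := by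
  have : (3 : ℝ) ≤ k := by exact_mod_cast hk
  rw [ga]
  exact one_div_le_one_div_of_le (by norm_num) (by linarith)

lemma al_pos {k l : ℕ} (hk : 3 ≤ k) (hl : k < l) : 0 < al k l := by
  have : (3 : ℝ) ≤ k := by exact_mod_cast hk
  have : (k : ℝ) < l := by exact_mod_cast hl
  rw [al]
  exact div_pos (by linarith) (mul_pos (by linarith) (by linarith))

/-- Since `al * l = 1 + ga`, this says `al * (l - 1) > 1`: attaching an `l`-AP at one point gains
one degree of freedom but costs more in density. -/
lemma al_lt {k l : ℕ} (hk : 3 ≤ k) (hl : k < l) : al k l < ga k := by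
  have h1 : (3 : ℝ) ≤ k := by exact_mod_cast hk
  have h2 : (k : ℝ) < l := by exact_mod_cast hl
  have h3 := al_mul hk hl
  have h4 := ga_mul hk
  have h5 := al_pos hk hl
  have h6 := ga_pos hk
  have h7 : 1 + ga k = ga k * k := by linarith
  by_contra! hc
  nlinarith

/-- The rate at which the excess of a growing part of a block decreases. -/
noncomputable def decay (k l : ℕ) : ℝ := min (al k l) (ga k - al k l) / l

/-- A bound for the size of a block. -/
noncomputable def blockSize (k l : ℕ) : ℕ := ⌈2 * l + 1 / decay k l⌉₊

lemma decay_pos {k l : ℕ} (hk : 3 ≤ k) (hl : k < l) : 0 < decay k l := by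
  have : (0 : ℝ) < l := by
    have : 0 < l := by omega
    exact_mod_cast this
  exact div_pos (lt_min (al_pos hk hl) (by linarith [al_lt hk hl])) this

/-- No small subset of `X` has too few degrees of freedom. -/
def SmallFree (k l : ℕ) (X : Finset ℕ) : Prop :=
  ∀ S ⊆ X, S.card ≤ blockSize k l → al k l * S.card ≤ rk k l ∅ S

/-- Build the block from `e` by adding `l`-APs. Each new point lowers the excess `rk - al * card` by
at least `decay`, while `SmallFree` keeps the excess nonnegative. So the process stops at a bounded
size, and only the whole block can stop it. -/
lemma block_bound {k l : ℕ} (hk : 3 ≤ k) (hl : k < l) {V N : Finset ℕ} (hV : SmallFree k l V)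
    (hN : IsBlock l V N) {e : Finset ℕ} (he : IsAP l e) (heN : e ⊆ N) :
    N.card ≤ blockSize k l ∧
      rk k l ∅ N - al k l * N.card ≤ (1 - ga k) - decay k l * (N.card - l) := by
  classical
  have hα := al_pos hk hl
  have hαl := al_mul hk hl
  have hγ := ga_pos hk
  have hδ := decay_pos hk hl
  have hl0 : (0 : ℝ) < l := by
    have : 0 < l := by omega
    exact_mod_cast this
  have hδ1 : decay k l * l ≤ al k l := by
    rw [decay, div_mul_cancel₀ _ hl0.ne']
    exact min_le_left _ _
  have hδ2 : decay k l * l ≤ ga k - al k l := by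
    rw [decay, div_mul_cancel₀ _ hl0.ne']
    exact min_le_right _ _
  have hl1 : (1 : ℝ) ≤ l := by
    have : 1 ≤ l := by omega
    exact_mod_cast this
  have hM : (2 * l : ℝ) + 1 / decay k l ≤ blockSize k l := Nat.le_ceil _
  have hdd : decay k l * (1 / decay k l) = 1 := by field_simp
  have hd0 : 0 < 1 / decay k l := by positivity
  let T := N.powerset.filter fun S => e ⊆ S ∧ S.card ≤ blockSize k l ∧
    rk k l ∅ S - al k l * S.card ≤ (1 - ga k) - decay k l * (S.card - l)
  have heT : e ∈ T := by
    refine mem_filter.2 ⟨mem_powerset.2 heN, Subset.rfl, ?_, ?_⟩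
    · rw [he.card]
      have : (l : ℝ) ≤ blockSize k l := by linarith
      exact_mod_cast this
    · have h2 : (rk k l ∅ e : ℝ) ≤ 2 := by
        exact_mod_cast rk_ap_le_two (Or.inr he) (by rw [he.card]; omega)
      rw [he.card]
      linarith
  obtain ⟨S, hS, hmax⟩ := exists_max_image T card ⟨e, heT⟩
  obtain ⟨hSN, heS, hSc, hSF⟩ := mem_filter.1 hS
  rw [mem_powerset] at hSN
  by_cases hSN' : S = N
  · rw [← hSN']
    exact ⟨hSc, hSF⟩
  exfalso
  obtain ⟨g, hg, hgN, ⟨u, hu, huS⟩, ⟨v, hv, hvS⟩⟩ :=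
    hN.exists_ap hSN ((he.nonempty (by omega)).mono heS) hSN'
  have hV' := hV S (hSN.trans hN.1.1) hSc
  have hgS : (g \ S).card ≤ l - 1 := by
    have : (g \ S).card < g.card :=
      card_lt_card (Finset.ssubset_iff_subset_ne.2 ⟨sdiff_subset, fun h => by
        rw [← h] at hu
        exact (Finset.mem_sdiff.1 hu).2 huS⟩)
    rw [hg.card] at this
    omega
  have hgS0 : 1 ≤ (g \ S).card := card_pos.2 ⟨v, Finset.mem_sdiff.2 ⟨hv, hvS⟩⟩
  have hcard : (S ∪ g).card = S.card + (g \ S).card := by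
    rw [← union_sdiff_self_eq_union, card_union_of_disjoint disjoint_sdiff]
  have hrk : rk k l ∅ (S ∪ g) ≤ rk k l ∅ S + rk k l S (g \ S) := by
    have := rk_union_le (k := k) (l := l) (A := ∅) (B := S) (C := g \ S) (disjoint_empty_left _)
    rwa [empty_union, union_sdiff_self_eq_union] at this
  have hrk' : (rk k l ∅ (S ∪ g) : ℝ) ≤ rk k l ∅ S + rk k l S (g \ S) := by exact_mod_cast hrk
  -- Two common points determine `g`, so no freedom is gained. With one common point, one degree is
  -- gained against `l - 1` new points. The two terms in the minimum defining `decay` serve these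
  -- two cases.
  have hstep : (rk k l S (g \ S) : ℝ) + decay k l * (g \ S).card ≤ al k l * (g \ S).card := by
    by_cases h2 : ∃ z ∈ g, z ∈ S ∧ u ≠ z
    · obtain ⟨z, hz, hzS, huz⟩ := h2
      rw [rk_sdiff_eq_zero (Or.inr hg) hu hz huz huS hzS]
      have : decay k l ≤ al k l := by nlinarith
      have : (0 : ℝ) ≤ (g \ S).card := Nat.cast_nonneg _
      push_cast
      nlinarith
    · push Not at h2
      have h1 : (rk k l S (g \ S) : ℝ) ≤ 1 := by
        exact_mod_cast rk_sdiff_le_one (Or.inr hg) (by rw [hg.card]; omega) hu huS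
      have h3 : g \ S = g.erase u := by
        ext z
        rw [Finset.mem_sdiff, mem_erase]
        constructor
        · rintro ⟨h4, h5⟩
          exact ⟨fun h => h5 (h ▸ huS), h4⟩
        · rintro ⟨h4, h5⟩
          exact ⟨h5, fun h => h4 (h2 z h5 h).symm⟩
      rw [h3] at h1 ⊢
      rw [card_erase_of_mem hu, hg.card, Nat.cast_sub (by omega)]
      push_cast
      linarith
  have hmem : S ∪ g ∈ T := by
    refine mem_filter.2 ⟨mem_powerset.2 (union_subset hSN hgN), heS.trans subset_union_left, ?_, ?_⟩
    -- Nonnegative excess gives `|S| ≤ l + 1 / decay`; the second `l` in `blockSize` leaves room for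
    -- `g`.
    · have h1 : decay k l * ((S.card : ℝ) - l) ≤ decay k l * (1 / decay k l) := by linarith
      have h2 := le_of_mul_le_mul_left h1 hδ
      have h3 : ((g \ S).card : ℝ) ≤ l := by
        have : (g \ S).card ≤ l := by omega
        exact_mod_cast this
      have : ((S ∪ g).card : ℝ) ≤ blockSize k l := by
        rw [hcard]
        push_cast
        linarith
      exact_mod_cast this
    · rw [hcard]
      push_cast
      linarith
  have := hmax _ hmem
  omega

/-! ### Recolouring a block -/

/-- Color `V \ B` by minimality, then make `Y` blue and `B \ Y` red. -/
lemma MinimalNonColorable.false_of_recolor {k l : ℕ} {V B Y : Finset ℕ}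
    (hV : MinimalNonColorable k l V) (hB : B ⊆ V) (hne : B.Nonempty) (hY : Y ⊆ B)
    (hlong : ∀ e, IsAP l e → e ⊆ V → ∀ x ∈ e, x ∈ B → ∃ y ∈ Y, y ∈ e)
    (hshort : ∀ h, IsAP k h → h ⊆ V → ∀ x ∈ h, x ∈ B → ∃ y ∈ h, y ∈ B ∧ y ∉ Y) : False := by
  obtain ⟨R, hR, h1, h2⟩ := hV.2 (V \ B) (sdiff_ssubset hB hne)
  refine hV.1 ⟨R ∪ (B \ Y), union_subset (hR.trans sdiff_subset) (sdiff_subset.trans hB), ?_, ?_⟩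
  · intro e he hs
    by_cases hx : ∃ x ∈ e, x ∈ B
    · obtain ⟨x, hx, hxB⟩ := hx
      obtain ⟨y, hy, hye⟩ := hlong e he
        (hs.trans (union_subset (hR.trans sdiff_subset) (sdiff_subset.trans hB))) x hx hxB
      rcases mem_union.1 (hs hye) with h | h
      · exact (Finset.mem_sdiff.1 (hR h)).2 (hY hy)
      · exact (Finset.mem_sdiff.1 h).2 hy
    · push Not at hx
      refine h1 e he fun x hxe => ?_
      rcases mem_union.1 (hs hxe) with h | h
      · exact h
      · exact absurd (Finset.mem_sdiff.1 h).1 (hx x hxe)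
  · intro e he hs
    by_cases hx : ∃ x ∈ e, x ∈ B
    · obtain ⟨x, hx, hxB⟩ := hx
      obtain ⟨y, hy, hyB, hyY⟩ := hshort e he (hs.trans sdiff_subset) x hx hxB
      exact (Finset.mem_sdiff.1 (hs hy)).2
        (mem_union_right _ (Finset.mem_sdiff.2 ⟨hyB, hyY⟩))
    · push Not at hx
      refine h2 e he fun x hxe => ?_
      have := Finset.mem_sdiff.1 (hs hxe)
      rw [mem_union, not_or] at this
      exact Finset.mem_sdiff.2 ⟨Finset.mem_sdiff.2 ⟨this.1, hx x hxe⟩, this.2.1⟩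

/-- The hypothesis is `al * L ≤ 2` with denominators cleared; `s = 2 l - L` works. It yields
transversals of at most `k - 2` points. -/
lemma exists_slack {k l L : ℕ} (hk : 3 ≤ k) (hl : k < l) (h : k * L + 2 * l ≤ 2 * l * k) :
    ∃ s, 3 ≤ s ∧ L + s ≤ 2 * l ∧ (l - 1) / (s - 1) + 2 ≤ k := by
  have hL : L + 3 ≤ 2 * l := by
    by_contra! hc
    nlinarith
  obtain ⟨s, hs⟩ := Nat.exists_eq_add_of_le hL
  refine ⟨s + 3, by omega, by omega, ?_⟩
  have hlt : (l - 1) / (s + 3 - 1) < k - 1 := by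
    rw [Nat.div_lt_iff_lt_mul (by omega)]
    obtain ⟨k, rfl⟩ := Nat.exists_eq_add_of_le hk
    obtain ⟨l, rfl⟩ := Nat.exists_eq_add_of_lt hl
    have h1 : (3 + k) * (L + 3 + s) = (3 + k) * (2 * (3 + k + l + 1)) := by rw [hs]
    rw [show 3 + k + l + 1 - 1 = 3 + k + l by omega, show 3 + k - 1 = k + 2 by omega,
      show s + 3 - 1 = s + 2 by omega]
    have h2 : 2 * (3 + k + l + 1) ≤ (3 + k) * (s + 3) := by nlinarith
    by_contra! hc
    nlinarith
  omega

/-- Here the hypothesis is `al * (L - 1) ≤ 2 - 2 * ga`, and the transversal may have only `k - 3`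
points. -/
lemma exists_slack' {k l L : ℕ} (hk : 3 ≤ k) (hl : k < l) (h : k * L + 4 * l ≤ 2 * l * k + k) :
    ∃ s, 3 ≤ s ∧ L + s ≤ 2 * l ∧ (l - 1) / (s - 1) + 3 ≤ k := by
  have hL : L + 3 ≤ 2 * l := by
    by_contra! hc
    nlinarith
  obtain ⟨s, hs⟩ := Nat.exists_eq_add_of_le hL
  refine ⟨s + 3, by omega, by omega, ?_⟩
  have hlt : (l - 1) / (s + 3 - 1) < k - 2 := by
    rw [Nat.div_lt_iff_lt_mul (by omega)]
    obtain ⟨k, rfl⟩ := Nat.exists_eq_add_of_le hk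
    obtain ⟨l, rfl⟩ := Nat.exists_eq_add_of_lt hl
    have h1 : (3 + k) * (L + 3 + s) = (3 + k) * (2 * (3 + k + l + 1)) := by rw [hs]
    rw [show 3 + k + l + 1 - 1 = 3 + k + l by omega, show 3 + k - 2 = k + 1 by omega,
      show s + 3 - 1 = s + 2 by omega]
    have h2 : 4 * (3 + k + l + 1) ≤ (3 + k) * (s + 4) := by nlinarith
    by_contra! hc
    nlinarith [mul_le_mul_of_nonneg_left h2 (Nat.zero_le (k + 1)),
      mul_le_mul_of_nonneg_left hc (Nat.zero_le (k + 3)), Nat.zero_le (k * l), Nat.zero_le (k * k)]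
  omega

/-! ### Flats -/

/-- The functions that are affine on the APs of `M` and vanish on `A`. -/
def van (k l : ℕ) (M A : Finset ℕ) : Submodule ℚ (ℕ → ℚ) where
  carrier := {y | y ∈ Sol k l ∅ M ∧ ∀ x ∈ A, y x = 0}
  zero_mem' := ⟨zero_mem _, fun _ _ => rfl⟩
  add_mem' := fun {y z} hy hz => ⟨add_mem hy.1 hz.1, fun x hx => by
    rw [Pi.add_apply, hy.2 x hx, hz.2 x hx, add_zero]⟩
  smul_mem' := fun c y hy => ⟨Submodule.smul_mem _ c hy.1, fun x hx => by
    rw [Pi.smul_apply, hy.2 x hx, smul_zero]⟩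

instance {k l : ℕ} {M A : Finset ℕ} : FiniteDimensional ℚ (van k l M A) :=
  finiteDimensional_of_supported fun _ hy => hy.1.1

lemma van_anti {k l : ℕ} {M A A' : Finset ℕ} (h : A ⊆ A') : van k l M A' ≤ van k l M A :=
  fun _ hy => ⟨hy.1, fun x hx => hy.2 x (h hx)⟩

open scoped Classical in
/-- The points of `M` at which each element of `van k l M A` vanishes. -/
noncomputable def clos (k l : ℕ) (M A : Finset ℕ) : Finset ℕ :=
  M.filter fun x => ∀ y ∈ van k l M A, y x = 0

lemma mem_clos {k l : ℕ} {M A : Finset ℕ} {x : ℕ} :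
    x ∈ clos k l M A ↔ x ∈ M ∧ ∀ y ∈ van k l M A, y x = 0 := by
  classical
  rw [clos, mem_filter]

lemma subset_clos {k l : ℕ} {M A : Finset ℕ} (h : A ⊆ M) : A ⊆ clos k l M A :=
  fun x hx => mem_clos.2 ⟨h hx, fun _ hy => hy.2 x hx⟩

lemma van_clos {k l : ℕ} {M A : Finset ℕ} (h : A ⊆ M) : van k l M (clos k l M A) = van k l M A :=
  (van_anti (subset_clos h)).antisymm fun y hy => ⟨hy.1, fun _ hx => (mem_clos.1 hx).2 y hy⟩

lemma clos_clos {k l : ℕ} {M A : Finset ℕ} (h : A ⊆ M) :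
    clos k l M (clos k l M A) = clos k l M A := by
  ext x
  rw [mem_clos, van_clos h, ← mem_clos]

lemma clos_subset {k l : ℕ} {M A : Finset ℕ} : clos k l M A ⊆ M := fun _ hx => (mem_clos.1 hx).1

lemma subset_of_two_mem {k l : ℕ} {M A g : Finset ℕ} (hA : clos k l M A = A)
    (hg : IsAP k g ∨ IsAP l g) (hgM : g ⊆ M) {u v : ℕ} (hu : u ∈ g) (hv : v ∈ g) (huv : u ≠ v)
    (huA : u ∈ A) (hvA : v ∈ A) : g ⊆ A := by
  intro x hx
  rw [← hA, mem_clos]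
  refine ⟨hgM hx, fun y hy => ?_⟩
  exact (hy.1.2 g hg (by rwa [empty_union])).eq_zero_of_two hu hv huv (hy.2 u huA) (hy.2 v hvA) x hx

lemma finrank_van_le {k l : ℕ} {M A g : Finset ℕ} (hg : IsAP k g ∨ IsAP l g) (hgM : g ⊆ M)
    (hc : 2 ≤ g.card) {u : ℕ} (hu : u ∈ g) (huA : u ∈ A) :
    Module.finrank ℚ (van k l M A) ≤ Module.finrank ℚ (van k l M (A ∪ g)) + 1 := by
  obtain ⟨v, hv, hvu⟩ := exists_mem_ne (s := g) (by omega) u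
  refine (finrank_le_inf_ker_add_one (LinearMap.proj v)).trans ?_
  gcongr
  refine Submodule.finrank_mono fun y hy => ⟨hy.1.1, fun x hx => ?_⟩
  rcases mem_union.1 hx with hx | hx
  · exact hy.1.2 x hx
  · exact (hy.1.1.2 g hg (by rwa [empty_union])).eq_zero_of_two hu hv hvu.symm (hy.1.2 u huA)
      hy.2 x hx

lemma rk_le_finrank_van_ap {k l : ℕ} {M g : Finset ℕ} (hg : IsAP k g ∨ IsAP l g) (hgM : g ⊆ M)
    (hc : 2 ≤ g.card) : rk k l ∅ M ≤ Module.finrank ℚ (van k l M g) + 2 := by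
  obtain ⟨u, hu, v, hv, huv⟩ := one_lt_card.1 hc
  have h1 := finrank_le_inf_ker_add_one (W := Sol k l ∅ M) (LinearMap.proj u)
  have h2 := finrank_le_inf_ker_add_one (W := Sol k l ∅ M ⊓ LinearMap.ker (LinearMap.proj u))
    (LinearMap.proj v)
  have h3 : Module.finrank ℚ ((Sol k l ∅ M ⊓ LinearMap.ker (LinearMap.proj u)) ⊓
      LinearMap.ker (LinearMap.proj v) : Submodule ℚ (ℕ → ℚ)) ≤
      Module.finrank ℚ (van k l M g) := by
    refine Submodule.finrank_mono fun y hy => ⟨hy.1.1, ?_⟩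
    exact (hy.1.1.2 g hg (by rwa [empty_union])).eq_zero_of_two hu hv huv hy.1.2 hy.2
  rw [rk]
  omega

/-- The indicator of `M` times an affine function. -/
def affine (M : Finset ℕ) (a b : ℚ) (x : ℕ) : ℚ := if x ∈ M then a + b * x else 0

lemma affine_mem_Sol {k l : ℕ} {M : Finset ℕ} (a b : ℚ) : affine M a b ∈ Sol k l ∅ M := by
  refine ⟨fun x hx => if_neg hx, fun e _ hs => ⟨a, b, fun x hx => if_pos ?_⟩⟩
  simpa using hs hx

/-- An element of `Sol k l ∅ M` is affine on the closure of an AP. -/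
lemma affine_on_clos {k l : ℕ} {M g : Finset ℕ} (hg : IsAP k g ∨ IsAP l g) (hgM : g ⊆ M)
    {y : ℕ → ℚ} (hy : y ∈ Sol k l ∅ M) : AffOn y (clos k l M g) := by
  obtain ⟨a, b, hab⟩ := hy.2 g hg (by rwa [empty_union])
  refine ⟨a, b, fun x hx => ?_⟩
  have hz : y - affine M a b ∈ van k l M g := by
    refine ⟨sub_mem hy (affine_mem_Sol a b), fun x hx => ?_⟩
    rw [Pi.sub_apply, hab x hx, affine, if_pos (hgM hx), sub_self]
  have h := (mem_clos.1 hx).2 _ hz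
  rw [Pi.sub_apply, affine, if_pos (mem_clos.1 hx).1, sub_eq_zero] at h
  exact h

lemma al_mul_mul {k l : ℕ} (hk : 3 ≤ k) (hl : k < l) : al k l * (l * (k - 1)) = k := by
  have h := al_mul hk hl
  have h' := ga_mul hk
  linear_combination h * ((k : ℝ) - 1) + h'

lemma card_le_of_al_mul_le {k l n : ℕ} (hk : 3 ≤ k) (hl : k < l) {a b : ℝ}
    (h : al k l * n ≤ a + b * ga k) : (k : ℝ) * n ≤ (a * (k - 1) + b) * l := by
  have h1 : (3 : ℝ) ≤ k := by exact_mod_cast hk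
  have h2 : (k : ℝ) < l := by exact_mod_cast hl
  have h3 : 0 ≤ (l : ℝ) * (k - 1) := mul_nonneg (by linarith) (by linarith)
  have h4 := mul_le_mul_of_nonneg_right h h3
  have h5 := al_mul_mul hk hl
  have h6 := ga_mul hk
  calc (k : ℝ) * n = al k l * n * (l * (k - 1)) := by linear_combination -(n : ℝ) * h5
    _ ≤ _ := h4
    _ = _ := by linear_combination b * l * h6

open scoped Classical in
/-- A block that is attached to the rest of a minimal non-colorable set at one point only has few
degrees of freedom. -/
theorem not_attached_at_point {k l : ℕ} (hk : 3 ≤ k) (hl : k < l) {V N : Finset ℕ} {v : ℕ}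
    (hV : MinimalNonColorable k l V) (hN : IsBlock l V N)
    (hatt : ∀ h, IsAP k h → h ⊆ V → ∀ x ∈ h, x ∈ N → x ≠ v → h ⊆ insert v N)
    (hrk : al k l * N.card + (if v ∈ N then 0 else ga k) ≤ rk k l ∅ (insert v N))
    (hv : v ∉ N → ∃ f, IsAP k f ∧ v ∈ f ∧ f ⊆ insert v N) : False := by
  set M := insert v N with hM
  set γ₀ : ℝ := if v ∈ N then 0 else ga k with hγ₀
  have hNM : N ⊆ M := subset_insert _ _
  have hα := al_pos hk hl
  have hαl := al_mul hk hl
  have hαγ := al_lt hk hl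
  have hγ := ga_pos hk
  have hγ1 := ga_le hk
  have hγ₀0 : 0 ≤ γ₀ := by
    rw [hγ₀]
    split_ifs <;> linarith
  have hcovN : ∀ x ∈ N, ∃ e, IsAP l e ∧ e ⊆ N ∧ x ∈ e := by
    intro x hx
    obtain ⟨e, f, he, -, heV, -, hef⟩ := hV.saturated x (hN.1.1 hx)
    have hxe : x ∈ e := (mem_inter.1 (hef ▸ mem_singleton_self x)).1
    exact ⟨e, he, hN.1.2 e he heV x hxe hx, hxe⟩
  obtain ⟨g₀, hg₀, hg₀N, hvg₀⟩ : ∃ e, IsAP l e ∧ e ⊆ N ∧ (v ∈ N → v ∈ e) := by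
    by_cases hvN : v ∈ N
    · obtain ⟨e, he, heN, hve⟩ := hcovN v hvN
      exact ⟨e, he, heN, fun _ => hve⟩
    · obtain ⟨x, hx⟩ := hN.2.1
      obtain ⟨e, he, heN, -⟩ := hcovN x hx
      exact ⟨e, he, heN, fun h => absurd h hvN⟩
  have hg₀M := hg₀N.trans hNM
  have hg₀2 := rk_le_finrank_van_ap (k := k) (Or.inr hg₀) hg₀M (by rw [hg₀.card]; omega)
  -- If `g₀` spans `M`, the rank is at most `2`, so `N` itself is small enough to be recolored
  -- through a transversal.
  by_cases hcl : clos k l M g₀ = M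
  · have h0 : Module.finrank ℚ (van k l M g₀) = 0 := by
      rw [Submodule.finrank_eq_zero, Submodule.eq_bot_iff]
      intro y hy
      ext x
      by_cases hx : x ∈ M
      · rw [← hcl] at hx
        exact (mem_clos.1 hx).2 y hy
      · exact hy.1.1 x hx
    have hd : (rk k l ∅ M : ℝ) ≤ 2 := by
      exact_mod_cast (by omega : rk k l ∅ M ≤ 2)
    have h1 := card_le_of_al_mul_le (n := N.card) (a := 2) (b := 0) hk hl (by linarith)
    obtain ⟨s, hs, hNs, hsk⟩ := exists_slack (L := N.card) hk hl (by
      have : (k : ℝ) * N.card + 2 * l ≤ 2 * l * k := by linarith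
      exact_mod_cast this)
    obtain ⟨Y, hvY, hYc, hY1, hY2⟩ := exists_small_transversal (by omega) hs hNs v
    have hYN : Y ⊆ N := by
      intro y hy
      obtain ⟨P, -, hPN, hyP⟩ := hY2 y hy
      exact hPN hyP
    refine hV.false_of_recolor (B := N.erase v) (Y := Y) ((erase_subset _ _).trans hN.1.1) ?_ ?_ ?_ ?_
    · obtain ⟨x, hx, hxv⟩ := exists_mem_ne (s := g₀) (by rw [hg₀.card]; omega) v
      exact ⟨x, mem_erase.2 ⟨hxv, hg₀N hx⟩⟩
    · intro y hy
      exact mem_erase.2 ⟨fun h => hvY (h ▸ hy), hYN hy⟩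
    · intro e he heV x hx hxN
      exact hY1 e he (hN.1.2 e he heV x hx (mem_of_mem_erase hxN))
    · intro h hh hhV x hx hxN
      by_contra! hc
      rw [mem_erase] at hxN
      have hsub : h ⊆ insert v Y := by
        intro z hz
        rw [mem_insert]
        by_cases hzv : z = v
        · exact Or.inl hzv
        · have hzN := (mem_insert.1 (hatt h hh hhV x hx hxN.2 hxN.1 hz)).resolve_left hzv
          exact Or.inr (hc z hz (mem_erase.2 ⟨hzv, hzN⟩))
      have := (card_le_card hsub).trans (card_insert_le _ _)
      rw [hh.card] at this
      omega
  -- Proper flats whose rank is at most `al * |A ∩ N| + (1 - ga)`. For a largest such `A`, the set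
  -- `N \ A` will be small.
  let good : Finset (Finset ℕ) := M.powerset.filter fun A => clos k l M A = A ∧ A ≠ M ∧ g₀ ⊆ A ∧
    (rk k l ∅ M : ℝ) ≤ Module.finrank ℚ (van k l M A) + al k l * (A ∩ N).card + (1 - ga k)
  have hgood0 : clos k l M g₀ ∈ good := by
    refine mem_filter.2 ⟨mem_powerset.2 clos_subset, clos_clos hg₀M, hcl, subset_clos hg₀M, ?_⟩
    rw [van_clos hg₀M]
    have h1 : l ≤ (clos k l M g₀ ∩ N).card := by
      rw [← hg₀.card]
      exact card_le_card (subset_inter (subset_clos hg₀M) hg₀N)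
    have h2 : (l : ℝ) ≤ (clos k l M g₀ ∩ N).card := by exact_mod_cast h1
    have h3 : (rk k l ∅ M : ℝ) ≤ Module.finrank ℚ (van k l M g₀) + 2 := by exact_mod_cast hg₀2
    nlinarith
  obtain ⟨A, hA, hmax⟩ := exists_max_image good card ⟨_, hgood0⟩
  obtain ⟨hAM, hAcl, hAne, hgA, hAF⟩ := mem_filter.1 hA
  rw [mem_powerset] at hAM
  have hvA : v ∈ N → v ∈ A := fun h => hgA (hvg₀ h)
  have hNA : ¬ N ⊆ A := by
    intro hNA
    refine hAne (hAM.antisymm (insert_subset ?_ hNA))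
    by_cases hvN : v ∈ N
    · exact hvA hvN
    obtain ⟨f, hf, hvf, hfM⟩ := hv hvN
    have hc : 1 < (f.erase v).card := by
      rw [card_erase_of_mem hvf, hf.card]
      omega
    obtain ⟨a, ha, b, hb, hab⟩ := one_lt_card.1 hc
    rw [mem_erase] at ha hb
    have ha' := (mem_insert.1 (hfM ha.2)).resolve_left ha.1
    have hb' := (mem_insert.1 (hfM hb.2)).resolve_left hb.1
    exact subset_of_two_mem hAcl (Or.inl hf) hfM ha.2 hb.2 hab (hNA ha') (hNA hb') hvf
  obtain ⟨g, hg, hgN, ⟨w, hwg, hwA⟩, ⟨z, hzg, hzA⟩⟩ := hN.exists_ap (S := A ∩ N)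
    inter_subset_right ((hg₀.nonempty (by omega)).mono (subset_inter hgA hg₀N))
    (fun h => hNA (h ▸ inter_subset_left))
  have hwN := (mem_inter.1 hwA).2
  replace hwA := (mem_inter.1 hwA).1
  have hzA' : z ∉ A := fun h => hzA (mem_inter.2 ⟨h, hgN hzg⟩)
  have hgM := hgN.trans hNM
  have hgw : ∀ x ∈ g, x ∈ A → x = w := by
    intro x hx hxA
    by_contra hxw
    exact hzA' (subset_of_two_mem hAcl (Or.inr hg) hgM hx hwg hxw hxA hwA hzg)
  have hAg : A ∪ g ⊆ M := union_subset hAM hgM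
  have hstep : (Module.finrank ℚ (van k l M A) : ℝ) ≤
      Module.finrank ℚ (van k l M (A ∪ g)) + 1 := by
    exact_mod_cast finrank_van_le (Or.inr hg) hgM (by rw [hg.card]; omega) hwg hwA
  -- Adding `g` costs at most one rank and brings `l - 1` points of `N`, with `al * (l - 1) > 1`, so
  -- the bound persists. By maximality of `A` the enlarged flat is everything; hence `A` is a
  -- hyperplane.
  have hfull : clos k l M (A ∪ g) = M := by
    by_contra hne
    have hlt : A.card < (clos k l M (A ∪ g)).card := by
      refine card_lt_card ⟨subset_union_left.trans (subset_clos hAg), fun h => hzA' ?_⟩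
      exact h (subset_clos hAg (mem_union_right _ hzg))
    refine absurd (hmax _ (mem_filter.2 ⟨mem_powerset.2 clos_subset, clos_clos hAg, hne,
      hgA.trans (subset_union_left.trans (subset_clos hAg)), ?_⟩)) (not_le.2 hlt)
    rw [van_clos hAg]
    have hcard : (A ∩ N).card + (l - 1) ≤ (clos k l M (A ∪ g) ∩ N).card := by
      have h1 : (g.erase w).card = l - 1 := by rw [card_erase_of_mem hwg, hg.card]
      rw [← h1, ← card_union_of_disjoint]
      · refine card_le_card (union_subset ?_ ?_)
        · exact inter_subset_inter (subset_union_left.trans (subset_clos hAg)) Subset.rfl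
        · refine subset_inter ?_ ((erase_subset _ _).trans hgN)
          exact (erase_subset _ _).trans (subset_union_right.trans (subset_clos hAg))
      · rw [disjoint_left]
        intro x hx hxg
        rw [mem_erase] at hxg
        exact hxg.1 (hgw x hxg.2 (mem_inter.1 hx).1)
    have hcard' : ((A ∩ N).card : ℝ) + (l - 1) ≤ (clos k l M (A ∪ g) ∩ N).card := by
      have : ((l - 1 : ℕ) : ℝ) = l - 1 := by
        rw [Nat.cast_sub (by omega), Nat.cast_one]
      rw [← this]
      exact_mod_cast hcard
    nlinarith
  have hvan0 : ∀ y ∈ van k l M (A ∪ g), y = 0 := by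
    intro y hy
    ext x
    by_cases hx : x ∈ M
    · rw [← hfull] at hx
      exact (mem_clos.1 hx).2 y hy
    · exact hy.1.1 x hx
  have hvan1 : (Module.finrank ℚ (van k l M A) : ℝ) ≤ 1 := by
    have h0 : Module.finrank ℚ (van k l M (A ∪ g)) = 0 := by
      rw [Submodule.finrank_eq_zero, Submodule.eq_bot_iff]
      exact hvan0
    rw [h0] at hstep
    simpa using hstep
  -- a function that vanishes exactly on `A`
  obtain ⟨y, hyA, hyz⟩ : ∃ y ∈ van k l M A, y z ≠ 0 := by
    by_contra! hc
    refine hzA' ?_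
    rw [← hAcl, mem_clos]
    exact ⟨hgM hzg, hc⟩
  set B := N \ A with hB
  have hBcard : ((A ∩ N).card : ℝ) + B.card = N.card := by
    have : (A ∩ N).card + B.card = N.card := by
      rw [inter_comm, hB, add_comm]
      exact card_sdiff_add_card_inter N A
    exact_mod_cast this
  have hvB : v ∉ B := fun h => (Finset.mem_sdiff.1 h).2 (hvA (Finset.mem_sdiff.1 h).1)
  have hwB : w ∉ B := fun h => (Finset.mem_sdiff.1 h).2 hwA
  have hBα : al k l * B.card ≤ 2 - ga k - γ₀ := by nlinarith
  have hBl : B.card + 3 < 2 * l := by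
    have h1 := card_le_of_al_mul_le (n := B.card) (a := 2) (b := -1) hk hl (by linarith)
    have h2 : k * (B.card + 3) < k * (2 * l) := by
      have h3 : (k : ℝ) < l := by exact_mod_cast hl
      have h4 : (k : ℝ) * (B.card + 3) < k * (2 * l) := by linarith
      exact_mod_cast h4
    exact lt_of_mul_lt_mul_left h2 (Nat.zero_le k)
  have hgwB : g.erase w ⊆ B := by
    intro x hx
    rw [mem_erase] at hx
    exact Finset.mem_sdiff.2 ⟨hgN hx.2, fun h => hx.1 (hgw x hx.2 h)⟩
  have hzw : z ≠ w := fun h => hzA' (h ▸ hwA)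
  have hclosA : ∀ x ∈ clos k l M g, x ∈ A → x = w := by
    intro x hx hxA
    by_contra hxw
    have haff := affine_on_clos (Or.inr hg) hgM hyA.1
    exact hyz (haff.eq_zero_of_two hx (subset_clos hgM hwg) hxw (hyA.2 x hxA) (hyA.2 w hwA) z
      (subset_clos hgM hzg))
  have hlongB : ∀ e, IsAP l e → e ⊆ V → ∀ x ∈ e, x ∈ B → e ⊆ insert w B := by
    intro e he heV x hx hxB
    have heN := hN.1.2 e he heV x hx (Finset.mem_sdiff.1 hxB).1
    have heM := heN.trans hNM
    have heA : (e \ B).card ≤ 1 := by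
      refine card_le_one.2 fun a ha b hb => ?_
      rw [Finset.mem_sdiff] at ha hb
      by_contra hab
      have haA : a ∈ A := by
        by_contra h
        exact ha.2 (Finset.mem_sdiff.2 ⟨heN ha.1, h⟩)
      have hbA : b ∈ A := by
        by_contra h
        exact hb.2 (Finset.mem_sdiff.2 ⟨heN hb.1, h⟩)
      exact (Finset.mem_sdiff.1 hxB).2
        (subset_of_two_mem hAcl (Or.inr he) heM ha.1 hb.1 hab haA hbA hx)
    have heB : l - 1 ≤ (e ∩ B).card := by
      have := card_sdiff_add_card_inter e B
      rw [he.card] at this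
      omega
    -- Both sets have at least `l - 1` points in `B`, which has fewer than `2 l - 3`. Two common
    -- points put `e` into the closure of `g`, which meets `A` only in `w`.
    have hmeet : 1 < ((e ∩ B) ∩ (g.erase w)).card := by
      have h1 := card_union_add_card_inter (e ∩ B) (g.erase w)
      have h2 := card_le_card (union_subset (inter_subset_right (s₁ := e)) hgwB)
      rw [card_erase_of_mem hwg, hg.card] at h1
      omega
    obtain ⟨a, ha, b, hb, hab⟩ := one_lt_card.1 hmeet
    rw [mem_inter, mem_inter, mem_erase] at ha hb
    have hecl := subset_of_two_mem (k := k) (clos_clos hgM) (Or.inr he) heM ha.1.1 hb.1.1 hab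
      (subset_clos hgM ha.2.2) (subset_clos hgM hb.2.2)
    intro x hx
    rw [mem_insert]
    by_cases hxA : x ∈ A
    · exact Or.inl (hclosA x (hecl hx) hxA)
    · exact Or.inr (Finset.mem_sdiff.2 ⟨heN hx, hxA⟩)
  have hshortA : ∀ h, IsAP k h → h ⊆ V → ∀ x ∈ h, x ∈ B → (h ∩ A).card ≤ 1 ∧ h ⊆ M := by
    intro h hh hhV x hx hxB
    have hhM := hatt h hh hhV x hx (Finset.mem_sdiff.1 hxB).1 fun h => hvB (h ▸ hxB)
    refine ⟨card_le_one.2 fun a ha b hb => ?_, hhM⟩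
    rw [mem_inter] at ha hb
    by_contra hab
    exact (Finset.mem_sdiff.1 hxB).2
      (subset_of_two_mem hAcl (Or.inl hh) hhM ha.1 hb.1 hab ha.2 hb.2 hx)
  have hLcard : (insert w B).card = B.card + 1 := card_insert_of_notMem hwB
  have hslack : ∃ s, 3 ≤ s ∧ (insert w B).card + s ≤ 2 * l ∧
      (l - 1) / (s - 1) + (if v ∈ N then 2 else 3) ≤ k := by
    rw [hLcard]
    have h3 : (k : ℝ) < l := by exact_mod_cast hl
    by_cases hvN : v ∈ N
    · simp only [hγ₀, hvN, if_true] at hBα ⊢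
      have h1 := card_le_of_al_mul_le (n := B.card) (a := 2) (b := -1) hk hl (by linarith)
      refine exists_slack hk hl ?_
      have : (k : ℝ) * (B.card + 1) + 2 * l ≤ 2 * l * k := by linarith
      exact_mod_cast this
    · simp only [hγ₀, hvN, if_false] at hBα ⊢
      have h1 := card_le_of_al_mul_le (n := B.card) (a := 2) (b := -2) hk hl (by linarith)
      refine exists_slack' hk hl ?_
      have : (k : ℝ) * (B.card + 1) + 4 * l ≤ 2 * l * k + k := by linarith
      exact_mod_cast this
  obtain ⟨s, hs, hLs, hsk⟩ := hslack
  obtain ⟨Y, hwY, hYc, hY1, hY2⟩ := exists_small_transversal (by omega) hs hLs w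
  refine hV.false_of_recolor (B := B) (Y := Y) (sdiff_subset.trans hN.1.1)
    ⟨z, hgwB (mem_erase.2 ⟨hzw, hzg⟩)⟩ ?_ ?_ ?_
  · intro x hx
    obtain ⟨P, -, hPL, hxP⟩ := hY2 x hx
    exact (mem_insert.1 (hPL hxP)).resolve_left fun h => hwY (h ▸ hx)
  · intro e he heV x hx hxB
    exact hY1 e he (hlongB e he heV x hx hxB)
  · intro h hh hhV x hx hxB
    obtain ⟨hhA, hhM⟩ := hshortA h hh hhV x hx hxB
    by_contra! hc
    -- A `k`-AP that spoils the recoloring has at most one point in `A`, its points of `N` outside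
    -- `A` in `Y`, and possibly `v`: fewer than `k` points.
    have hsub : h ⊆ (h ∩ A) ∪ (Y ∪ if v ∈ N then ∅ else {v}) := by
      intro a ha
      by_cases haA : a ∈ A
      · exact mem_union_left _ (mem_inter.2 ⟨ha, haA⟩)
      refine mem_union_right _ ?_
      by_cases haN : a ∈ N
      · exact mem_union_left _ (hc a ha (Finset.mem_sdiff.2 ⟨haN, haA⟩))
      · have hav := (mem_insert.1 (hhM ha)).resolve_right haN
        refine mem_union_right _ ?_
        rw [if_neg (hav ▸ haN), mem_singleton]
        exact hav
    have h1 := card_le_card hsub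
    have h2 := card_union_le (h ∩ A) (Y ∪ if v ∈ N then ∅ else {v})
    have h3 := card_union_le Y (if v ∈ N then ∅ else {v})
    rw [hh.card] at h1
    split_ifs at hsk h1 h2 h3
    · rw [card_empty] at h3
      omega
    · rw [card_singleton] at h3
      omega

/-! ### Extending a closed set along a short progression -/

lemma finrank_le_sum_cut (W' : Finset ℕ → Submodule ℚ (ℕ → ℚ)) [∀ N, FiniteDimensional ℚ (W' N)]
    (𝓕 : Finset (Finset ℕ)) : ∀ (W : Submodule ℚ (ℕ → ℚ)) [FiniteDimensional ℚ W],
    (∀ y ∈ W, ∀ N ∈ 𝓕, cut N y ∈ W' N) → (∀ y ∈ W, (∀ N ∈ 𝓕, cut N y = 0) → y = 0) →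
    Module.finrank ℚ W ≤ ∑ N ∈ 𝓕, Module.finrank ℚ (W' N) := by
  induction 𝓕 using Finset.induction_on with
  | empty =>
    intro W _ _ h
    have : W = ⊥ := (Submodule.eq_bot_iff _).2 fun y hy => h y hy (by simp)
    simp [this]
  | insert N 𝓕 hN ih =>
    intro W _ h1 h2
    have h3 := finrank_le_of_cut (B := N) (W := W) (W₁ := W' N)
      (W₂ := W ⊓ LinearMap.ker (cut N)) (fun y hy => h1 y hy N (mem_insert_self _ _))
      fun y hy h0 => ⟨hy, h0⟩
    have h4 := ih (W ⊓ LinearMap.ker (cut N)) (fun y hy N' hN' => h1 y hy.1 N' (mem_insert_of_mem hN'))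
      fun y hy h0 => h2 y hy.1 fun N' hN' => by
        rcases mem_insert.1 hN' with rfl | hN'
        · exact hy.2
        · exact h0 N' hN'
    rw [sum_insert hN]
    omega

/-- The functions on the union of `𝓕` that are affine on the APs inside the members of `𝓕` and
on `f`. -/
def glue (k l : ℕ) (𝓕 : Finset (Finset ℕ)) (f : Finset ℕ) : Submodule ℚ (ℕ → ℚ) where
  carrier := {y | (∀ x, x ∉ 𝓕.biUnion id → y x = 0) ∧
    (∀ N ∈ 𝓕, ∀ e, (IsAP k e ∨ IsAP l e) → e ⊆ N → AffOn y e) ∧ AffOn y f}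
  zero_mem' := ⟨fun _ _ => rfl, fun _ _ e _ _ => affOn_zero e, affOn_zero f⟩
  add_mem' := fun {y z} hy hz =>
    ⟨fun x hx => by rw [Pi.add_apply, hy.1 x hx, hz.1 x hx, add_zero],
      fun N hN e he hs => (hy.2.1 N hN e he hs).add (hz.2.1 N hN e he hs), hy.2.2.add hz.2.2⟩
  smul_mem' := fun c y hy =>
    ⟨fun x hx => by rw [Pi.smul_apply, hy.1 x hx, smul_zero],
      fun N hN e he hs => (hy.2.1 N hN e he hs).smul c, hy.2.2.smul c⟩

instance {k l : ℕ} {𝓕 : Finset (Finset ℕ)} {f : Finset ℕ} : FiniteDimensional ℚ (glue k l 𝓕 f) :=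
  finiteDimensional_of_supported fun _ hy => hy.1

lemma Sol_le_glue {k l : ℕ} {𝓕 : Finset (Finset ℕ)} {f A : Finset ℕ} (hf : IsAP k f)
    (hfA : f ⊆ A ∪ 𝓕.biUnion id) : Sol k l A (𝓕.biUnion id) ≤ glue k l 𝓕 f := by
  refine fun y hy => ⟨hy.1, fun N hN e he hs => hy.2 e he ?_, hy.2 f (Or.inl hf) hfA⟩
  exact (hs.trans (subset_biUnion_of_mem id hN)).trans subset_union_right

/-- Constants on `N` are solutions, so vanishing at a point costs a dimension. For two points, `x -
u` supplies a second one. -/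
lemma finrank_van_add_one_le {k l : ℕ} {N f : Finset ℕ} (h : (f ∩ N).Nonempty) :
    Module.finrank ℚ (van k l N (f ∩ N)) + 1 ≤ rk k l ∅ N := by
  obtain ⟨u, hu⟩ := h
  have huN := (mem_inter.1 hu).2
  have h1 := finrank_inf_ker_lt (LinearMap.proj u) (affine_mem_Sol (k := k) (l := l) (M := N) 1 0)
    (by simp [affine, huN])
  have h2 : Module.finrank ℚ (van k l N (f ∩ N)) ≤ Module.finrank ℚ
      (Sol k l ∅ N ⊓ LinearMap.ker (LinearMap.proj u) : Submodule ℚ (ℕ → ℚ)) :=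
    Submodule.finrank_mono fun y hy => ⟨hy.1, hy.2 u hu⟩
  rw [rk]
  omega

lemma finrank_van_add_two_le {k l : ℕ} {N f : Finset ℕ} (h : 2 ≤ (f ∩ N).card) :
    Module.finrank ℚ (van k l N (f ∩ N)) + 2 ≤ rk k l ∅ N := by
  obtain ⟨u, hu, v, hv, huv⟩ := one_lt_card.1 h
  have huN := (mem_inter.1 hu).2
  have hvN := (mem_inter.1 hv).2
  have h1 := finrank_inf_ker_lt (LinearMap.proj u) (affine_mem_Sol (k := k) (l := l) (M := N) 1 0)
    (by simp [affine, huN])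
  have h3 := finrank_inf_ker_lt (W := Sol k l ∅ N ⊓ LinearMap.ker (LinearMap.proj u))
    (LinearMap.proj v) (y := affine N (-u) 1)
    ⟨affine_mem_Sol _ _, by simp [affine, huN]⟩
    (by
      have : (v : ℚ) ≠ u := by exact_mod_cast huv.symm
      simp only [LinearMap.coe_proj, Function.eval, affine, hvN, if_true, one_mul]
      intro h
      exact this (by linarith))
  have h2 : Module.finrank ℚ (van k l N (f ∩ N)) ≤ Module.finrank ℚ
      ((Sol k l ∅ N ⊓ LinearMap.ker (LinearMap.proj u)) ⊓ LinearMap.ker (LinearMap.proj v) :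
        Submodule ℚ (ℕ → ℚ)) :=
    Submodule.finrank_mono fun y hy => ⟨⟨hy.1, hy.2 u hu⟩, hy.2 v hv⟩
  rw [rk]
  omega

/-- As `y` is zero on `A`, its values on `f` have one free parameter if `f` meets `A` once, and none
otherwise. Once `y` vanishes on `f`, its restrictions to the members of `𝓕` lose one dimension each,
or two for a member that meets `f` twice. -/
lemma finrank_glue_le {k l : ℕ} (hk : 3 ≤ k) {𝓕 : Finset (Finset ℕ)} {f A : Finset ℕ}
    (hf : IsAP k f) (hdisj : Disjoint A (𝓕.biUnion id)) (hfA : (f ∩ A).Nonempty)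
    (hmeet : ∀ N ∈ 𝓕, (f ∩ N).Nonempty) :
    (Module.finrank ℚ (glue k l 𝓕 f) : ℝ) ≤
      ∑ N ∈ 𝓕, ((rk k l ∅ N : ℝ) - 1 - if 2 ≤ (f ∩ N).card then 1 else 0) +
        if (f ∩ A).card = 1 then 1 else 0 := by
  have hz : ∀ y ∈ glue k l 𝓕 f, ∀ x ∈ A, y x = 0 := fun y hy x hx => hy.1 x (disjoint_left.1 hdisj hx)
  have hsum : ∀ W : Submodule ℚ (ℕ → ℚ), ∀ _ : FiniteDimensional ℚ W, W ≤ glue k l 𝓕 f →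
      (∀ y ∈ W, ∀ x ∈ f, y x = 0) → (Module.finrank ℚ W : ℝ) ≤
      ∑ N ∈ 𝓕, ((rk k l ∅ N : ℝ) - 1 - if 2 ≤ (f ∩ N).card then 1 else 0) := by
    intro W _ hW hW0
    have h1 := finrank_le_sum_cut (fun N => van k l N (f ∩ N)) 𝓕 W (by
      refine fun y hy N hN => ⟨⟨fun x hx => cut_of_notMem hx, fun e he hs => ?_⟩, fun x hx => ?_⟩
      · rw [empty_union] at hs
        obtain ⟨a, b, hab⟩ := (hW hy).2.1 N hN e he hs
        exact ⟨a, b, fun x hx => by rw [cut_of_mem (hs hx), hab x hx]⟩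
      · rw [mem_inter] at hx
        rw [cut_of_mem hx.2, hW0 y hy x hx.1]) (by
      intro y hy h0
      ext x
      by_cases hx : x ∈ 𝓕.biUnion id
      · obtain ⟨N, hN, hxN⟩ := mem_biUnion.1 hx
        rw [← cut_of_mem (B := N) (y := y) hxN, h0 N hN]
      · exact (hW hy).1 x hx)
    have h2 : (Module.finrank ℚ W : ℝ) ≤ ∑ N ∈ 𝓕, (Module.finrank ℚ (van k l N (f ∩ N)) : ℝ) := by
      exact_mod_cast h1
    refine h2.trans (sum_le_sum fun N hN => ?_)
    split_ifs with h
    · have : ((Module.finrank ℚ (van k l N (f ∩ N)) + 2 : ℕ) : ℝ) ≤ rk k l ∅ N := by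
        exact_mod_cast finrank_van_add_two_le h
      push_cast at this
      linarith
    · have : ((Module.finrank ℚ (van k l N (f ∩ N)) + 1 : ℕ) : ℝ) ≤ rk k l ∅ N := by
        exact_mod_cast finrank_van_add_one_le (hmeet N hN)
      push_cast at this
      linarith
  obtain ⟨u, hu⟩ := hfA
  have huf := (mem_inter.1 hu).1
  have huA := (mem_inter.1 hu).2
  split_ifs with h1
  · obtain ⟨v, hv, hvu⟩ := exists_mem_ne (s := f) (by rw [hf.card]; omega) u
    have h2 := finrank_le_inf_ker_add_one (W := glue k l 𝓕 f) (LinearMap.proj v)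
    have h3 := hsum (glue k l 𝓕 f ⊓ LinearMap.ker (LinearMap.proj v)) inferInstance inf_le_left
      fun y hy => hy.1.2.2.eq_zero_of_two huf hv hvu.symm (hz y hy.1 u huA) hy.2
    have h4 : (Module.finrank ℚ (glue k l 𝓕 f) : ℝ) ≤ Module.finrank ℚ
      (glue k l 𝓕 f ⊓ LinearMap.ker (LinearMap.proj v) : Submodule ℚ (ℕ → ℚ)) + 1 := by
      exact_mod_cast h2
    linarith
  · have hc : 1 < (f ∩ A).card := by
      have := card_pos.2 ⟨u, hu⟩
      omega
    obtain ⟨a, ha, b, hb, hab⟩ := one_lt_card.1 hc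
    rw [mem_inter] at ha hb
    rw [add_zero]
    exact hsum _ inferInstance le_rfl fun y hy =>
      hy.2.2.eq_zero_of_two ha.1 hb.1 hab (hz y hy a ha.2) (hz y hy b hb.2)

/-- An AP on which `(x - v) 1_N` is affine and somewhere nonzero lies in `N ∪ {v}`. -/
lemma subset_insert_of_affOn {q : ℕ} (hq : 3 ≤ q) {N h : Finset ℕ} {v x : ℕ} (hh : IsAP q h)
    (haff : AffOn (affine N (-v) 1) h) (hx : x ∈ h) (hxN : x ∈ N) (hxv : x ≠ v) :
    h ⊆ insert v N := by
  intro z hz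
  by_contra hc
  rw [mem_insert, not_or] at hc
  have hz0 : affine N (-v) 1 z = 0 := if_neg hc.2
  obtain ⟨y, hy⟩ : ((h.erase x).erase z).Nonempty := by
    rw [← card_pos, card_erase_of_mem, card_erase_of_mem hx, hh.card]
    · omega
    · exact mem_erase.2 ⟨fun h => hc.2 (h ▸ hxN), hz⟩
  simp only [mem_erase] at hy
  have hxval : affine N (-v) 1 x = -v + 1 * x := if_pos hxN
  have hv0 : (x : ℚ) - v ≠ 0 := sub_ne_zero.2 (by exact_mod_cast hxv)
  by_cases hyN : y ∈ N
  · have := haff.eq_of_two hx hy.2.2 (Ne.symm hy.2.1) hxval (if_pos hyN) z hz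
    rw [hz0] at this
    have hzv : (z : ℚ) = v := by linarith
    exact hc.1 (by exact_mod_cast hzv)
  · have := haff.eq_zero_of_two hz hy.2.2 (Ne.symm hy.1) hz0 (if_neg hyN) x hx
    rw [hxval] at this
    exact hv0 (by linarith)

lemma rk_singleton_add_one_le {k l : ℕ} {N : Finset ℕ} {v : ℕ} (hv : v ∉ N) :
    rk k l {v} N + 1 ≤ rk k l ∅ (insert v N) := by
  have h1 := finrank_inf_ker_lt (LinearMap.proj v)
    (affine_mem_Sol (k := k) (l := l) (M := insert v N) 1 0) (by simp [affine])
  have h2 : rk k l {v} N ≤ Module.finrank ℚ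
      (Sol k l ∅ (insert v N) ⊓ LinearMap.ker (LinearMap.proj v) : Submodule ℚ (ℕ → ℚ)) := by
    refine Submodule.finrank_mono fun y hy => ⟨⟨fun x hx => hy.1 x ?_, fun e he hs => hy.2 e he ?_⟩,
      hy.1 v hv⟩
    · exact fun h => hx (mem_insert_of_mem h)
    · rwa [empty_union, insert_eq] at hs
  rw [← rk] at h1
  omega

open scoped Classical in
/-- The basic extension step: a proper long-closed subset `A` of a minimal non-colorable set `V` can
be enlarged along a short progression `f` that leaves it. -/
theorem exists_extension {k l : ℕ} (hk : 3 ≤ k) (hl : k < l) {V A f : Finset ℕ} {x : ℕ}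
    (hV : MinimalNonColorable k l V) (hS : SmallFree k l V) (hA : LongClosed l V A) (hx : x ∈ A)
    (hf : IsAP k f) (hfV : f ⊆ V) (hxf : x ∈ f) (hfA : ¬ f ⊆ A) :
    ∃ B ⊆ V, Disjoint A B ∧ B.Nonempty ∧ B.card ≤ k * blockSize k l ∧
      ((∃ A₀ ⊆ A, A₀.card ≤ k + l ∧ (rk k l A₀ B : ℝ) < al k l * B.card - (1 - ga k)) ∨
        (LongClosed l V (A ∪ B) ∧ A ∪ B ≠ V ∧
          ((∃ A₀ ⊆ A, A₀.card ≤ k + l ∧ (rk k l A₀ B : ℝ) < al k l * B.card) ∨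
            (¬ Saturated k l (A ∪ B) ∧ (rk k l {x} B : ℝ) ≤ al k l * B.card)))) := by
  have hα := al_pos hk hl
  have hγ := ga_pos hk
  have hγ1 := ga_le hk
  have hγk := ga_mul hk
  have hcov : ∀ x ∈ V, ∃ e, IsAP l e ∧ e ⊆ V ∧ x ∈ e := by
    intro x hx
    obtain ⟨e, f, he, -, heV, -, hef⟩ := hV.saturated x hx
    exact ⟨e, he, heV, (mem_inter.1 (hef ▸ mem_singleton_self x)).1⟩
  choose! blk hblk using fun x (hx : x ∈ V) => exists_isBlock (l := l) hx
  set 𝓕 := (f \ A).image blk with h𝓕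
  set B := 𝓕.biUnion id with hB
  have hblock : ∀ N ∈ 𝓕, IsBlock l V N ∧ ∃ u ∈ f, u ∉ A ∧ u ∈ N := by
    intro N hN
    obtain ⟨u, hu, rfl⟩ := mem_image.1 hN
    rw [Finset.mem_sdiff] at hu
    have := hblk u (hfV hu.1)
    exact ⟨this.1, u, hu.1, hu.2, this.2⟩
  have hmeet : ∀ N ∈ 𝓕, (f ∩ N).Nonempty := by
    intro N hN
    obtain ⟨-, u, hu, -, huN⟩ := hblock N hN
    exact ⟨u, mem_inter.2 ⟨hu, huN⟩⟩
  have hbound : ∀ N ∈ 𝓕, N.card ≤ blockSize k l ∧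
      rk k l ∅ N - al k l * N.card ≤ (1 - ga k) - decay k l * (N.card - l) ∧
      (l : ℝ) ≤ N.card ∧ (¬ IsAP l N → (l : ℝ) < N.card) := by
    intro N hN
    obtain ⟨h1, -⟩ := hblock N hN
    obtain ⟨u, hu⟩ := h1.2.1
    obtain ⟨e, he, heV, hue⟩ := hcov u (h1.1.1 hu)
    have heN := h1.1.2 e he heV u hue hu
    obtain ⟨h2, h3⟩ := block_bound hk hl hS h1 he heN
    refine ⟨h2, h3, ?_, fun hNe => ?_⟩
    · have := card_le_card heN
      rw [he.card] at this
      exact_mod_cast this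
    · have := card_lt_card (heN.ssubset_of_ne fun h => hNe (h ▸ he))
      rw [he.card] at this
      exact_mod_cast this
  have hdec := decay_pos hk hl
  have hrkN : ∀ N ∈ 𝓕, (rk k l ∅ N : ℝ) ≤ al k l * N.card + (1 - ga k) := by
    intro N hN
    obtain ⟨-, h2, h3, -⟩ := hbound N hN
    nlinarith
  have hpd : Set.PairwiseDisjoint (𝓕 : Set (Finset ℕ)) id := by
    intro N hN N' hN' hne
    rw [Function.onFun, id, id, disjoint_left]
    intro z hz hz'
    exact hne ((hblock N hN).1.eq_of_mem (hblock N' hN').1 hz hz')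
  have hBcard : (B.card : ℝ) = ∑ N ∈ 𝓕, (N.card : ℝ) := by
    rw [hB, card_biUnion hpd]
    push_cast
    rfl
  have hAB : Disjoint A B := by
    rw [hB, disjoint_biUnion_right]
    intro N hN
    obtain ⟨h1, u, -, huA, huN⟩ := hblock N hN
    exact h1.disjoint hA huN huA
  have hBV : B ⊆ V := by
    rw [hB, biUnion_subset]
    exact fun N hN => (hblock N hN).1.1.1
  obtain ⟨z, hzf, hzA⟩ := not_subset.1 hfA
  have hfB : f \ A ⊆ B := by
    intro u hu
    exact mem_biUnion.2 ⟨blk u, mem_image_of_mem _ hu, (hblk u (hfV (Finset.mem_sdiff.1 hu).1)).2⟩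
  have hfAB : f ⊆ A ∪ B := by
    intro u hu
    by_cases huA : u ∈ A
    · exact mem_union_left _ huA
    · exact mem_union_right _ (hfB (Finset.mem_sdiff.2 ⟨hu, huA⟩))
  have hm1 : 1 ≤ 𝓕.card := by
    rw [Nat.one_le_iff_ne_zero, ← Nat.pos_iff_ne_zero, card_pos]
    exact ⟨_, mem_image_of_mem _ (Finset.mem_sdiff.2 ⟨hzf, hzA⟩)⟩
  refine ⟨B, hBV, hAB, ⟨z, hfB (Finset.mem_sdiff.2 ⟨hzf, hzA⟩)⟩, ?_, ?_⟩
  · refine card_biUnion_le.trans ((sum_le_card_nsmul _ _ _ fun N hN => (hbound N hN).1).trans ?_)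
    rw [smul_eq_mul]
    gcongr
    exact card_image_le.trans ((card_le_card sdiff_subset).trans hf.card.le)
  by_cases hdead : ∃ A₀ ⊆ A, A₀.card ≤ k + l ∧
      (rk k l A₀ B : ℝ) < al k l * B.card - (1 - ga k)
  · exact Or.inl hdead
  right
  push Not at hdead
  have hglue := finrank_glue_le (l := l) hk hf hAB ⟨x, mem_inter.2 ⟨hxf, hx⟩⟩ hmeet
  set H := (𝓕.filter fun N => 2 ≤ (f ∩ N).card).card with hH
  set s : ℝ := if (f ∩ A).card = 1 then 1 else 0 with hs
  have hHsum : (H : ℝ) = ∑ N ∈ 𝓕, if 2 ≤ (f ∩ N).card then (1 : ℝ) else 0 := by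
    rw [hH, card_filter]
    push_cast
    rfl
  -- `glue` uses only the relations inside blocks and along `f`, so its dimension bounds `rk` over
  -- `f ∩ A` from above.
  have hglue' : (Module.finrank ℚ (glue k l 𝓕 f) : ℝ) ≤
      al k l * B.card - 𝓕.card * ga k - H + s := by
    refine hglue.trans ?_
    gcongr
    rw [sum_sub_distrib, ← hHsum, hBcard, mul_sum]
    have : ∑ N ∈ 𝓕, ((rk k l ∅ N : ℝ) - 1) ≤ ∑ N ∈ 𝓕, (al k l * N.card - ga k) :=
      sum_le_sum fun N hN => by linarith [hrkN N hN]
    rw [sum_sub_distrib (g := fun _ => ga k), sum_const, nsmul_eq_mul] at this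
    linarith
  have hm1' : (1 : ℝ) ≤ 𝓕.card := by exact_mod_cast hm1
  have hs01 : s = 0 ∨ (s = 1 ∧ (f ∩ A).card = 1) := by
    rw [hs]
    split_ifs with h
    · exact Or.inr ⟨rfl, h⟩
    · exact Or.inl rfl
  have hSolE : ∀ A₀, f ∩ A ⊆ A₀ → Sol k l A₀ B ≤ glue k l 𝓕 f := by
    refine fun A₀ hA₀ => Sol_le_glue hf fun u hu => ?_
    rcases mem_union.1 (hfAB hu) with h | h
    · exact mem_union_left _ (hA₀ (mem_inter.2 ⟨hu, h⟩))
    · exact mem_union_right _ h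
  have hrkfA : (rk k l (f ∩ A) B : ℝ) ≤ Module.finrank ℚ (glue k l 𝓕 f) := by
    exact_mod_cast Submodule.finrank_mono (hSolE _ Subset.rfl)
  have hfAc : (f ∩ A).card ≤ k + l := by
    have := card_le_card (inter_subset_left (s₁ := f) (s₂ := A))
    rw [hf.card] at this
    omega
  have hmany : s = 1 → H = 0 → (k : ℝ) - 1 ≤ 𝓕.card := by
    intro hs1 hH0
    have hc : (f ∩ A).card = 1 := by
      rcases hs01 with h | h
      · rw [h] at hs1
        norm_num at hs1
      · exact h.2
    have h1 : f \ A ⊆ 𝓕.biUnion fun N => f ∩ N := by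
      intro u hu
      obtain ⟨N, hN, huN⟩ := mem_biUnion.1 (hfB hu)
      exact mem_biUnion.2 ⟨N, hN, mem_inter.2 ⟨(Finset.mem_sdiff.1 hu).1, huN⟩⟩
    have h2 : (𝓕.biUnion fun N => f ∩ N).card ≤ 𝓕.card * 1 := by
      refine card_biUnion_le_card_mul _ _ _ fun N hN => ?_
      rw [hH, card_eq_zero, filter_eq_empty_iff] at hH0
      have := hH0 hN
      omega
    have h3 := card_le_card h1
    have h4 := card_sdiff_add_card_inter f A
    rw [hf.card] at h4
    have : k ≤ 𝓕.card + 1 := by omega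
    have : (k : ℝ) ≤ 𝓕.card + 1 := by exact_mod_cast this
    linarith
  have hHs : (H : ℝ) < s + 1 := by
    have h1 := hdead (f ∩ A) inter_subset_right hfAc
    nlinarith
  -- The tight case is `s = 1`, `H = 0`, where at least `k - 1` blocks occur and `k * ga > 1`.
  have hslack : s < (𝓕.card + 1) * ga k + H := by
    have hH0 : (0 : ℝ) ≤ H := Nat.cast_nonneg _
    rcases hs01 with h | h
    · rw [h]
      nlinarith
    · rcases Nat.eq_zero_or_pos H with h0 | h0
      · have := hmany h.1 h0
        rw [h.1]
        nlinarith
      · have : (1 : ℝ) ≤ H := by exact_mod_cast h0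
        rw [h.1]
        nlinarith
  -- Since the step is not dead, the two dimensions differ by less than `1`, hence are equal:
  -- further progressions of `A₀ ∪ B` impose no new relations.
  have hESol : ∀ A₀ ⊆ A, f ∩ A ⊆ A₀ → A₀.card ≤ k + l → glue k l 𝓕 f ≤ Sol k l A₀ B := by
    intro A₀ hA₀ hfA₀ hc
    have h1 := hdead A₀ hA₀ hc
    have h2 : (Module.finrank ℚ (glue k l 𝓕 f) : ℝ) < rk k l A₀ B + 1 := by nlinarith
    have h3 : Module.finrank ℚ (glue k l 𝓕 f) < rk k l A₀ B + 1 := by exact_mod_cast h2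
    exact (Submodule.eq_of_le_of_finrank_le (hSolE A₀ hfA₀) (by rw [rk] at h3; omega)).ge
  -- Testing `h` against the function `(x - v) 1_N` shows that `N` is attached at `v` only. Taking
  -- `A₀ = (f ∪ h) ∩ A` keeps `A₀` within `k + l` points.
  have hlocal : ∀ N ∈ 𝓕, ∀ v : ℕ, affine N (-v) 1 ∈ glue k l 𝓕 f → ∀ h, (IsAP k h ∨ IsAP l h) →
      h ⊆ A ∪ B → ∀ x ∈ h, x ∈ N → x ≠ v → h ⊆ insert v N := by
    intro N hN v hy h hh hhAB x hx hxN hxv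
    have hhc : h.card ≤ l := by
      rcases hh with hh | hh
      · rw [hh.card]
        exact hl.le
      · rw [hh.card]
    have hmem := hESol ((f ∪ h) ∩ A) inter_subset_right
      (inter_subset_inter subset_union_left Subset.rfl)
      ((card_le_card inter_subset_left).trans ((card_union_le _ _).trans
        (Nat.add_le_add hf.card.le hhc))) hy
    have haff := hmem.2 h hh fun u hu => by
      rcases mem_union.1 (hhAB hu) with h' | h'
      · exact mem_union_left _ (mem_inter.2 ⟨mem_union_right _ hu, h'⟩)
      · exact mem_union_right _ h'
    rcases hh with hh | hh
    · exact subset_insert_of_affOn hk hh haff hx hxN hxv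
    · exact subset_insert_of_affOn (hk.trans hl.le) hh haff hx hxN hxv
  have hglue_mem : ∀ N ∈ 𝓕, ∀ v : ℕ, AffOn (affine N (-v) 1) f → affine N (-v) 1 ∈ glue k l 𝓕 f := by
    intro N hN v hv
    refine ⟨fun x hx => if_neg fun h => hx (mem_biUnion.2 ⟨N, hN, h⟩), fun N' hN' e he hs => ?_, hv⟩
    by_cases h : N' = N
    · subst h
      exact ⟨-v, 1, fun x hx => if_pos (hs hx)⟩
    · refine ⟨0, 0, fun x hx => ?_⟩
      have hxN : x ∉ N := disjoint_left.1 (hpd hN' hN h) (hs hx)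
      rw [affine, if_neg hxN]
      simp
  have honce : ∀ N ∈ 𝓕, (f ∩ N).card < 2 → ∃ u ∈ N, affine N (-u) 1 ∈ glue k l 𝓕 f := by
    intro N hN hc
    obtain ⟨u, hu⟩ := hmeet N hN
    refine ⟨u, (mem_inter.1 hu).2, hglue_mem N hN u ⟨0, 0, fun x hx => ?_⟩⟩
    by_cases hxN : x ∈ N
    · have : x = u := card_le_one.1 (by omega : (f ∩ N).card ≤ 1) x (mem_inter.2 ⟨hx, hxN⟩) u hu
      rw [affine, if_pos hxN, this]
      ring
    · rw [affine, if_neg hxN]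
      ring
  have hclAB : LongClosed l V (A ∪ B) := by
    refine hA.union ⟨hBV, fun e he heV u hu huB => ?_⟩
    obtain ⟨N, hN, huN⟩ := mem_biUnion.1 huB
    exact ((hblock N hN).1.1.2 e he heV u hu huN).trans (subset_biUnion_of_mem id hN)
  refine ⟨hclAB, ?_, ?_⟩
  · intro hABV
    -- A block met once by `f` is attached at a point of its own. If there is none, `H < s + 1`
    -- leaves a single block, attached at the only point of `f` in `A`.
    by_cases h1 : ∃ N ∈ 𝓕, (f ∩ N).card < 2
    · obtain ⟨N, hN, hc⟩ := h1
      obtain ⟨u, huN, hu⟩ := honce N hN hc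
      refine not_attached_at_point hk hl hV (hblock N hN).1 (v := u) ?_ ?_ (fun h => absurd huN h)
      · intro h hh hhV x hx hxN hxu
        exact hlocal N hN u hu h (Or.inl hh) (hABV ▸ hhV) x hx hxN hxu
      · rw [if_pos huN, insert_eq_of_mem huN, add_zero]
        exact hS N (hblock N hN).1.1.1 (hbound N hN).1
    · push Not at h1
      have hHm : H = 𝓕.card := by rw [hH, filter_true_of_mem h1]
      have hs1 : s = 1 ∧ (f ∩ A).card = 1 := by
        rcases hs01 with h | h
        · rw [h, hHm] at hHs
          linarith
        · exact h
      have hm : 𝓕.card = 1 := by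
        rw [hs1.1, hHm] at hHs
        have : 𝓕.card < 2 := by
          have : (𝓕.card : ℝ) < 2 := by linarith
          exact_mod_cast this
        omega
      obtain ⟨N, hN⟩ := card_eq_one.1 hm
      obtain ⟨v, hv⟩ := card_eq_one.1 hs1.2
      have hNm : N ∈ 𝓕 := hN ▸ mem_singleton_self N
      have hBN : B = N := by
        rw [hB, hN]
        simp
      have hvf : v ∈ f ∩ A := hv ▸ mem_singleton_self v
      rw [mem_inter] at hvf
      have hvN : v ∉ N := hBN ▸ disjoint_left.1 hAB hvf.2
      have hfN : f ⊆ insert v N := by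
        intro u hu
        rcases mem_union.1 (hfAB hu) with h | h
        · have : u ∈ f ∩ A := mem_inter.2 ⟨hu, h⟩
          rw [hv, mem_singleton] at this
          exact this ▸ mem_insert_self _ _
        · exact mem_insert_of_mem (hBN ▸ h)
      have hmem := hglue_mem N hNm v ⟨-v, 1, fun u hu => by
        rcases mem_insert.1 (hfN hu) with rfl | h
        · rw [affine, if_neg hvN]
          ring
        · exact if_pos h⟩
      refine not_attached_at_point hk hl hV (hblock N hNm).1 (v := v) ?_ ?_
        (fun _ => ⟨f, hf, hvf.1, hfN⟩)
      · intro h hh hhV x hx hxN hxu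
        exact hlocal N hNm v hmem h (Or.inl hh) (hABV ▸ hhV) x hx hxN hxu
      · rw [if_neg hvN]
        have h1 := hdead {v} (singleton_subset_iff.2 hvf.2) (by rw [card_singleton]; omega)
        have h2 : ((rk k l {v} N + 1 : ℕ) : ℝ) ≤ rk k l ∅ (insert v N) := by
          exact_mod_cast rk_singleton_add_one_le hvN
        rw [hBN] at h1
        push_cast at h2
        linarith
  · by_cases hlt : (Module.finrank ℚ (glue k l 𝓕 f) : ℝ) < al k l * B.card
    · exact Or.inl ⟨f ∩ A, inter_subset_right, hfAc, hrkfA.trans_lt hlt⟩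
    right
    have hs1 : s = 1 ∧ (f ∩ A).card = 1 := by
      rcases hs01 with h | h
      · refine absurd ?_ hlt
        have : (0 : ℝ) ≤ H := Nat.cast_nonneg _
        nlinarith
      · exact h
    have hH0 : H = 0 := by
      by_contra h
      refine hlt ?_
      have : (1 : ℝ) ≤ H := by exact_mod_cast Nat.one_le_iff_ne_zero.2 h
      nlinarith [hs1.1]
    have hm := hmany hs1.1 hH0
    have hfAx : f ∩ A = {x} := by
      obtain ⟨v, hv⟩ := card_eq_one.1 hs1.2
      have : x ∈ f ∩ A := mem_inter.2 ⟨hxf, hx⟩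
      rw [hv, mem_singleton] at this
      rw [hv, this]
    have hle : (Module.finrank ℚ (glue k l 𝓕 f) : ℝ) ≤ al k l * B.card := by
      rw [hs1.1] at hglue'
      have : (0 : ℝ) ≤ H := Nat.cast_nonneg _
      nlinarith
    refine ⟨fun hsat => ?_, ?_⟩
    swap
    · rw [← hfAx]
      exact hrkfA.trans hle
    obtain ⟨N, hN⟩ := card_pos.1 hm1
    have hN2 : (f ∩ N).card < 2 := by
      rw [hH, card_eq_zero, filter_eq_empty_iff] at hH0
      have := hH0 hN
      omega
    obtain ⟨u, huN, hu⟩ := honce N hN hN2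
    -- If `N` is an `l`-AP, both progressions witnessing saturation at `y` lie in `N`, so they meet
    -- in `k` points. If not, `N` has more than `l` points and `decay` makes the step strictly
    -- sparse.
    by_cases hNap : IsAP l N
    · obtain ⟨y, hy, hyu⟩ := exists_mem_ne (s := N) (by rw [hNap.card]; omega) u
      obtain ⟨e, g, he, hg, heAB, hgAB, heg⟩ :=
        hsat y (mem_union_right _ (mem_biUnion.2 ⟨N, hN, hy⟩))
      have hy' : y ∈ e ∩ g := heg ▸ mem_singleton_self y
      rw [mem_inter] at hy'
      have heN := hlocal N hN u hu e (Or.inr he) heAB y hy'.1 hy hyu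
      have hgN := hlocal N hN u hu g (Or.inl hg) hgAB y hy'.2 hy hyu
      rw [insert_eq_of_mem huN] at heN hgN
      have heq : e = N := eq_of_subset_of_card_le heN (by rw [he.card, hNap.card])
      rw [heq, inter_eq_right.2 hgN] at heg
      have := hg.card
      rw [heg, card_singleton] at this
      omega
    · refine hlt (hglue.trans_lt ?_)
      have h1 : ∑ N ∈ 𝓕, ((rk k l ∅ N : ℝ) - 1 - if 2 ≤ (f ∩ N).card then 1 else 0) <
          ∑ N ∈ 𝓕, (al k l * N.card - ga k) := by
        refine sum_lt_sum (fun N hN => ?_) ⟨N, hN, ?_⟩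
        · have := hrkN N hN
          split_ifs <;> linarith
        · obtain ⟨-, h2, h3, h4⟩ := hbound N hN
          have h5 := h4 hNap
          rw [if_neg (by omega)]
          nlinarith
      rw [sum_sub_distrib (g := fun _ => ga k), ← mul_sum, ← hBcard, sum_const, nsmul_eq_mul] at h1
      rw [hs1.1]
      nlinarith

/-! ### Growing sequences -/

/-- A part of a minimal non-colorable set is left by some short progression. -/
lemma MinimalNonColorable.exists_leaving {k l : ℕ} {V A : Finset ℕ}
    (hV : MinimalNonColorable k l V) (hA : LongClosed l V A) (hne : A.Nonempty) (hAV : A ≠ V) :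
    ∃ f, IsAP k f ∧ f ⊆ V ∧ (∃ x ∈ A, x ∈ f) ∧ ¬ f ⊆ A := by
  by_contra! hc
  obtain ⟨R₁, hR₁, h1, h2⟩ := hV.2 A (hA.1.ssubset_of_ne hAV)
  obtain ⟨R₂, hR₂, h3, h4⟩ := hV.2 (V \ A) (sdiff_ssubset hA.1 hne)
  refine hV.1 ⟨R₁ ∪ R₂, union_subset (hR₁.trans hA.1) (hR₂.trans sdiff_subset), ?_, ?_⟩
  · intro e he hs
    have heV : e ⊆ V := hs.trans (union_subset (hR₁.trans hA.1) (hR₂.trans sdiff_subset))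
    by_cases hx : ∃ x ∈ e, x ∈ A
    · obtain ⟨x, hxe, hxA⟩ := hx
      have heA := hA.2 e he heV x hxe hxA
      refine h1 e he fun y hy => (mem_union.1 (hs hy)).resolve_right fun h => ?_
      exact (Finset.mem_sdiff.1 (hR₂ h)).2 (heA hy)
    · push Not at hx
      exact h3 e he fun y hy => (mem_union.1 (hs hy)).resolve_left fun h => hx y hy (hR₁ h)
  · intro e he hs
    have heV : e ⊆ V := hs.trans sdiff_subset
    by_cases hx : ∃ x ∈ A, x ∈ e
    · have heA := hc e he heV hx
      refine h2 e he fun y hy => Finset.mem_sdiff.2 ⟨heA hy, fun h => ?_⟩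
      exact (Finset.mem_sdiff.1 (hs hy)).2 (mem_union_left _ h)
    · push Not at hx
      refine h4 e he fun y hy =>
        Finset.mem_sdiff.2 ⟨Finset.mem_sdiff.2 ⟨heV hy, fun h => hx y h hy⟩, fun h => ?_⟩
      exact (Finset.mem_sdiff.1 (hs hy)).2 (mem_union_right _ h)

/-- A chosen point of `A` at which `A` is not saturated, if there is one. -/
noncomputable def unsat (k l : ℕ) (A : Finset ℕ) : ℕ :=
  Classical.epsilon fun x => x ∈ A ∧
    ¬ ∃ e f, IsAP l e ∧ IsAP k f ∧ e ⊆ A ∧ f ⊆ A ∧ e ∩ f = {x}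

lemma unsat_spec {k l : ℕ} {A : Finset ℕ} (h : ¬ Saturated k l A) : unsat k l A ∈ A ∧
    ¬ ∃ e f, IsAP l e ∧ IsAP k f ∧ e ⊆ A ∧ f ⊆ A ∧ e ∩ f = {unsat k l A} := by
  rw [Saturated] at h
  push Not at h
  obtain ⟨x, hx, h⟩ := h
  refine Classical.epsilon_spec (p := fun x => x ∈ A ∧
    ¬ ∃ e f, IsAP l e ∧ IsAP k f ∧ e ⊆ A ∧ f ⊆ A ∧ e ∩ f = {x}) ⟨x, hx, ?_⟩
  rintro ⟨e, f, h1, h2, h3, h4, h5⟩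
  exact h e f h1 h2 h3 h4 h5

/-- A short progression that leaves `A` through the chosen unsaturated point of `A`. -/
lemma MinimalNonColorable.exists_leaving_unsat {k l : ℕ} {V A : Finset ℕ}
    (hV : MinimalNonColorable k l V) (hA : LongClosed l V A) (hne : A.Nonempty) (hAV : A ≠ V) :
    ∃ x ∈ A, (¬ Saturated k l A → x = unsat k l A) ∧
      ∃ f, IsAP k f ∧ f ⊆ V ∧ x ∈ f ∧ ¬ f ⊆ A := by
  by_cases hs : Saturated k l A
  · obtain ⟨f, hf, hfV, ⟨x, hx, hxf⟩, hfA⟩ := hV.exists_leaving hA hne hAV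
    exact ⟨x, hx, fun h => absurd hs h, f, hf, hfV, hxf, hfA⟩
  · obtain ⟨h1, h2⟩ := unsat_spec hs
    refine ⟨_, h1, fun _ => rfl, ?_⟩
    obtain ⟨e, f, he, hf, heV, hfV, hef⟩ := hV.saturated _ (hA.1 h1)
    have hx : unsat k l A ∈ e ∩ f := hef ▸ mem_singleton_self _
    rw [mem_inter] at hx
    exact ⟨f, hf, hfV, hx.2, fun hfA => h2 ⟨e, f, he, hf, hA.2 e he heV _ hx.1 h1, hfA, hef⟩⟩

/-- `B` has few degrees of freedom over some bounded part of `A`. -/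
def Sparse (k l : ℕ) (θ : ℝ) (A B : Finset ℕ) : Prop :=
  ∃ A₀ ⊆ A, A₀.card ≤ k + l ∧ (rk k l A₀ B : ℝ) < al k l * B.card + θ

/-- `A ∪ B` is an admissible extension of `A`. -/
def IsStep (k l : ℕ) (A B : Finset ℕ) : Prop :=
  Disjoint A B ∧ B.Nonempty ∧ B.card ≤ k * blockSize k l ∧
    (Sparse k l 0 A B ∨ (¬ Saturated k l (A ∪ B) ∧
      ∃ x ∈ A, (¬ Saturated k l A → x = unsat k l A) ∧ (rk k l {x} B : ℝ) ≤ al k l * B.card))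

/-- `A ∪ B` is an extension of `A` that should not occur. -/
def IsDead (k l : ℕ) (A B : Finset ℕ) : Prop :=
  Disjoint A B ∧ B.card ≤ k * blockSize k l ∧ Sparse k l (-(1 - ga k)) A B

open scoped Classical in
/-- The sets obtained from a block by `t` admissible extensions. -/
noncomputable def fam (k l n : ℕ) : ℕ → Finset (Finset ℕ)
  | 0 => (Icc 1 n).powerset.filter fun A =>
      A.card ≤ blockSize k l ∧ (rk k l ∅ A : ℝ) ≤ al k l * A.card + (1 - ga k)
  | t + 1 => (fam k l n t).biUnion fun A =>
      ((Icc 1 n).powerset.filter fun B => IsStep k l A B).image fun B => A ∪ B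

lemma mem_fam_succ {k l n t : ℕ} {A' : Finset ℕ} : A' ∈ fam k l n (t + 1) ↔
    ∃ A ∈ fam k l n t, ∃ B ⊆ Icc 1 n, IsStep k l A B ∧ A ∪ B = A' := by
  classical
  simp only [fam, mem_biUnion, mem_image, mem_filter, mem_powerset, and_assoc]

lemma fam_subset {k l n t : ℕ} {A : Finset ℕ} (h : A ∈ fam k l n t) : A ⊆ Icc 1 n := by
  induction t generalizing A with
  | zero =>
    rw [fam, mem_filter, mem_powerset] at h
    exact h.1
  | succ t ih =>
    obtain ⟨A, hA, B, hB, -, rfl⟩ := mem_fam_succ.1 h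
    exact union_subset (ih hA) hB

lemma card_fam {k l n t : ℕ} {A : Finset ℕ} (h : A ∈ fam k l n t) :
    A.card ≤ blockSize k l + t * (k * blockSize k l) := by
  induction t generalizing A with
  | zero =>
    rw [fam, mem_filter] at h
    simpa using h.2.1
  | succ t ih =>
    obtain ⟨A, hA, B, -, hB, rfl⟩ := mem_fam_succ.1 h
    have h1 := ih hA
    have h2 := hB.2.2.1
    have h3 := card_union_le A B
    rw [add_mul, one_mul]
    omega

/-- A non-colorable set without small dense subsets contains the result of an arbitrary number of
extensions, unless an extension that should not occur appears before. -/
theorem exists_long_growth {k l n : ℕ} (hk : 3 ≤ k) (hl : k < l) {V : Finset ℕ}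
    (hV : MinimalNonColorable k l V) (hS : SmallFree k l V) (hVn : V ⊆ Icc 1 n) (t : ℕ) :
    (∃ A ∈ fam k l n t, LongClosed l V A ∧ A.Nonempty ∧ A ≠ V) ∨
      ∃ t' < t, ∃ A ∈ fam k l n t', ∃ B, IsDead k l A B ∧ A ∪ B ⊆ V := by
  classical
  induction t with
  | zero =>
    left
    have hVne : V.Nonempty := by
      rw [nonempty_iff_ne_empty]
      rintro rfl
      refine hV.1 ⟨∅, Subset.rfl, fun e he hs => ?_, fun e he hs => ?_⟩
      · exact (he.nonempty (by omega)).ne_empty (subset_empty.1 hs)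
      · exact (he.nonempty (by omega)).ne_empty (subset_empty.1 hs)
    obtain ⟨x, hx⟩ := hVne
    obtain ⟨e, f, he, -, heV, -, hef⟩ := hV.saturated x hx
    have hxe := (mem_inter.1 (hef ▸ mem_singleton_self x)).1
    obtain ⟨N, hN, hxN⟩ := exists_isBlock (l := l) hx
    have heN := hN.1.2 e he heV x hxe hxN
    obtain ⟨h1, h2⟩ := block_bound hk hl hS hN he heN
    refine ⟨N, mem_filter.2 ⟨mem_powerset.2 (hN.1.1.trans hVn), h1, ?_⟩, hN.1, hN.2.1, ?_⟩
    · have h3 := card_le_card heN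
      rw [he.card] at h3
      have h4 : (l : ℝ) ≤ N.card := by exact_mod_cast h3
      have h5 := decay_pos hk hl
      nlinarith
    -- If `V` were one block, any of its points would serve as the point of attachment.
    · rintro rfl
      refine not_attached_at_point hk hl hV hN (v := x) (fun h _ hh _ _ _ _ =>
        hh.trans (subset_insert _ _)) ?_ fun h => absurd hxN h
      rw [if_pos hxN, insert_eq_of_mem hxN, add_zero]
      exact hS N Subset.rfl h1
  | succ t ih =>
    rcases ih with ⟨A, hA, hcl, hne, hAV⟩ | ⟨t', ht', h⟩
    swap
    · exact Or.inr ⟨t', by omega, h⟩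
    obtain ⟨x, hx, hxu, f, hf, hfV, hxf, hfA⟩ :=
      hV.exists_leaving_unsat hcl hne hAV
    obtain ⟨B, hBV, hAB, hBne, hBc, h | ⟨hcl', hne', h⟩⟩ :=
      exists_extension hk hl hV hS hcl hx hf hfV hxf hfA
    · obtain ⟨A₀, h1, h2, h3⟩ := h
      exact Or.inr ⟨t, by omega, A, hA, B, ⟨hAB, hBc, A₀, h1, h2, by linarith⟩,
        union_subset hcl.1 hBV⟩
    · refine Or.inl ⟨A ∪ B, ?_, hcl', hne.mono subset_union_left, hne'⟩
      refine mem_fam_succ.2 ⟨A, hA, B, hBV.trans hVn, ⟨hAB, hBne, hBc, ?_⟩, rfl⟩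
      rcases h with ⟨A₀, h1, h2, h3⟩ | ⟨h1, h2⟩
      · exact Or.inl ⟨A₀, h1, h2, by linarith⟩
      · exact Or.inr ⟨h1, x, hx, hxu, h2⟩

/-! ### Weighted counts -/

/-- Choosing one representation of each `b` embeds the left sum in the right one; repetitions only
help. -/
lemma sum_le_sum_sum_of_cover {ι κ β : Type*} {F : Finset β} {J : Finset ι} {G : ι → Finset κ}
    (φ : ι → κ → β) {w : β → ℝ} (hw : ∀ b, 0 ≤ w b)
    (h : ∀ b ∈ F, ∃ i ∈ J, ∃ j ∈ G i, φ i j = b) :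
    ∑ b ∈ F, w b ≤ ∑ i ∈ J, ∑ j ∈ G i, w (φ i j) := by
  classical
  rw [sum_sigma' J G (fun i j => w (φ i j))]
  rcases F.eq_empty_or_nonempty with rfl | ⟨b₀, hb₀⟩
  · rw [sum_empty]
    exact sum_nonneg fun _ _ => hw _
  have : Nonempty ι := ⟨(h b₀ hb₀).choose⟩
  have : Nonempty κ := ⟨(h b₀ hb₀).choose_spec.2.choose⟩
  choose! i hi j hj hφ using h
  let s : β → Σ _ : ι, κ := fun b => ⟨i b, j b⟩
  have hinj : Set.InjOn s F := by
    intro b hb b' hb' hbb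
    have h1 : i b = i b' := congrArg Sigma.fst hbb
    have h2 : j b = j b' := by
      have := congrArg (fun x : Σ _ : ι, κ => x.2) hbb
      exact this
    rw [← hφ b hb, ← hφ b' hb', h1, h2]
  calc ∑ b ∈ F, w b = ∑ b ∈ F, w (φ (s b).1 (s b).2) :=
        sum_congr rfl fun b hb => by rw [hφ b hb]
    _ = ∑ x ∈ F.image s, w (φ x.1 x.2) := (sum_image (f := fun x : Σ _ : ι, κ => w (φ x.1 x.2)) hinj).symm
    _ ≤ _ := by
        refine sum_le_sum_of_subset_of_nonneg ?_ fun _ _ _ => hw _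
        intro x hx
        obtain ⟨b, hb, rfl⟩ := mem_image.1 hx
        exact mem_sigma.2 ⟨hi b hb, hj b hb⟩

lemma rpow_neg_al_pow_le {n m r : ℕ} {α θ : ℝ} (hn : 1 ≤ n) (h : (r : ℝ) ≤ α * m + θ) :
    (n : ℝ) ^ r * ((n : ℝ) ^ (-α)) ^ m ≤ (n : ℝ) ^ θ := by
  have hn' : (1 : ℝ) ≤ n := by exact_mod_cast hn
  have hn0 : (0 : ℝ) < n := by linarith
  rw [← Real.rpow_natCast, ← Real.rpow_natCast, ← Real.rpow_mul hn0.le, ← Real.rpow_add hn0]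
  exact Real.rpow_le_rpow_of_exponent_le hn' (by linarith)

open scoped Classical in
-- Group by size: there are `O(n ^ r)` sets of size `m`, with `r = ⌊al * m + θ⌋`, each of weight `n
-- ^ (-al * m)`.
lemma exists_weight_bound (k l a K : ℕ) : ∃ C : ℝ, 0 < C ∧ ∀ n : ℕ, 1 ≤ n →
    ∀ A₀ : Finset ℕ, A₀.card ≤ a → ∀ θ : ℝ, ∀ F : Finset (Finset ℕ),
    (∀ B ∈ F, B ⊆ Icc 1 n ∧ Disjoint A₀ B ∧ B.card ≤ K ∧ (rk k l A₀ B : ℝ) ≤ al k l * B.card + θ) →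
    ∑ B ∈ F, ((n : ℝ) ^ (-al k l)) ^ B.card ≤ C * (n : ℝ) ^ θ := by
  choose C hC using card_le_of_rk_le k l a
  refine ⟨∑ m ∈ range (K + 1), (C m : ℝ) + 1, by positivity, fun n hn A₀ hA₀ θ F hF => ?_⟩
  have hn' : (1 : ℝ) ≤ n := by exact_mod_cast hn
  have hθ : 0 ≤ (n : ℝ) ^ θ := by positivity
  rw [← sum_fiberwise_of_maps_to (s := F) (t := range (K + 1)) (g := card)
    (fun B hB => mem_range.2 (Nat.lt_succ_of_le (hF B hB).2.2.1))]
  have hm : ∀ m ∈ range (K + 1), ∑ B ∈ F with B.card = m, ((n : ℝ) ^ (-al k l)) ^ B.card ≤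
      C m * (n : ℝ) ^ θ := by
    intro m _
    rcases (F.filter fun B => B.card = m).eq_empty_or_nonempty with he | ⟨B₁, hB₁⟩
    · rw [he, sum_empty]
      positivity
    have h0 : 0 ≤ al k l * m + θ := by
      rw [mem_filter] at hB₁
      have := (hF B₁ hB₁.1).2.2.2
      rw [hB₁.2] at this
      exact (Nat.cast_nonneg _).trans this
    have hcount := hC m A₀ hA₀ n ⌊al k l * m + θ⌋₊ hn (F.filter fun B => B.card = m) (by
      intro B hB
      rw [mem_filter] at hB
      obtain ⟨h1, h2, -, h3⟩ := hF B hB.1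
      rw [hB.2] at h3
      exact ⟨h1, h2, hB.2, Nat.le_floor h3⟩)
    have hcount' : ((F.filter fun B => B.card = m).card : ℝ) ≤
        C m * (n : ℝ) ^ ⌊al k l * m + θ⌋₊ := by exact_mod_cast hcount
    calc ∑ B ∈ F with B.card = m, ((n : ℝ) ^ (-al k l)) ^ B.card
        = ∑ B ∈ F with B.card = m, ((n : ℝ) ^ (-al k l)) ^ m :=
          sum_congr rfl fun B hB => by rw [(mem_filter.1 hB).2]
      _ = (F.filter fun B => B.card = m).card * ((n : ℝ) ^ (-al k l)) ^ m := by
          rw [sum_const, nsmul_eq_mul]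
      _ ≤ C m * (n : ℝ) ^ ⌊al k l * m + θ⌋₊ * ((n : ℝ) ^ (-al k l)) ^ m := by gcongr
      _ = C m * ((n : ℝ) ^ ⌊al k l * m + θ⌋₊ * ((n : ℝ) ^ (-al k l)) ^ m) := mul_assoc _ _ _
      _ ≤ C m * (n : ℝ) ^ θ := by
          gcongr
          exact rpow_neg_al_pow_le hn (Nat.floor_le h0)
  refine (sum_le_sum hm).trans ?_
  rw [← sum_mul]
  gcongr
  linarith

/-- The gap between exponents. -/
noncomputable def gap (k l : ℕ) : ℝ := 1 / (l * (k - 1))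

lemma gap_pos {k l : ℕ} (hk : 3 ≤ k) (hl : k < l) : 0 < gap k l := by
  have h1 : (3 : ℝ) ≤ k := by exact_mod_cast hk
  have h2 : (k : ℝ) < l := by exact_mod_cast hl
  exact one_div_pos.2 (mul_pos (by linarith) (by linarith))

/-- After multiplication by `l (k - 1)` both sides are integers, so a strict inequality gains a full
unit. -/
lemma le_sub_gap {k l r m : ℕ} (hk : 3 ≤ k) (hl : k < l) {θ : ℝ} {z : ℤ}
    (hz : θ * (l * (k - 1)) = z) (h : (r : ℝ) < al k l * m + θ) :
    (r : ℝ) ≤ al k l * m + (θ - gap k l) := by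
  have h1 : (3 : ℝ) ≤ k := by exact_mod_cast hk
  have h2 : (k : ℝ) < l := by exact_mod_cast hl
  have hD : 0 < (l : ℝ) * (k - 1) := mul_pos (by linarith) (by linarith)
  have h3 := al_mul_mul hk hl
  have h4 : gap k l * (l * (k - 1)) = 1 := one_div_mul_cancel hD.ne'
  have h5 : ((r * (l * (k - 1)) : ℤ) : ℝ) < ((k * m + z : ℤ) : ℝ) := by
    push_cast
    rw [← hz]
    linear_combination mul_lt_mul_of_pos_right h hD + (m : ℝ) * h3
  have h6 : (r * (l * (k - 1)) : ℤ) + 1 ≤ k * m + z := by exact_mod_cast h5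
  have h7 : ((r * (l * (k - 1)) + 1 : ℤ) : ℝ) ≤ ((k * m + z : ℤ) : ℝ) := by exact_mod_cast h6
  push_cast at h7
  rw [← hz] at h7
  refine le_of_mul_le_mul_right ?_ hD
  linear_combination h7 + (-(m : ℝ)) * h3 + h4

lemma card_filter_powerset_le (A : Finset ℕ) (a : ℕ) :
    (A.powerset.filter fun S => S.card ≤ a).card ≤ (a + 1) * (A.card + 1) ^ a := by
  classical
  have h : (A.powerset.filter fun S => S.card ≤ a) ⊆
      (range (a + 1)).biUnion fun i => A.powersetCard i := by
    intro S hS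
    rw [mem_filter, mem_powerset] at hS
    exact mem_biUnion.2 ⟨S.card, mem_range.2 (Nat.lt_succ_of_le hS.2), mem_powersetCard.2 ⟨hS.1, rfl⟩⟩
  refine (card_le_card h).trans ((card_biUnion_le_card_mul _ _ ((A.card + 1) ^ a) ?_).trans ?_)
  · intro i hi
    rw [card_powersetCard]
    calc A.card.choose i ≤ A.card ^ i := Nat.choose_le_pow _ _
      _ ≤ (A.card + 1) ^ i := Nat.pow_le_pow_left (Nat.le_succ _) _
      _ ≤ (A.card + 1) ^ a := Nat.pow_le_pow_right (Nat.succ_pos _) (by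
          rw [mem_range] at hi
          omega)
  · rw [card_range]

open scoped Classical in
-- Sum over the bounded parts `A₀` of `A`; their number is polynomial in `|A|`, and `gap` is gained
-- for each.
lemma exists_sparse_weight_bound {k l : ℕ} (hk : 3 ≤ k) (hl : k < l) : ∃ C : ℝ, 0 < C ∧
    ∀ n : ℕ, 1 ≤ n → ∀ A : Finset ℕ, ∀ θ : ℝ, (∃ z : ℤ, θ * (l * (k - 1)) = z) →
    ∀ F : Finset (Finset ℕ),
    (∀ B ∈ F, B ⊆ Icc 1 n ∧ Disjoint A B ∧ B.card ≤ k * blockSize k l ∧ Sparse k l θ A B) →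
    ∑ B ∈ F, ((n : ℝ) ^ (-al k l)) ^ B.card ≤
      C * ((A.card : ℝ) + 1) ^ (k + l) * (n : ℝ) ^ (θ - gap k l) := by
  obtain ⟨C, hC0, hC⟩ := exists_weight_bound k l (k + l) (k * blockSize k l)
  refine ⟨C * ((k + l : ℕ) + 1), by positivity, fun n hn A θ ⟨z, hz⟩ F hF => ?_⟩
  have h1 := sum_le_sum_sum_of_cover (F := F) (J := A.powerset.filter fun S => S.card ≤ k + l)
    (G := fun A₀ => F.filter fun B => (rk k l A₀ B : ℝ) < al k l * B.card + θ)
    (fun _ B => B) (w := fun B => ((n : ℝ) ^ (-al k l)) ^ B.card) (fun B => by positivity) (by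
      intro B hB
      obtain ⟨-, -, -, A₀, h1, h2, h3⟩ := hF B hB
      exact ⟨A₀, mem_filter.2 ⟨mem_powerset.2 h1, h2⟩, B, mem_filter.2 ⟨hB, h3⟩, rfl⟩)
  have h2 : ∀ A₀ ∈ A.powerset.filter fun S => S.card ≤ k + l,
      ∑ B ∈ F.filter fun B => (rk k l A₀ B : ℝ) < al k l * B.card + θ,
        ((n : ℝ) ^ (-al k l)) ^ B.card ≤ C * (n : ℝ) ^ (θ - gap k l) := by
    intro A₀ hA₀
    rw [mem_filter, mem_powerset] at hA₀
    refine hC n hn A₀ hA₀.2 _ _ fun B hB => ?_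
    rw [mem_filter] at hB
    obtain ⟨h3, h4, h5, -⟩ := hF B hB.1
    exact ⟨h3, disjoint_of_subset_left hA₀.1 h4, h5, le_sub_gap hk hl hz hB.2⟩
  have h3 : ((A.powerset.filter fun S => S.card ≤ k + l).card : ℝ) ≤
      ((k + l : ℕ) + 1) * ((A.card : ℝ) + 1) ^ (k + l) := by
    exact_mod_cast card_filter_powerset_le A (k + l)
  have h4 : 0 ≤ C * (n : ℝ) ^ (θ - gap k l) := by positivity
  calc _ ≤ _ := h1
    _ ≤ _ := sum_le_sum h2
    _ = (A.powerset.filter fun S => S.card ≤ k + l).card * (C * (n : ℝ) ^ (θ - gap k l)) := by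
        rw [sum_const, nsmul_eq_mul]
    _ ≤ ((k + l : ℕ) + 1) * ((A.card : ℝ) + 1) ^ (k + l) * (C * (n : ℝ) ^ (θ - gap k l)) := by
        gcongr
    _ = _ := by ring

open scoped Classical in
/-- The weight of a member of a growing sequence. -/
noncomputable def wt (k l : ℕ) (P Λ : ℝ) (A : Finset ℕ) : ℝ :=
  P ^ A.card * if Saturated k l A then Λ else 1

lemma wt_nonneg {k l : ℕ} {P Λ : ℝ} (hP : 0 ≤ P) (hΛ : 0 ≤ Λ) (A : Finset ℕ) :
    0 ≤ wt k l P Λ A := by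
  rw [wt]
  split_ifs <;> positivity

lemma pow_card_le_wt {k l : ℕ} {P Λ : ℝ} (hP : 0 ≤ P) (hΛ : 1 ≤ Λ) (A : Finset ℕ) :
    P ^ A.card ≤ wt k l P Λ A := by
  rw [wt]
  have : 0 ≤ P ^ A.card := by positivity
  split_ifs
  · exact le_mul_of_one_le_right this hΛ
  · rw [mul_one]

lemma wt_le {k l : ℕ} {P Λ : ℝ} (hP : 0 ≤ P) (hΛ : 1 ≤ Λ) (A : Finset ℕ) :
    wt k l P Λ A ≤ P ^ A.card * Λ := by
  rw [wt]
  have : 0 ≤ P ^ A.card := by positivity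
  split_ifs
  · exact le_rfl
  · gcongr

open scoped Classical in
/-- The extensions of a set have small total weight. -/
lemma exists_sum_wt_step_le {k l : ℕ} (hk : 3 ≤ k) (hl : k < l) : ∃ C : ℝ, 0 < C ∧
    ∀ n : ℕ, 1 ≤ n → ∀ c : ℝ, 0 ≤ c → c ≤ 1 → ∀ Λ : ℝ, 1 ≤ Λ → ∀ A : Finset ℕ,
    ((A.card : ℝ) + 1) ≤ Λ →
    ∑ B ∈ (Icc 1 n).powerset.filter fun B => IsStep k l A B,
      wt k l (c * (n : ℝ) ^ (-al k l)) Λ (A ∪ B) ≤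
        (C * c + C * Λ ^ (k + l + 1) * (n : ℝ) ^ (-gap k l)) *
          wt k l (c * (n : ℝ) ^ (-al k l)) Λ A := by
  obtain ⟨C₁, hC₁0, hC₁⟩ := exists_weight_bound k l 1 (k * blockSize k l)
  obtain ⟨C₂, hC₂0, hC₂⟩ := exists_sparse_weight_bound hk hl
  refine ⟨C₁ + C₂, by positivity, fun n hn c hc0 hc1 Λ hΛ A hA => ?_⟩
  set Q : ℝ := (n : ℝ) ^ (-al k l) with hQ
  have hQ0 : 0 ≤ Q := by positivity
  have hP0 : 0 ≤ c * Q := by positivity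
  have hΛ0 : 0 ≤ Λ := by linarith
  have hPB : ∀ B : Finset ℕ, (c * Q) ^ B.card ≤ Q ^ B.card := fun B =>
    pow_le_pow_left₀ hP0 (mul_le_of_le_one_left hQ0 hc1) _
  have hPB' : ∀ B : Finset ℕ, B.Nonempty → (c * Q) ^ B.card ≤ c * Q ^ B.card := by
    intro B hB
    rw [mul_pow]
    gcongr
    exact pow_le_of_le_one hc0 hc1 (card_pos.2 hB).ne'
  have hPA : 0 ≤ (c * Q) ^ A.card := by positivity
  set F := (Icc 1 n).powerset.filter fun B => IsStep k l A B with hF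
  have hmem : ∀ B ∈ F, B ⊆ Icc 1 n ∧ IsStep k l A B := by
    intro B hB
    rw [hF, mem_filter, mem_powerset] at hB
    exact hB
  have hcard : ∀ B ∈ F, (c * Q) ^ (A ∪ B).card = (c * Q) ^ A.card * (c * Q) ^ B.card := by
    intro B hB
    rw [card_union_of_disjoint (hmem B hB).2.1, pow_add]
  rw [← sum_filter_add_sum_filter_not F fun B => Sparse k l 0 A B]
  -- The result may be saturated, which costs one more factor `Λ`; the power of `n` pays for it.
  have hsp : ∑ B ∈ F with Sparse k l 0 A B, wt k l (c * Q) Λ (A ∪ B) ≤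
      (C₂ * Λ ^ (k + l + 1) * (n : ℝ) ^ (-gap k l)) * (c * Q) ^ A.card := by
    have h1 := hC₂ n hn A 0 ⟨0, by simp⟩ (F.filter fun B => Sparse k l 0 A B) (by
      intro B hB
      rw [mem_filter] at hB
      obtain ⟨h1, h2, -, h3, -⟩ := hmem B hB.1
      exact ⟨h1, h2, h3, hB.2⟩)
    rw [zero_sub] at h1
    calc ∑ B ∈ F with Sparse k l 0 A B, wt k l (c * Q) Λ (A ∪ B)
        ≤ ∑ B ∈ F with Sparse k l 0 A B, (c * Q) ^ A.card * Λ * Q ^ B.card := by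
          refine sum_le_sum fun B hB => (wt_le hP0 hΛ _).trans ?_
          rw [hcard B (mem_filter.1 hB).1]
          calc (c * Q) ^ A.card * (c * Q) ^ B.card * Λ = (c * Q) ^ A.card * Λ * (c * Q) ^ B.card := by
                ring
            _ ≤ _ := mul_le_mul_of_nonneg_left (hPB B) (by positivity)
      _ = (c * Q) ^ A.card * Λ * ∑ B ∈ F with Sparse k l 0 A B, Q ^ B.card := by rw [mul_sum]
      _ ≤ (c * Q) ^ A.card * Λ * (C₂ * Λ ^ (k + l) * (n : ℝ) ^ (-gap k l)) := by
          gcongr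
          refine h1.trans ?_
          gcongr
      _ = _ := by ring
  have hns : ∑ B ∈ F with ¬ Sparse k l 0 A B, wt k l (c * Q) Λ (A ∪ B) ≤
      C₁ * c * wt k l (c * Q) Λ A := by
    -- The possible points of departure. If `A` is saturated there are `|A| ≤ Λ` of them, which the
    -- factor `Λ` in its weight absorbs; otherwise there is only one.
    have hX : ∃ X ⊆ A, (∀ x ∈ A, (¬ Saturated k l A → x = unsat k l A) → x ∈ X) ∧
        (X.card : ℝ) * (c * Q) ^ A.card ≤ wt k l (c * Q) Λ A := by
      by_cases hs : Saturated k l A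
      · refine ⟨A, Subset.rfl, fun x hx _ => hx, ?_⟩
        rw [wt, if_pos hs, mul_comm]
        gcongr
        linarith
      · refine ⟨{unsat k l A}, singleton_subset_iff.2 (unsat_spec hs).1, fun x _ hx => ?_, ?_⟩
        · rw [hx hs, mem_singleton]
        · rw [wt, if_neg hs, card_singleton]
          simp
    obtain ⟨X, hXA, hX, hXw⟩ := hX
    have h1 := sum_le_sum_sum_of_cover (F := F.filter fun B => ¬ Sparse k l 0 A B) (J := X)
      (G := fun x => F.filter fun B => ¬ Saturated k l (A ∪ B) ∧
        (rk k l {x} B : ℝ) ≤ al k l * B.card)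
      (fun _ B => B) (w := fun B => wt k l (c * Q) Λ (A ∪ B)) (fun B => wt_nonneg hP0 hΛ0 _) (by
        intro B hB
        rw [mem_filter] at hB
        obtain ⟨h1, x, hx, hxu, hxr⟩ := (hmem B hB.1).2.2.2.2.resolve_left hB.2
        exact ⟨x, hX x hx hxu, B, mem_filter.2 ⟨hB.1, h1, hxr⟩, rfl⟩)
    have h2 : ∀ x ∈ X, ∑ B ∈ F with ¬ Saturated k l (A ∪ B) ∧
        (rk k l {x} B : ℝ) ≤ al k l * B.card, wt k l (c * Q) Λ (A ∪ B) ≤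
        (c * Q) ^ A.card * c * C₁ := by
      intro x hx
      have h3 := hC₁ n hn {x} (by simp) 0 (F.filter fun B => ¬ Saturated k l (A ∪ B) ∧
        (rk k l {x} B : ℝ) ≤ al k l * B.card) (by
        intro B hB
        rw [mem_filter] at hB
        obtain ⟨h1, h2, -, h3, -⟩ := hmem B hB.1
        refine ⟨h1, disjoint_of_subset_left (singleton_subset_iff.2 (hXA hx)) h2, h3, ?_⟩
        rw [add_zero]
        exact hB.2.2)
      rw [Real.rpow_zero, mul_one] at h3
      calc _ ≤ ∑ B ∈ F with ¬ Saturated k l (A ∪ B) ∧ (rk k l {x} B : ℝ) ≤ al k l * B.card,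
            (c * Q) ^ A.card * c * Q ^ B.card := by
            refine sum_le_sum fun B hB => ?_
            rw [mem_filter] at hB
            rw [wt, if_neg hB.2.1, mul_one, hcard B hB.1, mul_assoc]
            gcongr
            exact hPB' B (hmem B hB.1).2.2.1
        _ = (c * Q) ^ A.card * c * ∑ B ∈ F with ¬ Saturated k l (A ∪ B) ∧
            (rk k l {x} B : ℝ) ≤ al k l * B.card, Q ^ B.card := by rw [mul_sum]
        _ ≤ _ := by gcongr
    calc _ ≤ _ := h1
      _ ≤ _ := sum_le_sum h2
      _ = C₁ * c * (X.card * (c * Q) ^ A.card) := by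
          rw [sum_const, nsmul_eq_mul]
          ring
      _ ≤ _ := by gcongr
  have hw0 := wt_nonneg (k := k) (l := l) hP0 hΛ0 A
  have hwA := pow_card_le_wt (k := k) (l := l) hP0 hΛ A
  have hE : 0 ≤ Λ ^ (k + l + 1) * (n : ℝ) ^ (-gap k l) := by positivity
  have h5 : (C₂ * Λ ^ (k + l + 1) * (n : ℝ) ^ (-gap k l)) * (c * Q) ^ A.card ≤
      (C₂ * Λ ^ (k + l + 1) * (n : ℝ) ^ (-gap k l)) * wt k l (c * Q) Λ A := by gcongr
  have h6 : 0 ≤ C₂ * c * wt k l (c * Q) Λ A := by positivity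
  have h7 : 0 ≤ C₁ * (Λ ^ (k + l + 1) * (n : ℝ) ^ (-gap k l)) * wt k l (c * Q) Λ A := by
    positivity
  calc _ ≤ _ := add_le_add hsp hns
    _ ≤ _ := by linarith

open scoped Classical in
-- Choose `c` so that balanced steps contribute at most `1 / 16` per step; the assumption on `Λ`
-- does the same for sparse steps.
lemma exists_sum_wt_fam_le {k l : ℕ} (hk : 3 ≤ k) (hl : k < l) : ∃ c C : ℝ, 0 < c ∧ c ≤ 1 ∧ 0 < C ∧
    ∀ n : ℕ, 1 ≤ n → ∀ τ : ℕ, ∀ Λ : ℝ, (blockSize k l + τ * (k * blockSize k l) + 1 : ℝ) ≤ Λ →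
    C * Λ ^ (k + l + 1) * (n : ℝ) ^ (-gap k l) ≤ 1 / 16 → ∀ t ≤ τ,
    ∑ A ∈ fam k l n t, wt k l (c * (n : ℝ) ^ (-al k l)) Λ A ≤
      (1 / 8) ^ t * (C * Λ * (n : ℝ) ^ (1 - ga k)) := by
  obtain ⟨C₀, hC₀0, hC₀⟩ := exists_weight_bound k l 0 (blockSize k l)
  obtain ⟨C₁, hC₁0, hC₁⟩ := exists_sum_wt_step_le hk hl
  have hc0 : 0 < min 1 (1 / (16 * C₁)) := by positivity
  have hc1 : min 1 (1 / (16 * C₁)) ≤ 1 := min_le_left _ _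
  have hcC : C₁ * min 1 (1 / (16 * C₁)) ≤ 1 / 16 := by
    calc C₁ * min 1 (1 / (16 * C₁)) ≤ C₁ * (1 / (16 * C₁)) := by
          gcongr
          exact min_le_right _ _
      _ = 1 / 16 := by field_simp
  generalize min 1 (1 / (16 * C₁)) = c at hc0 hc1 hcC
  refine ⟨c, C₀ + C₁, hc0, hc1, by positivity, fun n hn τ Λ hΛ hsmall t => ?_⟩
  have hΛ1 : 1 ≤ Λ := by
    have : (0 : ℝ) ≤ blockSize k l + τ * (k * blockSize k l) := by positivity
    linarith
  have hΛ0 : 0 ≤ Λ := by linarith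
  have hP0 : 0 ≤ c * (n : ℝ) ^ (-al k l) := by positivity
  induction t with
  | zero =>
    intro _
    have h1 := hC₀ n hn ∅ (by simp) (1 - ga k) (fam k l n 0) (by
      intro B hB
      rw [fam, mem_filter, mem_powerset] at hB
      exact ⟨hB.1, disjoint_empty_left _, hB.2.1, hB.2.2⟩)
    rw [pow_zero, one_mul]
    calc ∑ A ∈ fam k l n 0, wt k l (c * (n : ℝ) ^ (-al k l)) Λ A
        ≤ ∑ A ∈ fam k l n 0, ((n : ℝ) ^ (-al k l)) ^ A.card * Λ := by
          refine sum_le_sum fun A _ => (wt_le hP0 hΛ1 A).trans ?_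
          refine mul_le_mul_of_nonneg_right (pow_le_pow_left₀ hP0 ?_ _) hΛ0
          exact mul_le_of_le_one_left (by positivity) hc1
      _ = (∑ A ∈ fam k l n 0, ((n : ℝ) ^ (-al k l)) ^ A.card) * Λ := by rw [sum_mul]
      _ ≤ C₀ * (n : ℝ) ^ (1 - ga k) * Λ := by gcongr
      _ ≤ C₀ * (n : ℝ) ^ (1 - ga k) * Λ + C₁ * (n : ℝ) ^ (1 - ga k) * Λ :=
          le_add_of_nonneg_right (by positivity)
      _ = _ := by ring
  | succ t ih =>
    intro ht
    have h1 := ih (by omega)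
    have h2 := sum_le_sum_sum_of_cover (F := fam k l n (t + 1)) (J := fam k l n t)
      (G := fun A => (Icc 1 n).powerset.filter fun B => IsStep k l A B) (fun A B => A ∪ B)
      (w := fun A => wt k l (c * (n : ℝ) ^ (-al k l)) Λ A) (fun A => wt_nonneg hP0 hΛ0 A) (by
        intro A hA
        obtain ⟨A', hA', B, hB, h3, h4⟩ := mem_fam_succ.1 hA
        exact ⟨A', hA', B, mem_filter.2 ⟨mem_powerset.2 hB, h3⟩, h4⟩)
    have h3 : ∀ A ∈ fam k l n t, ∑ B ∈ (Icc 1 n).powerset.filter fun B => IsStep k l A B,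
        wt k l (c * (n : ℝ) ^ (-al k l)) Λ (A ∪ B) ≤
          1 / 8 * wt k l (c * (n : ℝ) ^ (-al k l)) Λ A := by
      intro A hA
      have hA1 : ((A.card : ℕ) : ℝ) ≤ ((blockSize k l + τ * (k * blockSize k l) : ℕ) : ℝ) := by
        refine Nat.cast_le.2 ((card_fam hA).trans ?_)
        gcongr
        omega
      push_cast at hA1
      refine (hC₁ n hn c hc0.le hc1 Λ hΛ1 A (by linarith)).trans ?_
      refine mul_le_mul_of_nonneg_right ?_ (wt_nonneg hP0 hΛ0 A)
      have h4 : 0 ≤ C₀ * Λ ^ (k + l + 1) * (n : ℝ) ^ (-gap k l) := by positivity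
      linarith
    calc _ ≤ _ := h2
      _ ≤ _ := sum_le_sum h3
      _ = 1 / 8 * ∑ A ∈ fam k l n t, wt k l (c * (n : ℝ) ^ (-al k l)) Λ A := by rw [mul_sum]
      _ ≤ 1 / 8 * ((1 / 8) ^ t * ((C₀ + C₁) * Λ * (n : ℝ) ^ (1 - ga k))) := by gcongr
      _ = _ := by ring

/-! ### The random set -/

open MeasureTheory Measure in
lemma setBernoulli_real_superset {n : ℕ} (p : I) {T : Finset ℕ} (hT : T ⊆ Icc 1 n) :
    (setBernoulli (Set.Icc 1 n) p).real {S | (T : Set ℕ) ⊆ S} = (p : ℝ) ^ T.card := by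
  classical
  have h : setBernoulli (Set.Icc 1 n) p {S | (T : Set ℕ) ⊆ S} =
      (unitInterval.toNNReal p : ENNReal) ^ T.card := by
    rw [setBernoulli_apply']
    have hpre : ((fun q : ℕ → Prop => {i | q i}) ⁻¹' {S | (T : Set ℕ) ⊆ S}) =
        Set.pi (T : Set ℕ) fun _ => {True} := by
      ext q
      simp [Set.subset_def, Set.mem_pi]
    rw [hpre, infinitePi_pi _ (fun _ _ => by measurability), ← prod_const]
    refine prod_congr rfl fun i hi => ?_
    have := mem_Icc.1 (hT hi)
    simp [this]
  rw [measureReal_def, h]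
  simp

open MeasureTheory in
lemma setBernoulli_real_exists_superset_le {n : ℕ} (p : I) {P : ℝ} (hp : (p : ℝ) ≤ P)
    {F : Finset (Finset ℕ)} (hF : ∀ T ∈ F, T ⊆ Icc 1 n) :
    (setBernoulli (Set.Icc 1 n) p).real {S | ∃ T ∈ F, (T : Set ℕ) ⊆ S} ≤
      ∑ T ∈ F, P ^ T.card := by
  have h : {S : Set ℕ | ∃ T ∈ F, (T : Set ℕ) ⊆ S} = ⋃ T ∈ F, {S | (T : Set ℕ) ⊆ S} := by
    ext S
    simp
  rw [h]
  refine (measureReal_biUnion_finset_le F _).trans (sum_le_sum fun T hT => ?_)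
  rw [setBernoulli_real_superset p (hF T hT)]
  exact pow_le_pow_left₀ p.2.1 hp _

open scoped Classical in
/-- The supports of the extensions that should not occur. -/
noncomputable def deadFam (k l n τ : ℕ) : Finset (Finset ℕ) :=
  (range τ).biUnion fun t => (fam k l n t).biUnion fun A =>
    ((Icc 1 n).powerset.filter fun B => IsDead k l A B).image fun B => A ∪ B

open scoped Classical in
/-- The small sets with too few degrees of freedom. -/
noncomputable def denseFam (k l n : ℕ) : Finset (Finset ℕ) :=
  (Icc 1 n).powerset.filter fun S => S.card ≤ blockSize k l ∧
    (rk k l ∅ S : ℝ) < al k l * S.card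

lemma mem_deadFam {k l n τ : ℕ} {T : Finset ℕ} : T ∈ deadFam k l n τ ↔
    ∃ t < τ, ∃ A ∈ fam k l n t, ∃ B ⊆ Icc 1 n, IsDead k l A B ∧ A ∪ B = T := by
  classical
  simp only [deadFam, mem_biUnion, mem_image, mem_filter, mem_powerset, and_assoc, mem_range]

/-- The reason why a random set may fail to be colorable. -/
lemma exists_subset_of_not_colorable {k l n : ℕ} (hk : 3 ≤ k) (hl : k < l) (τ : ℕ) {X : Finset ℕ}
    (hX : X ⊆ Icc 1 n) (h : ¬ Colorable k l X) :
    (∃ T ∈ denseFam k l n, T ⊆ X) ∨ (∃ T ∈ fam k l n τ, T ⊆ X) ∨ ∃ T ∈ deadFam k l n τ, T ⊆ X := by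
  classical
  by_cases hS : SmallFree k l X
  swap
  · left
    rw [SmallFree] at hS
    push Not at hS
    obtain ⟨S, h1, h2, h3⟩ := hS
    exact ⟨S, mem_filter.2 ⟨mem_powerset.2 (h1.trans hX), h2, h3⟩, h1⟩
  right
  obtain ⟨V, hVX, hV⟩ := exists_minimalNonColorable h
  rcases exists_long_growth hk hl hV (fun S hSV => hS S (hSV.trans hVX)) (hVX.trans hX) τ with
    ⟨A, hA, hcl, -⟩ | ⟨t, ht, A, hA, B, hB, hAB⟩
  · exact Or.inl ⟨A, hA, hcl.1.trans hVX⟩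
  · exact Or.inr ⟨A ∪ B, mem_deadFam.2 ⟨t, ht, A, hA, B,
      subset_union_right.trans (hAB.trans (hVX.trans hX)), hB, rfl⟩, hAB.trans hVX⟩

open MeasureTheory in
-- The colorable event and the three obstruction events cover the whole space. Only subadditivity is
-- used, so no measurability of the colorable event is needed.
lemma one_le_probAsymTwoColorable_add {k l n : ℕ} (hk : 3 ≤ k) (hl : k < l) (τ : ℕ) (p : I)
    {P : ℝ} (hp : (p : ℝ) ≤ P) :
    1 ≤ probAsymTwoColorable n l k p + (∑ T ∈ denseFam k l n, P ^ T.card +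
      (∑ T ∈ fam k l n τ, P ^ T.card + ∑ T ∈ deadFam k l n τ, P ^ T.card)) := by
  classical
  set G := {S : Set ℕ | ((apHypergraph n l k).inducedOn S).AsymTwoColorable l k} with hG
  have h1 : ∀ S : Set ℕ, S ∈ G ∪ ({S | ∃ T ∈ denseFam k l n, (T : Set ℕ) ⊆ S} ∪
      ({S | ∃ T ∈ fam k l n τ, (T : Set ℕ) ⊆ S} ∪ {S | ∃ T ∈ deadFam k l n τ, (T : Set ℕ) ⊆ S})) := by
    intro S
    by_cases hc : Colorable k l ((Icc 1 n).filter (· ∈ S))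
    · exact Or.inl (asymTwoColorable_of_colorable hl.ne' hc)
    have hsub : ∀ T : Finset ℕ, T ⊆ (Icc 1 n).filter (· ∈ S) → (T : Set ℕ) ⊆ S := fun T hT x hx =>
      (mem_filter.1 (hT hx)).2
    rcases exists_subset_of_not_colorable hk hl τ (filter_subset _ _) hc with
      ⟨T, hT, hTS⟩ | ⟨T, hT, hTS⟩ | ⟨T, hT, hTS⟩
    · exact Or.inr (Or.inl ⟨T, hT, hsub T hTS⟩)
    · exact Or.inr (Or.inr (Or.inl ⟨T, hT, hsub T hTS⟩))
    · exact Or.inr (Or.inr (Or.inr ⟨T, hT, hsub T hTS⟩))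
  have h2 := Set.eq_univ_of_forall h1
  have h3 : (setBernoulli (Set.Icc 1 n) p).real Set.univ = 1 := probReal_univ
  rw [← h2] at h3
  rw [← h3, probAsymTwoColorable]
  refine (measureReal_union_le _ _).trans (add_le_add le_rfl ?_)
  refine (measureReal_union_le _ _).trans (add_le_add ?_ ?_)
  · refine setBernoulli_real_exists_superset_le p hp fun T hT => ?_
    exact mem_powerset.1 (mem_filter.1 hT).1
  refine (measureReal_union_le _ _).trans (add_le_add ?_ ?_)
  · exact setBernoulli_real_exists_superset_le p hp fun T hT => fam_subset hT
  · refine setBernoulli_real_exists_superset_le p hp fun T hT => ?_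
    obtain ⟨t, -, A, hA, B, hB, -, rfl⟩ := mem_deadFam.1 hT
    exact union_subset (fam_subset hA) hB

lemma exists_prob_bound {k l : ℕ} (hk : 3 ≤ k) (hl : k < l) : ∃ c C : ℝ, 0 < c ∧ 0 < C ∧
    ∀ n : ℕ, 1 ≤ n → ∀ τ : ℕ, ∀ Λ : ℝ, (blockSize k l + τ * (k * blockSize k l) + 1 : ℝ) ≤ Λ →
    C * Λ ^ (k + l + 1) * (n : ℝ) ^ (-gap k l) ≤ 1 / 16 →
    ∀ p : I, (p : ℝ) ≤ c * (n : ℝ) ^ (-al k l) →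
    1 - (C * (n : ℝ) ^ (-gap k l) + ((1 / 8) ^ τ * (C * Λ * (n : ℝ) ^ (1 - ga k)) +
      τ * (C * Λ ^ (k + l + 1) * (n : ℝ) ^ (-gap k l)))) ≤ probAsymTwoColorable n l k p := by
  classical
  obtain ⟨c, C₁, hc0, hc1, hC₁0, hC₁⟩ := exists_sum_wt_fam_le hk hl
  obtain ⟨C₂, hC₂0, hC₂⟩ := exists_sparse_weight_bound hk hl
  refine ⟨c, C₁ + C₂ + C₁ * C₂, hc0, by positivity, fun n hn τ Λ hΛ hsmall p hp => ?_⟩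
  have hn0 : (0 : ℝ) < n := by exact_mod_cast hn
  have hΛ1 : 1 ≤ Λ := by
    have : (0 : ℝ) ≤ blockSize k l + τ * (k * blockSize k l) := by positivity
    linarith
  have hΛ0 : 0 ≤ Λ := by linarith
  set Q : ℝ := (n : ℝ) ^ (-al k l) with hQ
  have hQ0 : 0 ≤ Q := by positivity
  have hP0 : 0 ≤ c * Q := by positivity
  have hPB : ∀ B : Finset ℕ, (c * Q) ^ B.card ≤ Q ^ B.card := fun B =>
    pow_le_pow_left₀ hP0 (mul_le_of_le_one_left hQ0 hc1) _
  have hfam : ∀ t ≤ τ, ∑ A ∈ fam k l n t, (c * Q) ^ A.card ≤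
      (1 / 8) ^ t * (C₁ * Λ * (n : ℝ) ^ (1 - ga k)) := by
    intro t ht
    refine (sum_le_sum fun A _ => pow_card_le_wt (k := k) (l := l) hP0 hΛ1 A).trans
      (hC₁ n hn τ Λ hΛ ?_ t ht)
    refine le_trans ?_ hsmall
    gcongr
    have : 0 ≤ C₂ + C₁ * C₂ := by positivity
    linarith
  have hdense : ∑ T ∈ denseFam k l n, (c * Q) ^ T.card ≤ C₂ * (n : ℝ) ^ (-gap k l) := by
    have h1 := hC₂ n hn ∅ 0 ⟨0, by simp⟩ (denseFam k l n) (by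
      intro B hB
      rw [denseFam, mem_filter, mem_powerset] at hB
      refine ⟨hB.1, disjoint_empty_left _, hB.2.1.trans (Nat.le_mul_of_pos_left _ (by omega)),
        ∅, Subset.rfl, by simp, ?_⟩
      rw [add_zero]
      exact hB.2.2)
    rw [zero_sub, card_empty, Nat.cast_zero, zero_add, one_pow, mul_one] at h1
    exact (sum_le_sum fun B _ => hPB B).trans h1
  have hdead : ∑ T ∈ deadFam k l n τ, (c * Q) ^ T.card ≤
      τ * (C₁ * C₂ * Λ ^ (k + l + 1) * (n : ℝ) ^ (-gap k l)) := by
    have h1 := sum_le_sum_sum_of_cover (F := deadFam k l n τ) (J := (range τ).sigma fun t => fam k l n t)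
      (G := fun x => (Icc 1 n).powerset.filter fun B => IsDead k l x.2 B) (fun x B => x.2 ∪ B)
      (w := fun A => (c * Q) ^ A.card) (fun A => by positivity) (by
        intro T hT
        obtain ⟨t, ht, A, hA, B, hB, h1, h2⟩ := mem_deadFam.1 hT
        exact ⟨⟨t, A⟩, mem_sigma.2 ⟨mem_range.2 ht, hA⟩, B,
          mem_filter.2 ⟨mem_powerset.2 hB, h1⟩, h2⟩)
    rw [sum_sigma] at h1
    have h2 : ∀ t ∈ range τ, ∀ A ∈ fam k l n t,
        ∑ B ∈ (Icc 1 n).powerset.filter fun B => IsDead k l A B, (c * Q) ^ (A ∪ B).card ≤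
        (c * Q) ^ A.card * (C₂ * Λ ^ (k + l) * (n : ℝ) ^ (-(1 - ga k) - gap k l)) := by
      intro t ht A hA
      have hA1 : ((A.card : ℕ) : ℝ) ≤ ((blockSize k l + τ * (k * blockSize k l) : ℕ) : ℝ) := by
        refine Nat.cast_le.2 ((card_fam hA).trans ?_)
        rw [mem_range] at ht
        gcongr
      push_cast at hA1
      -- A dead step gains `n ^ (-(1 - ga) - gap)`, which cancels the `n ^ (1 - ga)` of the starting
      -- blocks.
      have h3 := hC₂ n hn A (-(1 - ga k)) ⟨-(l * (k - 1) - l), by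
        have := ga_mul hk
        push_cast
        linear_combination (l : ℝ) * this⟩
        ((Icc 1 n).powerset.filter fun B => IsDead k l A B) (by
          intro B hB
          rw [mem_filter, mem_powerset] at hB
          exact ⟨hB.1, hB.2⟩)
      calc ∑ B ∈ (Icc 1 n).powerset.filter fun B => IsDead k l A B, (c * Q) ^ (A ∪ B).card
          ≤ ∑ B ∈ (Icc 1 n).powerset.filter fun B => IsDead k l A B, (c * Q) ^ A.card * Q ^ B.card := by
            refine sum_le_sum fun B hB => ?_
            rw [card_union_of_disjoint (mem_filter.1 hB).2.1, pow_add]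
            exact mul_le_mul_of_nonneg_left (hPB B) (by positivity)
        _ = (c * Q) ^ A.card * ∑ B ∈ (Icc 1 n).powerset.filter fun B => IsDead k l A B,
            Q ^ B.card := by rw [mul_sum]
        _ ≤ (c * Q) ^ A.card *
            (C₂ * ((A.card : ℝ) + 1) ^ (k + l) * (n : ℝ) ^ (-(1 - ga k) - gap k l)) := by gcongr
        _ ≤ _ := by
            gcongr
            linarith
    have h3 : ∀ t ∈ range τ, ∑ A ∈ fam k l n t,
        ∑ B ∈ (Icc 1 n).powerset.filter fun B => IsDead k l A B, (c * Q) ^ (A ∪ B).card ≤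
        C₁ * C₂ * Λ ^ (k + l + 1) * (n : ℝ) ^ (-gap k l) := by
      intro t ht
      refine (sum_le_sum (h2 t ht)).trans ?_
      rw [← sum_mul]
      have h4 : ∑ A ∈ fam k l n t, (c * Q) ^ A.card ≤ C₁ * Λ * (n : ℝ) ^ (1 - ga k) := by
        refine (hfam t (mem_range.1 ht).le).trans (mul_le_of_le_one_left (by positivity) ?_)
        exact pow_le_one₀ (by norm_num) (by norm_num)
      have h5 : (n : ℝ) ^ (1 - ga k) * (n : ℝ) ^ (-(1 - ga k) - gap k l) = (n : ℝ) ^ (-gap k l) := by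
        rw [← Real.rpow_add hn0]
        congr 1
        ring
      calc _ ≤ C₁ * Λ * (n : ℝ) ^ (1 - ga k) *
            (C₂ * Λ ^ (k + l) * (n : ℝ) ^ (-(1 - ga k) - gap k l)) := by gcongr
        _ = C₁ * C₂ * Λ ^ (k + l + 1) *
            ((n : ℝ) ^ (1 - ga k) * (n : ℝ) ^ (-(1 - ga k) - gap k l)) := by ring
        _ = _ := by rw [h5]
    refine h1.trans ((sum_le_sum h3).trans ?_)
    rw [sum_const, card_range, nsmul_eq_mul]
  have hmain := one_le_probAsymTwoColorable_add (n := n) hk hl τ p hp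
  have hfam' := hfam τ le_rfl
  have e1 : 0 ≤ (C₁ + C₁ * C₂) * (n : ℝ) ^ (-gap k l) := by positivity
  have e2 : 0 ≤ (1 / 8) ^ τ * ((C₂ + C₁ * C₂) * Λ * (n : ℝ) ^ (1 - ga k)) := by positivity
  have e3 : 0 ≤ τ * ((C₁ + C₂) * Λ ^ (k + l + 1) * (n : ℝ) ^ (-gap k l)) := by positivity
  linarith

/-! ### The limit. -/

lemma tendsto_log_pow_mul_rpow (m : ℕ) {κ : ℝ} (hκ : 0 < κ) :
    Tendsto (fun n : ℕ => (Real.log n + 2) ^ m * (n : ℝ) ^ (-κ)) atTop (𝓝 0) := by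
  have h1 : (fun x : ℝ => Real.log x + 2) =O[atTop] Real.log :=
    (Asymptotics.isBigO_refl _ _).add (Real.isLittleO_const_log_atTop (c := 2)).isBigO
  have h2 : (fun x : ℝ => Real.log x ^ m) =o[atTop] fun x => x ^ κ := by
    simpa using isLittleO_log_rpow_rpow_atTop (m : ℝ) hκ
  have h3 := ((h1.pow m).trans_isLittleO h2).tendsto_div_nhds_zero
  refine (h3.comp tendsto_natCast_atTop_atTop).congr fun n => ?_
  rw [Function.comp_apply, Real.rpow_neg (Nat.cast_nonneg n), div_eq_mul_inv]

end AsymVdW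

open AsymVdW in
theorem mainTheorem3 (q₁ q₂ : ℕ) (hq₂ : 3 ≤ q₂) (hq : q₂ < q₁) :
    ∃ c : ℝ, 0 < c ∧ ∀ p : ℕ → I,
      (∀ᶠ n : ℕ in atTop,
        (p n : ℝ) ≤ c * (n : ℝ) ^ (-((q₂ : ℝ) / ((q₁ : ℝ) * ((q₂ : ℝ) - 1))))) →
      Tendsto (fun n : ℕ => probAsymTwoColorable n q₁ q₂ (p n)) atTop (𝓝 1) := by
  obtain ⟨c, C, hc, hC, h⟩ := exists_prob_bound hq₂ hq
  refine ⟨c, hc, fun p hp => ?_⟩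
  set D : ℝ := blockSize q₂ q₁ + q₂ * blockSize q₂ q₁ + 1 with hD
  have hD1 : 1 ≤ D := by
    have : (0 : ℝ) ≤ blockSize q₂ q₁ + q₂ * blockSize q₂ q₁ := by positivity
    linarith
  have hκ := gap_pos hq₂ hq
  have hκ1 : gap q₂ q₁ ≤ ga q₂ := by
    have h1 : (3 : ℝ) ≤ q₂ := by exact_mod_cast hq₂
    have h2 : (q₂ : ℝ) < q₁ := by exact_mod_cast hq
    refine one_div_le_one_div_of_le (by linarith) ?_
    nlinarith
  have hγ := ga_le hq₂
  have hlim : Tendsto (fun n : ℕ => C * D ^ (q₂ + q₁ + 2) *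
      ((Real.log n + 2) ^ (q₂ + q₁ + 2) * (n : ℝ) ^ (-gap q₂ q₁))) atTop (𝓝 0) := by
    simpa using (tendsto_log_pow_mul_rpow (q₂ + q₁ + 2) hκ).const_mul (C * D ^ (q₂ + q₁ + 2))
  have hev : ∀ᶠ n : ℕ in atTop, 1 - 3 * (C * D ^ (q₂ + q₁ + 2) *
      ((Real.log n + 2) ^ (q₂ + q₁ + 2) * (n : ℝ) ^ (-gap q₂ q₁))) ≤
      probAsymTwoColorable n q₁ q₂ (p n) := by
    filter_upwards [hp, eventually_ge_atTop 1, hlim.eventually_le_const (by norm_num :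
      (0 : ℝ) < 1 / 16)] with n hpn hn hsmall
    have hn1 : (1 : ℝ) ≤ n := by exact_mod_cast hn
    have hn0 : (0 : ℝ) < n := by linarith
    have hlog : 0 ≤ Real.log n := Real.log_nonneg hn1
    -- As `8 > e`, this many steps give `(1 / 8) ^ τ ≤ 1 / n`, enough to beat `n ^ (1 - ga)`, while
    -- `Λ` stays logarithmic in `n`.
    set τ := ⌈Real.log n⌉₊ with hτ
    have hτ1 : (τ : ℝ) ≤ Real.log n + 1 := (Nat.ceil_lt_add_one hlog).le
    have hτ2 : Real.log n ≤ τ := Nat.le_ceil _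
    set Λ : ℝ := D * (Real.log n + 2) with hΛdef
    have hΛ : (blockSize q₂ q₁ + τ * (q₂ * blockSize q₂ q₁) + 1 : ℝ) ≤ Λ := by
      have h1 : (τ : ℝ) * (q₂ * blockSize q₂ q₁) ≤ (Real.log n + 2) * (q₂ * blockSize q₂ q₁) := by
        gcongr
        linarith
      have h2 : (1 : ℝ) * (blockSize q₂ q₁ + 1) ≤ (Real.log n + 2) * (blockSize q₂ q₁ + 1) := by
        gcongr
        linarith
      rw [hΛdef, hD]
      linarith
    have hτΛ : (τ : ℝ) ≤ Λ := by
      have : 1 * (Real.log n + 2) ≤ D * (Real.log n + 2) := by gcongr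
      linarith
    have hΛ1 : 1 ≤ Λ := by
      have : 1 * (Real.log n + 2) ≤ D * (Real.log n + 2) := by gcongr
      linarith
    have hΛ0 : 0 ≤ Λ := by linarith
    rw [show C * D ^ (q₂ + q₁ + 2) * ((Real.log n + 2) ^ (q₂ + q₁ + 2) * (n : ℝ) ^ (-gap q₂ q₁)) =
      C * Λ ^ (q₂ + q₁ + 2) * (n : ℝ) ^ (-gap q₂ q₁) by rw [hΛdef, mul_pow]; ring] at hsmall ⊢
    have hmain := h n hn τ Λ hΛ (le_trans (by gcongr; omega) hsmall) (p n) hpn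
    have e1 : C * (n : ℝ) ^ (-gap q₂ q₁) ≤ C * Λ ^ (q₂ + q₁ + 2) * (n : ℝ) ^ (-gap q₂ q₁) := by
      gcongr
      exact le_mul_of_one_le_right hC.le (one_le_pow₀ hΛ1)
    have e3 : τ * (C * Λ ^ (q₂ + q₁ + 1) * (n : ℝ) ^ (-gap q₂ q₁)) ≤
        C * Λ ^ (q₂ + q₁ + 2) * (n : ℝ) ^ (-gap q₂ q₁) := by
      calc _ ≤ Λ * (C * Λ ^ (q₂ + q₁ + 1) * (n : ℝ) ^ (-gap q₂ q₁)) := by gcongr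
        _ = _ := by ring
    have e2 : (1 / 8) ^ τ * (C * Λ * (n : ℝ) ^ (1 - ga q₂)) ≤
        C * Λ ^ (q₂ + q₁ + 2) * (n : ℝ) ^ (-gap q₂ q₁) := by
      have h8 : ((1 : ℝ) / 8) ^ τ ≤ (n : ℝ) ^ (-1 : ℝ) := by
        have h1 : (1 : ℝ) / 8 ≤ Real.exp (-1) := by
          rw [Real.exp_neg, one_div]
          exact inv_anti₀ (Real.exp_pos 1) (by linarith [Real.exp_one_lt_d9])
        calc ((1 : ℝ) / 8) ^ τ ≤ Real.exp (-1) ^ τ := by gcongr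
          _ = Real.exp (τ * (-1)) := (Real.exp_nat_mul _ _).symm
          _ ≤ Real.exp (Real.log n * (-1)) := Real.exp_le_exp.2 (by linarith)
          _ = _ := (Real.rpow_def_of_pos hn0 _).symm
      have hne : (n : ℝ) ^ (-1 : ℝ) * (n : ℝ) ^ (1 - ga q₂) ≤ (n : ℝ) ^ (-gap q₂ q₁) := by
        rw [← Real.rpow_add hn0]
        exact Real.rpow_le_rpow_of_exponent_le hn1 (by linarith)
      have hΛ2 : Λ ≤ Λ ^ (q₂ + q₁ + 2) := le_self_pow₀ hΛ1 (by omega)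
      calc (1 / 8) ^ τ * (C * Λ * (n : ℝ) ^ (1 - ga q₂))
          ≤ (n : ℝ) ^ (-1 : ℝ) * (C * Λ * (n : ℝ) ^ (1 - ga q₂)) := by gcongr
        _ = C * Λ * ((n : ℝ) ^ (-1 : ℝ) * (n : ℝ) ^ (1 - ga q₂)) := by ring
        _ ≤ C * Λ ^ (q₂ + q₁ + 2) * (n : ℝ) ^ (-gap q₂ q₁) := by gcongr
    linarith
  refine tendsto_of_tendsto_of_tendsto_of_le_of_le' (h := fun _ => 1) ?_ tendsto_const_nhds hev
    (Eventually.of_forall fun n => MeasureTheory.measureReal_le_one)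
  simpa using (hlim.const_mul 3).const_sub 1
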